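/- Let $u\colon\mathbb R^3\to\mathbb R^3$ be a smooth involution whose fixed point set is non-empty and whose differential at every fixed point is diagonalizable with eigenvalues $1,-1,-1$. For $i=0,1$ let $S_i\subset\mathbb R^3$ be a compact connected smoothly embedded surface (possibly with boundary) with $u(S_i)=S_i$, equipped with an area form $\Omega_i$ such that $u^*\Omega_i=\Omega_i$. Let $U_i\supseteq S_i$ be a $u$-invariant open set (for instance $U_i=\mathbb R^3$) and let $\xi_i=\ker\alpha_i$ be an invariant contact structure on $U_i$, that is, $\alpha_i$ is a smooth $1$-form on $U_i$ with $\alpha_i\wedge d\alpha_i>0$ and $u^*\alpha_i=-\alpha_i$. Let $X_i$ be the vector field on $S_i$ determined by $\Omega_i(X_i,\cdot)=\alpha_i|_{TS_i}$, which represents the characteristic foliation of $\xi_i$ on $S_i$. Let $\phi\colon S_0\to S_1$ be a diffeomorphism with $\phi\circ u=u\circ\phi$ on $S_0$ that matches the characteristic foliations, that is, $X_1=f\,\phi_*X_0$ for some smooth function $f\colon S_1\to(0,\infty)$ with $f\circ u=f$. Then there exist $u$-invariant open neighborhoods $\mathcal N(S_0)\subseteq U_0$ of $S_0$ and $\mathcal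 N(S_1)\subseteq U_1$ of $S_1$ and a diffeomorphism $\psi\colon\mathcal N(S_0)\to\mathcal N(S_1)$ such that $\psi\circ u=u\circ\psi$, $T\psi(\xi_0)=\xi_1$, and $\psi|_{S_0}=\phi$. -/

import Mathlib

open Set
open scoped ContDiff

noncomputable section

namespace EquivContact

/-- Euclidean three-space, with the orientation given by its standard basis. -/
abbrev R3 : Type := EuclideanSpace ℝ (Fin 3)

/-- The standard basis vectors of `R3`. -/
def stdVec (i : Fin 3) : R3 := EuclideanSpace.single i (1 : ℝ)

/-- Smooth involutions of `R3` with non-empty fixed point set, whose differential at every fixed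
point is diagonalizable as `[1] ⊕ [-1] ⊕ [-1]`. -/
structure IsAxialInvolution (u : R3 → R3) : Prop where
  smooth : ContDiff ℝ ∞ u
  involutive : Function.Involutive u
  exists_fixed : ∃ p, u p = p
  diagonal : ∀ p, u p = p → ∃ b : Module.Basis (Fin 3) ℝ R3,
    fderiv ℝ u p (b 0) = b 0 ∧ fderiv ℝ u p (b 1) = -b 1 ∧ fderiv ℝ u p (b 2) = -b 2

/-- Smoothness of a map on an arbitrary subset of `R3`: locally, the map is the restriction of a
smooth map defined on an open subset of `R3`. -/
def SmoothOnSet {F : Type*} [NormedAddCommGroup F] [NormedSpace ℝ F] (f : R3 → F) (S : Set R3) :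
    Prop :=
  ∀ p ∈ S, ∃ (V : Set R3) (g : R3 → F), IsOpen V ∧ p ∈ V ∧ ContDiffOn ℝ ∞ g V ∧ EqOn f g (S ∩ V)

/-- Compact connected smooth surfaces embedded in `R3`, possibly with boundary. Around each of its
points there are smooth coordinates of `R3` in which the surface is a piece of a plane (around
interior points) or of a closed half-plane (around boundary points). -/
structure IsCompactSurface (S : Set R3) : Prop where
  compact : IsCompact S
  connected : IsConnected S
  chart : ∀ p ∈ S, ∃ e : OpenPartialHomeomorph R3 R3, p ∈ e.source ∧
    ContDiffOn ℝ ∞ e e.source ∧ ContDiffOn ℝ ∞ e.symm e.target ∧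
    ((∀ x ∈ e.source, x ∈ S ↔ e x 2 = 0) ∨ (∀ x ∈ e.source, x ∈ S ↔ e x 2 = 0 ∧ 0 ≤ e x 1))

/-- The tangent plane `T_p S` of an embedded surface (possibly with boundary), as a subspace of
`R3`: the linear span of all limits of rescaled secant vectors of `S` at `p`. -/
def tangentPlane (S : Set R3) (p : R3) : Submodule ℝ R3 :=
  Submodule.span ℝ (tangentConeAt ℝ S p)

/-- `S` is preserved by `u`, and the 2-form `Ω` (of which only the restriction to the tangent planes
of `S` matters) is a `u`-invariant area form on `S`. -/
structure IsInvariantAreaForm (u : R3 → R3) (S : Set R3) (Ω : R3 → R3 [⋀^Fin 2]→L[ℝ] ℝ) :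
    Prop where
  mapsTo : MapsTo u S S
  smooth : SmoothOnSet Ω S
  nonvanishing : ∀ p ∈ S, ∃ v ∈ tangentPlane S p, ∃ w ∈ tangentPlane S p, Ω p ![v, w] ≠ 0
  invariant : ∀ p ∈ S, ∀ v ∈ tangentPlane S p, ∀ w ∈ tangentPlane S p,
    Ω (u p) ![fderiv ℝ u p v, fderiv ℝ u p w] = Ω p ![v, w]

/-- A `u`-oriented compact surface `(S, Ω)`. -/
structure IsUOrientedCompactSurface (u : R3 → R3) (S : Set R3) (Ω : R3 → R3 [⋀^Fin 2]→L[ℝ] ℝ) :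
    Prop where
  surface : IsCompactSurface S
  area : IsInvariantAreaForm u S Ω

/-- The exterior derivative `dα` of a 1-form. -/
def dForm (α : R3 → R3 →L[ℝ] ℝ) (p : R3) : R3 [⋀^Fin 2]→L[ℝ] ℝ :=
  extDeriv (fun x => ContinuousAlternatingMap.ofSubsingleton ℝ R3 ℝ (0 : Fin 1) (α x)) p

/-- The value of `α ∧ dα` at `p` on the standard basis of `R3`. -/
def contactVolume (α : R3 → R3 →L[ℝ] ℝ) (p : R3) : ℝ :=
  α p (stdVec 0) * dForm α p ![stdVec 1, stdVec 2] +
    α p (stdVec 1) * dForm α p ![stdVec 2, stdVec 0] +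
    α p (stdVec 2) * dForm α p ![stdVec 0, stdVec 1]

/-- `α` is a positive contact form on the `u`-invariant open set `U`, with `u^* α = -α`; that is,
`ker α` is an invariant positively cooriented contact structure on `U`. -/
structure IsInvariantContactForm (u : R3 → R3) (U : Set R3) (α : R3 → R3 →L[ℝ] ℝ) : Prop where
  isOpen : IsOpen U
  mapsTo : MapsTo u U U
  smooth : ContDiffOn ℝ ∞ α U
  positive : ∀ p ∈ U, 0 < contactVolume α p
  antiInvariant : ∀ p ∈ U, ∀ v : R3, α (u p) (fderiv ℝ u p v) = -α p v

/-- The contact plane at `p` of the contact structure `ξ = ker α`. -/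
def contactPlane (α : R3 → R3 →L[ℝ] ℝ) (p : R3) : Submodule ℝ R3 :=
  LinearMap.ker (α p : R3 →ₗ[ℝ] ℝ)

/-- `X` is the vector field on `S` with `i_X Ω = α|_{TS}` (contraction in the first entry). It
represents the characteristic foliation of `ker α` on `(S, Ω)`. On the points of `S` it is uniquely
determined, and it is smooth because `Ω` and `α` are. -/
def IsCharacteristicField (S : Set R3) (Ω : R3 → R3 [⋀^Fin 2]→L[ℝ] ℝ) (α : R3 → R3 →L[ℝ] ℝ)
    (X : R3 → R3) : Prop :=
  ∀ p ∈ S, X p ∈ tangentPlane S p ∧ ∀ v ∈ tangentPlane S p, Ω p ![X p, v] = α p v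

/-- Two vector fields on `S` represent the same singular foliation: they differ by a positive
smooth `u`-invariant factor. -/
def SameFoliation (u : R3 → R3) (S : Set R3) (X X' : R3 → R3) : Prop :=
  ∃ f : R3 → ℝ, SmoothOnSet f S ∧ (∀ p ∈ S, 0 < f p) ∧ (∀ p ∈ S, f (u p) = f p) ∧
    ∀ p ∈ S, X' p = f p • X p

/-- `φ` is a `u`-equivariant diffeomorphism from `S₀` onto `S₁`. -/
structure IsEquivariantDiffeo (u : R3 → R3) (S₀ S₁ : Set R3) (φ : PartialEquiv R3 R3) : Prop where
  source_eq : φ.source = S₀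
  target_eq : φ.target = S₁
  smooth : SmoothOnSet φ S₀
  smooth_symm : SmoothOnSet φ.symm S₁
  equivariant : ∀ p ∈ S₀, φ (u p) = u (φ p)

/-- The push-forward `φ_* X` of a vector field on `S₀ = φ.source`. On `T_p S₀` the derivative of
`φ` within `S₀` is the differential of `φ`. -/
def pushforward (φ : PartialEquiv R3 R3) (X : R3 → R3) (q : R3) : R3 :=
  fderivWithin ℝ φ φ.source (φ.symm q) (X (φ.symm q))

/-- `ψ` is a `u`-equivariant contactomorphism from the open `u`-invariant set `ψ.source` onto the
open `u`-invariant set `ψ.target`, for the contact structures `ker α₀` and `ker α₁`. -/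
structure IsEquivariantContacto (u : R3 → R3) (α₀ α₁ : R3 → R3 →L[ℝ] ℝ)
    (ψ : OpenPartialHomeomorph R3 R3) : Prop where
  source_invariant : MapsTo u ψ.source ψ.source
  target_invariant : MapsTo u ψ.target ψ.target
  smooth : ContDiffOn ℝ ∞ ψ ψ.source
  smooth_symm : ContDiffOn ℝ ∞ ψ.symm ψ.target
  equivariant : ∀ p ∈ ψ.source, ψ (u p) = u (ψ p)
  map_contactPlane : ∀ p ∈ ψ.source,
    (contactPlane α₀ p).map (fderiv ℝ ψ p : R3 →ₗ[ℝ] R3) = contactPlane α₁ (ψ p)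

end EquivContact

end

/-! The argument is Giroux's: extend `φ` off the surface so that the contact planes match along it,
then correct the extension by Moser's trick, keeping everything `u`-equivariant.

Along `S₀` the matching of foliations says that `φ` pulls `α₁|TS₁` back to `h` times `α₀|TS₀`, where
`h` is the foliation factor times the ratio of the area forms. The ratio has no zero and `S₀` is
connected, so its sign is constant; a negative sign is removed by replacing `(Ω₁, α₁)` by `(-Ω₁,
-α₁)`, which changes neither the contact structure nor `X₁`.

To match all of `α₀` and not only its tangential part, the image `Z` of a normal vector `n` must
satisfy `α₁ Z = h * α₀ n` and lie on the positive side of `S₁`. The only obstruction is at singular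
points, where `α₁` is a multiple of the conormal; there the contact condition forces the right sign
(`IsSurfaceMap.normal_mul_normal_pos`, `IsSurfaceMap.exists_extension`). Both conditions on the
derivative survive averaging over `u`. As `u` need not be linear, the average is taken in `R3 × R3`
and retracted equivariantly to the graph of `u` (`exists_equivariant_average`).

This gives an equivariant local diffeomorphism `F` such that `F^* α₁` is a positive multiple of `α₀`
at every point of `S₀`. The linear path from `α₀` to `F^* α₁` is then contact near `S₀`, and its
Moser field vanishes on `S₀` and is `u`-invariant. Its time-one map `χ` fixes `S₀` and carries `ker
α₀` to `ker F^* α₁` (`exists_moser_diffeo`), so `ψ = F ∘ χ` is the required map near `S₀`.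

The smooth dependence of the flow on its initial point comes from the inverse function theorem for
the integral equation on the space of paths (`exists_equivariant_flow`). -/

noncomputable section

open Set Filter Topology
open scoped ContDiff unitInterval

namespace EquivContact

/-! ### The inverse function theorem around a compact set. -/

section InverseFunction

variable {E F : Type*} [NormedAddCommGroup E] [NormedSpace ℝ E] [CompleteSpace E]
  [NormedAddCommGroup F] [NormedSpace ℝ F]

/-- A smooth map that is injective on a compact set `K` and whose derivatives at the points of `K`
are isomorphisms restricts to a diffeomorphism from a neighbourhood of `K` onto an open set. -/
theorem exists_openPartialHomeomorph_of_injOn {f : E → F} {K V : Set E} (hK : IsCompact K)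
    (hV : IsOpen V) (hKV : K ⊆ V) (hf : ContDiffOn ℝ ∞ f V) (hinj : InjOn f K)
    (hf' : ∀ x ∈ K, ∃ L : E ≃L[ℝ] F, HasFDerivAt f (L : E →L[ℝ] F) x) :
    ∃ e : OpenPartialHomeomorph E F, K ⊆ e.source ∧ e.source ⊆ V ∧ (∀ x, e x = f x) ∧
      ContDiffOn ℝ ∞ e.symm e.target ∧
      ∀ x ∈ e.source, ∃ L : E ≃L[ℝ] F, HasFDerivAt f (L : E →L[ℝ] F) x := by
  have hcd : ∀ x ∈ V, ContDiffAt ℝ ∞ f x := fun x hx => hf.contDiffAt (hV.mem_nhds hx)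
  have hstrict : ∀ x ∈ V, HasStrictFDerivAt f (fderiv ℝ f x) x :=
    fun x hx => (hcd x hx).hasStrictFDerivAt (by simp)
  have hcont : ContinuousOn (fderiv ℝ f) V := hf.continuousOn_fderiv_of_isOpen hV (by simp)
  set V' : Set E := V ∩ fderiv ℝ f ⁻¹' range ((↑) : (E ≃L[ℝ] F) → E →L[ℝ] F) with hV'
  have hV'o : IsOpen V' := hcont.isOpen_inter_preimage hV (ContinuousLinearEquiv.isOpen)
  have hKV' : K ⊆ V' := by
    intro x hx
    obtain ⟨L, hL⟩ := hf' x hx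
    exact ⟨hKV hx, L, hL.fderiv.symm⟩
  have hder : ∀ x ∈ V', ∃ L : E ≃L[ℝ] F, HasStrictFDerivAt f (L : E →L[ℝ] F) x := by
    rintro x ⟨hx, L, hL⟩
    exact ⟨L, hL ▸ hstrict x hx⟩
  -- Injectivity on the compact set together with local injectivity at each of its points gives
  -- injectivity on a neighbourhood.
  obtain ⟨T, hTo, hKT, hT⟩ := hinj.exists_isOpen_superset hK
    (fun x hx => (hcd x (hKV hx)).continuousAt) (by
      intro x hx
      obtain ⟨L, hL⟩ := hder x (hKV' hx)
      refine ⟨(hL.toOpenPartialHomeomorph f).source, ?_, ?_⟩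
      · exact (hL.toOpenPartialHomeomorph f).open_source.mem_nhds hL.mem_toOpenPartialHomeomorph_source
      · have := (hL.toOpenPartialHomeomorph f).injOn
        simpa using this)
  have hWo : IsOpen (T ∩ V') := hTo.inter hV'o
  have hopen : ∀ s ⊆ T ∩ V', IsOpen s → IsOpen (f '' s) := by
    intro s hs hso
    rw [isOpen_iff_mem_nhds]
    rintro _ ⟨x, hx, rfl⟩
    obtain ⟨L, hL⟩ := hder x (hs hx).2
    rw [← hL.map_nhds_eq_of_equiv]
    exact image_mem_map (hso.mem_nhds hx)
  let pe : PartialEquiv E F := (hT.mono (inter_subset_left (t := V'))).toPartialEquiv f (T ∩ V')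
  have hpe : ∀ x, pe x = f x := fun x => rfl
  have hpes : pe.source = T ∩ V' := rfl
  let e : OpenPartialHomeomorph E F := OpenPartialHomeomorph.ofContinuousOpenRestrict pe
    (hf.continuousOn.mono fun x hx => hx.2.1) (by
      intro s hs
      have := hopen (Subtype.val '' s) (by rintro _ ⟨y, hy, rfl⟩; exact y.2)
        (hWo.isOpenMap_subtype_val s hs)
      rwa [image_image] at this) hWo
  have he : ∀ x, e x = f x := fun x => rfl
  refine ⟨e, fun x hx => ⟨hKT hx, hKV' hx⟩, fun x hx => hx.2.1, he, ?_, ?_⟩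
  · intro y hy
    have hx := e.map_target hy
    obtain ⟨L, hL⟩ := hder _ hx.2
    exact (e.contDiffAt_symm hy (f₀' := L) hL.hasFDerivAt (hcd _ hx.2.1)).contDiffWithinAt
  · intro x hx
    obtain ⟨L, hL⟩ := hder _ hx.2
    exact ⟨L, hL.hasFDerivAt⟩

end InverseFunction

/-! ### Smoothness of composition operators on spaces of continuous maps. -/

section Nemytskii

universe v

variable {X : Type*} [TopologicalSpace X] [CompactSpace X]

/-- Pointwise application of a continuous family of operators. -/
def pointwiseApply (X : Type*) [TopologicalSpace X] [CompactSpace X] (E F : Type*)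
    [NormedAddCommGroup E] [NormedSpace ℝ E] [NormedAddCommGroup F] [NormedSpace ℝ F] :
    C(X, E →L[ℝ] F) →L[ℝ] C(X, E) →L[ℝ] C(X, F) :=
  LinearMap.mkContinuous₂
    (LinearMap.mk₂ ℝ (fun (A : C(X, E →L[ℝ] F)) (h : C(X, E)) =>
      (⟨fun t => A t (h t), by fun_prop⟩ : C(X, F)))
      (by intros; ext; simp) (by intros; ext; simp) (by intros; ext; simp) (by intros; ext; simp))
    1 (by
      intro A h
      rw [one_mul, ContinuousMap.norm_le _ (by positivity)]
      intro t
      exact (ContinuousLinearMap.le_opNorm _ _).trans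
        (mul_le_mul (A.norm_coe_le_norm t) (h.norm_coe_le_norm t) (norm_nonneg _) (by positivity)))

@[simp] theorem pointwiseApply_apply {E F : Type*}
    [NormedAddCommGroup E] [NormedSpace ℝ E] [NormedAddCommGroup F] [NormedSpace ℝ F]
    (A : C(X, E →L[ℝ] F)) (h : C(X, E)) (t : X) : pointwiseApply X E F A h t = A t (h t) := rfl

/-- Composition with a differentiable map is differentiable on continuous functions. -/
theorem hasFDerivAt_comp_continuousMap {E F : Type*}
    [NormedAddCommGroup E] [NormedSpace ℝ E] [NormedAddCommGroup F] [NormedSpace ℝ F]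
    (f : C(E, F)) (f' : C(E, E →L[ℝ] F)) (hf : ∀ x, HasFDerivAt f (f' x) x) (γ : C(X, E)) :
    HasFDerivAt (fun γ : C(X, E) => f.comp γ) (pointwiseApply X E F (f'.comp γ)) γ := by
  rw [hasFDerivAt_iff_isLittleO_nhds_zero, Asymptotics.isLittleO_iff]
  intro ε hε
  have hc : Continuous fun γ : C(X, E) => f'.comp γ := ContinuousMap.continuous_postcomp f'
  obtain ⟨δ, hδ, hδ'⟩ := (Metric.continuousAt_iff (α := C(X, E)) (β := C(X, E →L[ℝ] F))).1
    (hc.continuousAt (x := γ)) ε hε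
  filter_upwards [Metric.ball_mem_nhds (0 : C(X, E)) hδ] with h hh
  have hh : ‖h‖ < δ := by simpa using hh
  rw [ContinuousMap.norm_le _ (by positivity)]
  intro t
  -- Shifting `γ` by the constant path `y - γ t` turns the continuity of `γ ↦ f' ∘ γ` in the sup
  -- norm into an estimate on a ball whose radius does not depend on `t`.
  have key : ∀ y ∈ Metric.ball (γ t) δ, ‖f' y - f' (γ t)‖ ≤ ε := by
    intro y hy
    have h1 := @hδ' (γ + ContinuousMap.const X (y - γ t)) (by
      rw [dist_eq_norm, add_sub_cancel_left]
      refine lt_of_le_of_lt ?_ (mem_ball_iff_norm.1 hy)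
      rw [ContinuousMap.norm_le _ (by positivity)]
      intro s; simp)
    have h2 := ContinuousMap.dist_apply_le_dist
      (f := f'.comp (γ + ContinuousMap.const X (y - γ t))) (g := f'.comp γ) t
    simp only [ContinuousMap.comp_apply, ContinuousMap.add_apply,
      ContinuousMap.const_apply, add_sub_cancel, dist_eq_norm] at h2
    exact h2.trans h1.le
  have hht : ‖h t‖ ≤ ‖h‖ := h.norm_coe_le_norm t
  have := (convex_ball (γ t) δ).norm_image_sub_le_of_norm_hasFDerivWithin_le'
    (f := f) (f' := f') (φ := f' (γ t)) (C := ε) (fun x _ => (hf x).hasFDerivWithinAt) key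
    (Metric.mem_ball_self hδ) (y := γ t + h t) (by simp; linarith)
  simp only [add_sub_cancel_left] at this
  simp only [ContinuousMap.sub_apply, ContinuousMap.comp_apply, ContinuousMap.add_apply,
    pointwiseApply_apply]
  exact this.trans (by gcongr)

/-- The derivative of composition with `f` is composition with `fderiv ℝ f`, so the induction must
run over all targets `F`; the common universe keeps `E →L[ℝ] F` among them. -/
theorem contDiff_nat_comp_continuousMap {E : Type v} [NormedAddCommGroup E] [NormedSpace ℝ E]
    (n : ℕ) : ∀ {F : Type v} [NormedAddCommGroup F] [NormedSpace ℝ F] (f : C(E, F))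
    (_ : ContDiff ℝ ∞ f), ContDiff ℝ n (fun γ : C(X, E) => f.comp γ) := by
  induction n with
  | zero =>
    intro F _ _ f hf
    exact contDiff_zero.2 (ContinuousMap.continuous_postcomp f)
  | succ n ih =>
    intro F _ _ f hf
    have hf1 : ContDiff ℝ ∞ (fderiv ℝ f) := hf.fderiv_right (by simp)
    rw [Nat.cast_add, Nat.cast_one, contDiff_succ_iff_hasFDerivAt]
    refine ⟨fun γ => pointwiseApply X E F ((⟨fderiv ℝ f, hf1.continuous⟩ : C(E, E →L[ℝ] F)).comp γ),
      ?_, fun γ => ?_⟩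
    · have h1 := ih (⟨fderiv ℝ f, hf1.continuous⟩ : C(E, E →L[ℝ] F)) hf1
      exact (pointwiseApply X E F).contDiff.comp h1
    · exact hasFDerivAt_comp_continuousMap f ⟨fderiv ℝ f, hf1.continuous⟩
        (fun x => (hf.differentiable (by simp) x).hasFDerivAt) γ

theorem contDiff_comp_continuousMap {E F : Type v} [NormedAddCommGroup E] [NormedSpace ℝ E]
    [NormedAddCommGroup F] [NormedSpace ℝ F] (f : C(E, F)) (hf : ContDiff ℝ ∞ f) :
    ContDiff ℝ ∞ (fun γ : C(X, E) => f.comp γ) :=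
  contDiff_infty.2 fun n => contDiff_nat_comp_continuousMap n f hf

end Nemytskii

end EquivContact

end

noncomputable section

open Set Filter Topology
open scoped ContDiff unitInterval
set_option linter.unusedSectionVars false

namespace EquivContact

/-! ### Volterra operators on paths over the unit interval. -/

section Volterra

variable {E : Type*} [NormedAddCommGroup E] [NormedSpace ℝ E] [CompleteSpace E]

theorem continuous_comp_projIcc (g : C(I, E)) :
    Continuous fun s : ℝ => g (projIcc 0 1 zero_le_one s) :=
  g.continuous.comp continuous_projIcc

theorem continuous_integral_projIcc (g : C(I, E)) :
    Continuous fun t : ℝ => ∫ s in (0 : ℝ)..t, g (projIcc 0 1 zero_le_one s) :=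
  intervalIntegral.continuous_primitive
    (fun _ _ => (continuous_comp_projIcc g).intervalIntegrable _ _) 0

/-- The primitive vanishing at `0` of a continuous function on the unit interval. -/
def primitive (E : Type*) [NormedAddCommGroup E] [NormedSpace ℝ E] [CompleteSpace E] :
    C(I, E) →L[ℝ] C(I, E) :=
  LinearMap.mkContinuous
    { toFun := fun g => ⟨fun t => ∫ s in (0 : ℝ)..t, g (projIcc 0 1 zero_le_one s),
        (continuous_integral_projIcc g).comp continuous_subtype_val⟩
      map_add' := fun f g => by
        ext t
        exact intervalIntegral.integral_add
          ((continuous_comp_projIcc f).intervalIntegrable _ _)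
          ((continuous_comp_projIcc g).intervalIntegrable _ _)
      map_smul' := fun c f => by
        ext t
        exact intervalIntegral.integral_smul c _ } 1 (by
    intro g
    rw [one_mul, ContinuousMap.norm_le _ (norm_nonneg g)]
    intro t
    refine (intervalIntegral.norm_integral_le_of_norm_le_const (C := ‖g‖)
      fun s _ => g.norm_coe_le_norm _).trans ?_
    rw [sub_zero, abs_of_nonneg t.2.1]
    exact mul_le_of_le_one_right (norm_nonneg _) t.2.2)

theorem primitive_apply (g : C(I, E)) (t : I) :
    primitive E g t = ∫ s in (0 : ℝ)..t, g (projIcc 0 1 zero_le_one s) := rfl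

@[simp] theorem primitive_zero (g : C(I, E)) : primitive E g 0 = 0 := by
  rw [primitive_apply]; simp

theorem hasDerivWithinAt_primitive (g : C(I, E)) {t : ℝ} (ht : t ∈ Icc (0 : ℝ) 1) :
    HasDerivWithinAt (fun t => primitive E g (projIcc 0 1 zero_le_one t)) (g ⟨t, ht⟩)
      (Icc 0 1) t := by
  have h1 : HasDerivAt (fun t : ℝ => ∫ s in (0 : ℝ)..t, g (projIcc 0 1 zero_le_one s))
      (g (projIcc 0 1 zero_le_one t)) t :=
    (continuous_comp_projIcc g).integral_hasStrictDerivAt 0 t |>.hasDerivAt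
  rw [projIcc_of_mem _ ht] at h1
  refine h1.hasDerivWithinAt.congr_of_mem (fun s hs => ?_) ht
  rw [primitive_apply, projIcc_of_mem _ hs]

/-- The Volterra operator `h ↦ ∫ A h`. -/
def volterra (A : C(I, E →L[ℝ] E)) : C(I, E) →L[ℝ] C(I, E) :=
  (primitive E).comp (pointwiseApply I E E A)

/-- Each iteration integrates once more from `0`, which produces the factor `t ^ n / n!`. No
smallness of `A` is needed for a high power to be a contraction. -/
theorem norm_volterra_pow_apply_le (A : C(I, E →L[ℝ] E)) (h : C(I, E)) (n : ℕ) (t : I) :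
    ‖(volterra A ^ n) h t‖ ≤ ‖A‖ ^ n * ((t : ℝ) ^ n / n.factorial) * ‖h‖ := by
  induction n generalizing t with
  | zero => simpa using h.norm_coe_le_norm t
  | succ n ih =>
    rw [pow_succ']
    change ‖primitive E (pointwiseApply I E E A ((volterra A ^ n) h)) t‖ ≤ _
    rw [primitive_apply]
    have hint : ∫ s in (0 : ℝ)..t, ‖A‖ ^ (n + 1) * (s ^ n / n.factorial) * ‖h‖ =
        ‖A‖ ^ (n + 1) * ((t : ℝ) ^ (n + 1) / (n + 1).factorial) * ‖h‖ := by
      rw [intervalIntegral.integral_mul_const, intervalIntegral.integral_const_mul,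
        intervalIntegral.integral_div, integral_pow, Nat.factorial_succ]
      have : (n.factorial : ℝ) ≠ 0 := by positivity
      push_cast
      field_simp
      simp
    rw [← hint]
    refine intervalIntegral.norm_integral_le_of_norm_le t.2.1 ?_
      (Continuous.intervalIntegrable (by fun_prop) _ _)
    refine Eventually.of_forall fun s hs => ?_
    have hs' : s ∈ Icc (0 : ℝ) 1 := ⟨hs.1.le, hs.2.trans t.2.2⟩
    rw [projIcc_of_mem _ hs', pointwiseApply_apply]
    refine ((A ⟨s, hs'⟩).le_opNorm _).trans ?_
    have h1 := ih ⟨s, hs'⟩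
    have h2 := A.norm_coe_le_norm ⟨s, hs'⟩
    calc ‖A ⟨s, hs'⟩‖ * ‖(volterra A ^ n) h ⟨s, hs'⟩‖
        ≤ ‖A‖ * (‖A‖ ^ n * (s ^ n / n.factorial) * ‖h‖) := by gcongr
      _ = ‖A‖ ^ (n + 1) * (s ^ n / n.factorial) * ‖h‖ := by ring

/-- For large `n` the power `V ^ n` has norm less than one, so `1 - V ^ n` is a unit; it is the
product of `1 - V` with a geometric sum commuting with it. -/
theorem isUnit_one_sub_volterra (A : C(I, E →L[ℝ] E)) : IsUnit (1 - volterra A) := by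
  obtain ⟨n, hn⟩ : ∃ n : ℕ, ‖A‖ ^ n / n.factorial < 1 :=
    ((FloorSemiring.tendsto_pow_div_factorial_atTop ‖A‖).eventually_lt_const one_pos).exists
  have h1 : ‖volterra A ^ n‖ ≤ ‖A‖ ^ n / n.factorial := by
    refine ContinuousLinearMap.opNorm_le_bound _ (by positivity) fun h => ?_
    rw [ContinuousMap.norm_le _ (by positivity)]
    intro t
    refine (norm_volterra_pow_apply_le A h n t).trans ?_
    gcongr
    rw [← mul_div_assoc]
    gcongr
    exact mul_le_of_le_one_right (by positivity) (pow_le_one₀ t.2.1 t.2.2)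
  have h2 : IsUnit (1 - volterra A ^ n) := isUnit_one_sub_of_norm_lt_one (R := C(I, E) →L[ℝ] C(I, E)) (h1.trans_lt hn)
  have h3 : Commute (1 - volterra A) (∑ i ∈ Finset.range n, volterra A ^ i) :=
    Commute.sum_right _ _ _ fun i _ =>
      ((Commute.one_left _).sub_left ((Commute.refl _).pow_right i))
  rw [← mul_neg_geom_sum, h3.isUnit_mul_iff] at h2
  exact h2.1

end Volterra

/-! ### Integral curves as zeros of a smooth map on a space of paths. -/

section Flow

variable {E : Type} [NormedAddCommGroup E] [NormedSpace ℝ E]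

/-- The constant paths. -/
def constPath (E : Type*) [NormedAddCommGroup E] [NormedSpace ℝ E] : E →L[ℝ] C(I, E) :=
  LinearMap.mkContinuous
    { toFun := fun x => ContinuousMap.const I x
      map_add' := fun _ _ => by ext; rfl
      map_smul' := fun _ _ => by ext; rfl } 1 (by
    intro x
    rw [one_mul, ContinuousMap.norm_le _ (norm_nonneg x)]
    exact fun _ => le_rfl)

@[simp] theorem constPath_apply (x : E) (t : I) : constPath E x t = x := rfl

/-- The graph of a path. -/
def pathGraph (γ : C(I, E)) : C(I, ℝ × E) := ⟨fun t => (t, γ t), by fun_prop⟩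

@[simp] theorem pathGraph_apply (γ : C(I, E)) (t : I) : pathGraph γ t = ((t : ℝ), γ t) := rfl

theorem hasFDerivAt_pathGraph (γ : C(I, E)) :
    HasFDerivAt pathGraph ((ContinuousLinearMap.inr ℝ ℝ E).compLeftContinuous ℝ I) γ := by
  have h : (pathGraph : C(I, E) → C(I, ℝ × E)) = fun γ =>
      pathGraph 0 + (ContinuousLinearMap.inr ℝ ℝ E).compLeftContinuous ℝ I γ := by
    ext γ t <;> simp
  rw [h]
  exact (ContinuousLinearMap.hasFDerivAt _).const_add _

theorem contDiff_pathGraph : ContDiff ℝ ∞ (pathGraph : C(I, E) → C(I, ℝ × E)) := by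
  have h : (pathGraph : C(I, E) → C(I, ℝ × E)) = fun γ =>
      pathGraph 0 + (ContinuousLinearMap.inr ℝ ℝ E).compLeftContinuous ℝ I γ := by
    ext γ t <;> simp
  rw [h]
  exact contDiff_const.add (ContinuousLinearMap.contDiff _)

/-- The linearization along a path of a time-dependent vector field. -/
def linearizationAlong (Y : C(ℝ × E, E)) (hY : ContDiff ℝ ∞ Y) (γ : C(I, E)) :
    C(I, E →L[ℝ] E) :=
  ⟨fun t => (fderiv ℝ Y (t, γ t)).comp (ContinuousLinearMap.inr ℝ ℝ E), by
    have := hY.continuous_fderiv (by simp)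
    fun_prop⟩

theorem linearizationAlong_apply (Y : C(ℝ × E, E)) (hY : ContDiff ℝ ∞ Y) (γ : C(I, E)) (t : I)
    (v : E) : linearizationAlong Y hY γ t v = fderiv ℝ Y (t, γ t) (0, v) := rfl

variable [CompleteSpace E]

theorem hasFDerivAt_primitive_comp (Y : C(ℝ × E, E)) (hY : ContDiff ℝ ∞ Y) (γ : C(I, E)) :
    HasFDerivAt (fun γ => primitive E (Y.comp (pathGraph γ)))
      (volterra (linearizationAlong Y hY γ)) γ := by
  have hY1 : ContDiff ℝ ∞ (fderiv ℝ Y) := hY.fderiv_right (by simp)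
  have h1 := hasFDerivAt_comp_continuousMap Y
    (⟨fderiv ℝ Y, hY1.continuous⟩ : C(ℝ × E, ℝ × E →L[ℝ] E))
    (fun x => (hY.differentiable (by simp) x).hasFDerivAt) (pathGraph γ)
  exact (primitive E).hasFDerivAt.comp γ (h1.comp γ (hasFDerivAt_pathGraph γ))

/-- The map whose zeros over `x` are the integral curves starting at `x`. -/
def integralCurveMap (Y : C(ℝ × E, E)) (q : E × C(I, E)) : E × C(I, E) :=
  (q.1, q.2 - constPath E q.1 - primitive E (Y.comp (pathGraph q.2)))

theorem contDiff_integralCurveMap (Y : C(ℝ × E, E)) (hY : ContDiff ℝ ∞ Y) :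
    ContDiff ℝ ∞ (integralCurveMap Y) := by
  have h1 : ContDiff ℝ ∞ fun γ : C(I, E) => primitive E (Y.comp (pathGraph γ)) :=
    (primitive E).contDiff.comp ((contDiff_comp_continuousMap Y hY).comp contDiff_pathGraph)
  exact contDiff_fst.prodMk ((contDiff_snd.sub ((constPath E).contDiff.comp contDiff_fst)).sub
    (h1.comp contDiff_snd))

/-- The derivative is block triangular with diagonal blocks `1` and `1 - T`, and `T` is a Volterra
operator. Keeping the initial point as first component lets the inverse function theorem do the work
of the implicit one. -/
theorem exists_equiv_hasFDerivAt_integralCurveMap (Y : C(ℝ × E, E)) (hY : ContDiff ℝ ∞ Y)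
    (q : E × C(I, E)) : ∃ L : (E × C(I, E)) ≃L[ℝ] (E × C(I, E)),
      HasFDerivAt (integralCurveMap Y) (L : E × C(I, E) →L[ℝ] E × C(I, E)) q := by
  set T := volterra (linearizationAlong Y hY q.2) with hT
  obtain ⟨U, hU⟩ := isUnit_one_sub_volterra (linearizationAlong Y hY q.2)
  have hU1 : ∀ h, (U⁻¹.val) (h - T h) = h := by
    intro h
    have := congrArg (fun S : C(I, E) →L[ℝ] C(I, E) => S h) U.inv_mul
    rw [hU] at this
    simpa using this
  have hU2 : ∀ h, (U⁻¹.val) h - T ((U⁻¹.val) h) = h := by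
    intro h
    have := congrArg (fun S : C(I, E) →L[ℝ] C(I, E) => S h) U.mul_inv
    rw [hU] at this
    simpa using this
  let Z := C(I, E)
  let f1 : E × Z →L[ℝ] E := ContinuousLinearMap.fst ℝ E Z
  let f2 : E × Z →L[ℝ] Z := ContinuousLinearMap.snd ℝ E Z
  let L : E × Z →L[ℝ] E × Z := f1.prod (f2 - (constPath E).comp f1 - T.comp f2)
  let L' : E × Z →L[ℝ] E × Z := f1.prod ((U⁻¹.val).comp (f2 + (constPath E).comp f1))
  refine ⟨ContinuousLinearEquiv.equivOfInverse L L' ?_ ?_, ?_⟩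
  · rintro ⟨x, h⟩
    change (x, (U⁻¹.val) (h - constPath E x - T h + constPath E x)) = (x, h)
    rw [← hU1 h]
    congr 2
    rw [hU1]; abel
  · rintro ⟨x, h⟩
    change (x, (U⁻¹.val) (h + constPath E x) - constPath E x -
      T ((U⁻¹.val) (h + constPath E x))) = (x, h)
    rw [sub_right_comm, hU2, add_sub_cancel_right]
  · change HasFDerivAt (integralCurveMap Y) L q
    have h1 : HasFDerivAt (fun q : E × Z => primitive E (Y.comp (pathGraph q.2))) (T.comp f2) q :=
      (hasFDerivAt_primitive_comp Y hY q.2).comp q hasFDerivAt_snd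
    exact hasFDerivAt_fst.prodMk ((hasFDerivAt_snd.sub
      ((constPath E).hasFDerivAt.comp q hasFDerivAt_fst)).sub h1)

end Flow

end EquivContact

end

/-! ### The equivariant flow near a compact set of zeros. -/

noncomputable section

open Set Filter Topology
open scoped ContDiff unitInterval Manifold
set_option linter.unusedSectionVars false

namespace EquivContact

/-- A smooth map on a neighbourhood of a compact set agrees near that set with a globally defined
smooth map. -/
theorem exists_contDiff_eqOn_of_isCompact {E F : Type*} [NormedAddCommGroup E] [NormedSpace ℝ E]
    [FiniteDimensional ℝ E] [NormedAddCommGroup F] [NormedSpace ℝ F] {C R : Set E} {f : E → F}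
    (hC : IsCompact C) (hR : IsOpen R) (hCR : C ⊆ R) (hf : ContDiffOn ℝ ∞ f R) :
    ∃ (g : E → F) (R' : Set E), ContDiff ℝ ∞ g ∧ IsOpen R' ∧ C ⊆ R' ∧ R' ⊆ R ∧ EqOn g f R' := by
  obtain ⟨D, hD, hCD, hDR⟩ := exists_compact_between hC hR hCR
  obtain ⟨D', hD', hDD', hDR'⟩ := exists_compact_between hD hR hDR
  obtain ⟨χ, hχ, -, hsupp, hone⟩ := exists_contMDiff_support_eq_eq_one_iff (n := (⊤ : ℕ∞)) 𝓘(ℝ, E)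
    (isOpen_interior (s := D')) hD.isClosed hDD'
  refine ⟨fun x => χ x • f x, interior D, ?_, isOpen_interior, hCD, interior_subset.trans hDR, ?_⟩
  · rw [contDiff_iff_contDiffAt]
    intro x
    by_cases hx : x ∈ R
    · exact hχ.contDiff.contDiffAt.smul (hf.contDiffAt (hR.mem_nhds hx))
    · have hx' : x ∈ D'ᶜ := fun h => hx (hDR' h)
      refine (contDiffAt_const (c := (0 : F))).congr_of_eventuallyEq ?_
      filter_upwards [hD'.isClosed.isOpen_compl.mem_nhds hx'] with y hy
      have : χ y = 0 := by
        rw [← Function.notMem_support, hsupp]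
        exact fun h => hy (interior_subset h)
      rw [this, zero_smul]
  · intro x hx
    change χ x • f x = f x
    rw [(hone x).1 (interior_subset hx), one_smul]

/-- Integral curves are fixed points of the integral operator. -/
theorem integralCurveMap_eq_zero {E : Type} [NormedAddCommGroup E] [NormedSpace ℝ E]
    [CompleteSpace E] (Y : C(ℝ × E, E)) (γ : C(I, E))
    (hγ : ∀ t (ht : t ∈ Icc (0 : ℝ) 1), HasDerivWithinAt
      (fun s => γ (projIcc 0 1 zero_le_one s)) (Y (t, γ ⟨t, ht⟩)) (Icc 0 1) t) :
    integralCurveMap Y (γ 0, γ) = (γ 0, 0) := by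
  refine Prod.ext rfl ?_
  ext t
  change γ t - γ 0 - primitive E (Y.comp (pathGraph γ)) t = 0
  have hc := continuous_comp_projIcc γ
  have h0 : projIcc (0 : ℝ) 1 zero_le_one 0 = 0 := projIcc_left _
  have ht : projIcc (0 : ℝ) 1 zero_le_one t = t := projIcc_val _ t
  rw [primitive_apply, intervalIntegral.integral_eq_sub_of_hasDerivAt_of_le t.2.1
    (f := fun s => γ (projIcc 0 1 zero_le_one s)) hc.continuousOn (fun s hs => ?_)
    ((continuous_comp_projIcc _).intervalIntegrable _ _)]
  · simp only [h0, ht, sub_self]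
  · have hs' : s ∈ Icc (0 : ℝ) 1 := ⟨hs.1.le, hs.2.le.trans t.2.2⟩
    rw [projIcc_of_mem _ hs']
    exact (hγ s hs').hasDerivAt (Icc_mem_nhds hs.1 (hs.2.trans_le t.2.2))

/-- The flow on the time interval `[0, 1]` of a time-dependent vector field that vanishes along a
compact set `K`, defined near `K`, together with its linearized equation and its equivariance. -/
theorem exists_equivariant_flow {E : Type} [NormedAddCommGroup E] [NormedSpace ℝ E]
    [FiniteDimensional ℝ E] {K : Set E} (hK : IsCompact K) {R : Set (ℝ × E)} (hR : IsOpen R)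
    (hKR : Icc (0 : ℝ) 1 ×ˢ K ⊆ R) {Y : ℝ × E → E} (hY : ContDiffOn ℝ ∞ Y R)
    (hY0 : ∀ q ∈ Icc (0 : ℝ) 1 ×ˢ K, Y q = 0) {u : E → E} (hu : ContDiff ℝ ∞ u)
    (huK : MapsTo u K K) (huY : ∀ t x, (t, x) ∈ R → (t, u x) ∈ R →
      Y (t, u x) = fderiv ℝ u x (Y (t, x))) :
    ∃ (N : Set E) (Γ : E → C(I, E)), IsOpen N ∧ K ⊆ N ∧ ContDiffOn ℝ ∞ Γ N ∧
      (∀ x ∈ K, ∀ t, Γ x t = x) ∧ (∀ x ∈ N, Γ x 0 = x) ∧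
      (∀ x ∈ N, ∀ t : I, ((t : ℝ), Γ x t) ∈ R) ∧
      (∀ x ∈ N, ∀ t (ht : t ∈ Icc (0 : ℝ) 1), HasDerivWithinAt
        (fun s => Γ x (projIcc 0 1 zero_le_one s)) (Y (t, Γ x ⟨t, ht⟩)) (Icc 0 1) t) ∧
      (∀ x ∈ N, ∀ v, fderiv ℝ Γ x v 0 = v) ∧
      (∀ x ∈ N, ∀ v t (ht : t ∈ Icc (0 : ℝ) 1), HasDerivWithinAt
        (fun s => fderiv ℝ Γ x v (projIcc 0 1 zero_le_one s))
        (fderiv ℝ Y (t, Γ x ⟨t, ht⟩) (0, fderiv ℝ Γ x v ⟨t, ht⟩)) (Icc 0 1) t) ∧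
      (∀ x ∈ N, u x ∈ N → ∀ t, Γ (u x) t = u (Γ x t)) := by
  have : CompleteSpace E := FiniteDimensional.complete ℝ E
  -- The composition operators act on globally defined maps, so `Y` is replaced by a global `Y'`
  -- that equals it on a neighbourhood `R'` of `[0, 1] × K`.
  obtain ⟨Y', R', hY's, hR', hKR', hRR', hYY'⟩ :=
    exists_contDiff_eqOn_of_isCompact (isCompact_Icc.prod hK) hR hKR hY
  let Yc : C(ℝ × E, E) := ⟨Y', hY's.continuous⟩
  have hYc : ContDiff ℝ ∞ Yc := hY's
  have hYcY : ∀ q ∈ R', Yc q = Y q := hYY'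
  have hconst : ∀ p ∈ K, integralCurveMap Yc (p, constPath E p) = (p, 0) := by
    intro p hp
    refine Prod.ext rfl ?_
    ext t
    change constPath E p t - constPath E p t - primitive E (Yc.comp (pathGraph _)) t = 0
    have : Yc.comp (pathGraph (constPath E p)) = 0 := by
      ext s
      have hs : ((s : ℝ), p) ∈ Icc (0 : ℝ) 1 ×ˢ K := ⟨s.2, hp⟩
      exact (hYcY _ (hKR' hs)).trans (hY0 _ hs)
    rw [this]; simp
  -- At points of `K` the constant paths solve the integral equation, so it can be inverted near
  -- them; `Γ x` is the path component of the inverse at `(x, 0)`.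
  obtain ⟨e, hKe, -, heq, hesymm, -⟩ := exists_openPartialHomeomorph_of_injOn
    (f := integralCurveMap Yc) (K := (fun p => (p, constPath E p)) '' K)
    (hK.image (by fun_prop)) isOpen_univ (subset_univ _)
    (contDiff_integralCurveMap Yc hYc).contDiffOn
    (by
      rintro _ ⟨p, hp, rfl⟩ _ ⟨q, hq, rfl⟩ h
      have : p = q := congrArg Prod.fst h
      rw [this])
    (fun q _ => exists_equiv_hasFDerivAt_integralCurveMap Yc hYc q)
  set Γ : E → C(I, E) := fun x => (e.symm (x, 0)).2 with hΓ
  set N0 : Set E := {x | (x, (0 : C(I, E))) ∈ e.target} with hN0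
  have hN0o : IsOpen N0 := e.open_target.preimage (by fun_prop)
  have hKsrc : ∀ p ∈ K, (p, constPath E p) ∈ e.source := fun p hp => hKe ⟨p, hp, rfl⟩
  have hΓK : ∀ p ∈ K, p ∈ N0 ∧ e.symm (p, 0) = (p, constPath E p) := by
    intro p hp
    have h1 := hKsrc p hp
    have h2 : e (p, constPath E p) = (p, 0) := (heq _).trans (hconst p hp)
    exact ⟨by have := e.map_source h1; rwa [h2] at this, by rw [← h2, e.left_inv h1]⟩
  have hsol : ∀ x ∈ N0, e.symm (x, 0) = (x, Γ x) ∧ integralCurveMap Yc (x, Γ x) = (x, 0) := by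
    intro x hx
    have h1 := e.right_inv hx
    rw [heq] at h1
    have h2 : (e.symm (x, 0)).1 = x := congrArg Prod.fst h1
    have h3 : e.symm (x, 0) = (x, Γ x) := Prod.ext h2 rfl
    exact ⟨h3, by rw [← h3, h1]⟩
  have hΓsmooth : ContDiffOn ℝ ∞ Γ N0 :=
    contDiff_snd.comp_contDiffOn (hesymm.comp (by fun_prop) fun x hx => hx)
  set M : Set C(I, ℝ × E) := {g | MapsTo g univ R'} with hM
  have hMo : IsOpen M := ContinuousMap.isOpen_setOfPred_mapsTo isCompact_univ hR'
  have hgraph : Continuous (pathGraph : C(I, E) → C(I, ℝ × E)) := contDiff_pathGraph.continuous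
  let uc : C(E, E) := ⟨u, hu.continuous⟩
  have hucc : Continuous fun γ : C(I, E) => uc.comp γ := ContinuousMap.continuous_postcomp uc
  -- `N1` and `N2` keep the graphs of `Γ x` and of `u ∘ Γ x` inside `R'`, where `Y'` equals `Y`.
  -- `N3` keeps `u ∘ Γ x` in the domain where solutions are unique.
  set N1 := N0 ∩ (fun x => pathGraph (Γ x)) ⁻¹' M with hN1
  have hN1o : IsOpen N1 := (hgraph.comp_continuousOn hΓsmooth.continuousOn).isOpen_inter_preimage
    hN0o hMo
  set N2 := N0 ∩ (fun x => pathGraph (uc.comp (Γ x))) ⁻¹' M with hN2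
  have hN2o : IsOpen N2 := ((hgraph.comp hucc).comp_continuousOn
    hΓsmooth.continuousOn).isOpen_inter_preimage hN0o hMo
  set N3 := N0 ∩ (fun x => (u x, uc.comp (Γ x))) ⁻¹' e.source with hN3
  have hN3o : IsOpen N3 := (hu.continuous.continuousOn.prodMk
    (hucc.comp_continuousOn hΓsmooth.continuousOn)).isOpen_inter_preimage hN0o e.open_source
  have hΓc : ∀ p ∈ K, Γ p = constPath E p := fun p hp => by rw [hΓ]; simp [(hΓK p hp).2]
  have hΓ0 : ∀ x ∈ N0, ∀ t, Γ x t = x + primitive E (Yc.comp (pathGraph (Γ x))) t := by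
    intro x hx t
    have h := congrArg (fun q : E × C(I, E) => q.2 t) (hsol x hx).2
    change Γ x t - x - primitive E (Yc.comp (pathGraph (Γ x))) t = 0 at h
    rw [← sub_eq_zero, ← h]; abel
  have hderivΓ : ∀ x ∈ N1, ∀ t (ht : t ∈ Icc (0 : ℝ) 1), HasDerivWithinAt
      (fun s => Γ x (projIcc 0 1 zero_le_one s)) (Y (t, Γ x ⟨t, ht⟩)) (Icc 0 1) t := by
    intro x hx t ht
    have h1 := (hasDerivWithinAt_primitive (Yc.comp (pathGraph (Γ x))) ht).const_add x
    have h2 : (Yc.comp (pathGraph (Γ x))) ⟨t, ht⟩ = Y (t, Γ x ⟨t, ht⟩) :=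
      hYcY _ (hx.2 (mem_univ (⟨t, ht⟩ : I)))
    rw [h2] at h1
    exact h1.congr_of_mem (fun s _ => hΓ0 x hx.1 _) ht
  -- Differentiating the integral equation in the initial point gives the linearized equation, again
  -- in integral form.
  have hvar : ∀ x ∈ N0, ∀ v, fderiv ℝ Γ x v = constPath E v +
      volterra (linearizationAlong Yc hYc (Γ x)) (fderiv ℝ Γ x v) := by
    intro x hx v
    have hd : HasFDerivAt Γ (fderiv ℝ Γ x) x :=
      ((hΓsmooth.contDiffAt (hN0o.mem_nhds hx)).differentiableAt (by simp)).hasFDerivAt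
    have h1 : HasFDerivAt (fun x => constPath E x + primitive E (Yc.comp (pathGraph (Γ x))))
        (constPath E + (volterra (linearizationAlong Yc hYc (Γ x))).comp (fderiv ℝ Γ x)) x :=
      (constPath E).hasFDerivAt.add
        ((hasFDerivAt_primitive_comp Yc hYc (Γ x)).comp x hd)
    have h2 : Γ =ᶠ[𝓝 x] fun x => constPath E x + primitive E (Yc.comp (pathGraph (Γ x))) := by
      filter_upwards [hN0o.mem_nhds hx] with y hy
      ext t
      exact hΓ0 y hy t
    have h3 := (h1.congr_of_eventuallyEq h2).fderiv
    nth_rewrite 1 [h3]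
    rfl
  refine ⟨N1 ∩ N2 ∩ N3, Γ, (hN1o.inter hN2o).inter hN3o, ?_, hΓsmooth.mono fun x hx => hx.1.1.1,
    fun x hx t => by rw [hΓc x hx, constPath_apply], ?_,
    fun x hx t => hRR' (hx.1.1.2 (mem_univ t)),
    fun x hx => hderivΓ x hx.1.1, ?_, ?_, ?_⟩
  · intro p hp
    have h1 := hΓc p hp
    have h2 := (hΓK p hp).1
    have h3 : uc.comp (Γ p) = constPath E (u p) := by rw [h1]; rfl
    refine ⟨⟨⟨h2, ?_⟩, ⟨h2, ?_⟩⟩, ⟨h2, ?_⟩⟩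
    · rw [mem_preimage, h1]
      exact fun t _ => hKR' ⟨t.2, hp⟩
    · rw [mem_preimage, h3]
      exact fun t _ => hKR' ⟨t.2, huK hp⟩
    · rw [mem_preimage, h3]
      exact hKsrc _ (huK hp)
  · intro x hx
    rw [hΓ0 x hx.1.1.1, primitive_zero, add_zero]
  · intro x hx v
    rw [hvar x hx.1.1.1 v, ContinuousMap.add_apply, constPath_apply]
    change v + primitive E _ 0 = v
    rw [primitive_zero, add_zero]
  · intro x hx v t ht
    have h1 := (hasDerivWithinAt_primitive (pointwiseApply I E E
      (linearizationAlong Yc hYc (Γ x)) (fderiv ℝ Γ x v)) ht).const_add v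
    have hmem : (t, Γ x ⟨t, ht⟩) ∈ R' := hx.1.1.2 (mem_univ (⟨t, ht⟩ : I))
    have hYd : fderiv ℝ Y (t, Γ x ⟨t, ht⟩) = fderiv ℝ Yc (t, Γ x ⟨t, ht⟩) :=
      Filter.EventuallyEq.fderiv_eq (by
        filter_upwards [hR'.mem_nhds hmem] with q hq using (hYcY q hq).symm)
    rw [hYd]
    rw [pointwiseApply_apply, linearizationAlong_apply] at h1
    refine h1.congr_of_mem (fun s _ => ?_) ht
    exact congrArg (fun g : C(I, E) => g (projIcc 0 1 zero_le_one s)) (hvar x hx.1.1.1 v)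
  -- Both `u ∘ Γ x` and `Γ (u x)` solve the integral equation with initial point `u x`, and both lie
  -- in `e.source`, where `integralCurveMap` is injective.
  · intro x hx hux t
    have hγ : ∀ t (ht : t ∈ Icc (0 : ℝ) 1), HasDerivWithinAt
        (fun s => (uc.comp (Γ x)) (projIcc 0 1 zero_le_one s)) (Yc (t, (uc.comp (Γ x)) ⟨t, ht⟩))
        (Icc 0 1) t := by
      intro t ht
      have hd : HasFDerivAt u (fderiv ℝ u (Γ x ⟨t, ht⟩))
          ((fun s => Γ x (projIcc 0 1 zero_le_one s)) t) := by
        change HasFDerivAt u _ (Γ x (projIcc 0 1 zero_le_one t))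
        rw [projIcc_of_mem _ ht]
        exact (hu.differentiable (by simp) _).hasFDerivAt
      have h1 := hd.comp_hasDerivWithinAt t (hderivΓ x hx.1.1 t ht)
      have m1 : (t, Γ x ⟨t, ht⟩) ∈ R' := hx.1.1.2 (mem_univ (⟨t, ht⟩ : I))
      have m2 : (t, u (Γ x ⟨t, ht⟩)) ∈ R' := hx.1.2.2 (mem_univ (⟨t, ht⟩ : I))
      rw [← huY _ _ (hRR' m1) (hRR' m2), ← hYcY _ m2] at h1
      exact h1
    have h1 := integralCurveMap_eq_zero Yc (uc.comp (Γ x)) hγ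
    have h00 : (uc.comp (Γ x)) 0 = u x := by
      change u (Γ x 0) = u x
      rw [hΓ0 x hx.1.1.1, primitive_zero, add_zero]
    rw [h00] at h1
    have h2 := hsol _ hux.1.1.1
    have h3 : (u x, Γ (u x)) ∈ e.source := h2.1 ▸ e.map_target hux.1.1.1
    have h4 := e.injOn h3 hx.2.2 (by
      change e _ = e (u x, uc.comp (Γ x))
      rw [heq, heq, h1, h2.2])
    exact congrArg (fun q : E × C(I, E) => q.2 t) h4

end EquivContact

end

noncomputable section

open Set Filter Topology
open scoped ContDiff

namespace EquivContact

/-! ### Forms and determinants on `R3`. -/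

section LinearAlgebra

theorem stdVec_apply (i j : Fin 3) : stdVec i j = if j = i then 1 else 0 := by
  simp [stdVec]

theorem eq_sum_stdVec (v : R3) : v = v 0 • stdVec 0 + v 1 • stdVec 1 + v 2 • stdVec 2 := by
  ext i; fin_cases i <;> simp [stdVec_apply]

theorem clm_expand {F : Type*} [NormedAddCommGroup F] [NormedSpace ℝ F] (A : R3 →L[ℝ] F) (v : R3) :
    A v = v 0 • A (stdVec 0) + v 1 • A (stdVec 1) + v 2 • A (stdVec 2) := by
  conv_lhs => rw [eq_sum_stdVec v]
  simp only [map_add, map_smul]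

theorem functional_expand (A : R3 →L[ℝ] ℝ) (v : R3) :
    A v = v 0 * A (stdVec 0) + v 1 * A (stdVec 1) + v 2 * A (stdVec 2) := by
  simpa using clm_expand A v

theorem update_vec_zero (v w x : R3) : Function.update ![v, w] 0 x = ![x, w] := by
  ext i : 1; fin_cases i <;> rfl

theorem update_vec_one (v w x : R3) : Function.update ![v, w] 1 x = ![v, x] := by
  ext i : 1; fin_cases i <;> rfl

/-- The bilinear map of a 2-form. -/
def toBilin (θ : R3 [⋀^Fin 2]→L[ℝ] ℝ) : R3 →ₗ[ℝ] R3 →ₗ[ℝ] ℝ :=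
  LinearMap.mk₂ ℝ (fun v w => θ ![v, w])
    (fun v v' w => by
      have := θ.map_update_add ![v, w] 0 v v'
      simpa only [update_vec_zero] using this)
    (fun c v w => by
      have := θ.map_update_smul ![v, w] 0 c v
      simpa only [update_vec_zero] using this)
    (fun v w w' => by
      have := θ.map_update_add ![v, w] 1 w w'
      simpa only [update_vec_one] using this)
    (fun c v w => by
      have := θ.map_update_smul ![v, w] 1 c w
      simpa only [update_vec_one] using this)

theorem toBilin_apply (θ : R3 [⋀^Fin 2]→L[ℝ] ℝ) (v w : R3) : toBilin θ v w = θ ![v, w] := rfl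

theorem twoForm_self (θ : R3 [⋀^Fin 2]→L[ℝ] ℝ) (v : R3) : θ ![v, v] = 0 :=
  θ.map_eq_zero_of_eq ![v, v] (i := 0) (j := 1) rfl (by simp)

theorem twoForm_swap (θ : R3 [⋀^Fin 2]→L[ℝ] ℝ) (v w : R3) : θ ![v, w] = -θ ![w, v] := by
  have h := twoForm_self θ (v + w)
  rw [← toBilin_apply] at h
  simp only [map_add, LinearMap.add_apply, toBilin_apply, twoForm_self] at h
  linarith

theorem twoForm_expand (θ : R3 [⋀^Fin 2]→L[ℝ] ℝ) (v w : R3) :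
    θ ![v, w] = (v 1 * w 2 - v 2 * w 1) * θ ![stdVec 1, stdVec 2] +
      (v 2 * w 0 - v 0 * w 2) * θ ![stdVec 2, stdVec 0] +
      (v 0 * w 1 - v 1 * w 0) * θ ![stdVec 0, stdVec 1] := by
  conv_lhs => rw [← toBilin_apply, eq_sum_stdVec v, eq_sum_stdVec w]
  simp only [map_add, map_smul, LinearMap.add_apply, LinearMap.smul_apply, toBilin_apply,
    twoForm_self, smul_eq_mul]
  rw [twoForm_swap θ (stdVec 1) (stdVec 0), twoForm_swap θ (stdVec 2) (stdVec 1),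
    twoForm_swap θ (stdVec 0) (stdVec 2)]
  ring

/-- The value of `A ∧ θ` on the standard basis. -/
def wedge (A : R3 →L[ℝ] ℝ) (θ : R3 [⋀^Fin 2]→L[ℝ] ℝ) : ℝ :=
  A (stdVec 0) * θ ![stdVec 1, stdVec 2] + A (stdVec 1) * θ ![stdVec 2, stdVec 0] +
    A (stdVec 2) * θ ![stdVec 0, stdVec 1]

/-- The standard volume form. -/
def det3 (v w n : R3) : ℝ :=
  (v 1 * w 2 - v 2 * w 1) * n 0 + (v 2 * w 0 - v 0 * w 2) * n 1 + (v 0 * w 1 - v 1 * w 0) * n 2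

/-- The left side is `A ∧ θ` evaluated on `(v, w, n)`. If `v` and `w` lie in the kernel of `A`, only
`A n * θ ![v, w]` is left; this is how orientations are compared below. -/
theorem wedge_mul_det3 (A : R3 →L[ℝ] ℝ) (θ : R3 [⋀^Fin 2]→L[ℝ] ℝ) (v w n : R3) :
    A v * θ ![w, n] + A w * θ ![n, v] + A n * θ ![v, w] = wedge A θ * det3 v w n := by
  rw [functional_expand A v, functional_expand A w, functional_expand A n, twoForm_expand θ w n,
    twoForm_expand θ n v, twoForm_expand θ v w, wedge, det3]
  ring

/-- The determinant of an endomorphism of `R3`. -/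
def jac (L : R3 →L[ℝ] R3) : ℝ := det3 (L (stdVec 0)) (L (stdVec 1)) (L (stdVec 2))

theorem det3_map (L : R3 →L[ℝ] R3) (v w n : R3) :
    det3 (L v) (L w) (L n) = jac L * det3 v w n := by
  rw [clm_expand L v, clm_expand L w, clm_expand L n]
  simp only [jac, det3, PiLp.add_apply, PiLp.smul_apply, smul_eq_mul]
  ring

theorem jac_comp (L M : R3 →L[ℝ] R3) : jac (L.comp M) = jac L * jac M := by
  rw [jac]
  simp only [ContinuousLinearMap.comp_apply]
  rw [det3_map]; rfl

theorem jac_id : jac (ContinuousLinearMap.id ℝ R3) = 1 := by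
  simp [jac, det3, stdVec_apply]

theorem jac_ne_zero_of_comp_eq_id {L M : R3 →L[ℝ] R3}
    (h : L.comp M = ContinuousLinearMap.id ℝ R3) : jac L ≠ 0 := by
  intro h0
  have := jac_comp L M
  rw [h, jac_id, h0, zero_mul] at this
  exact one_ne_zero this

theorem injective_of_jac_ne_zero {L : R3 →L[ℝ] R3} (h : jac L ≠ 0) : Function.Injective L := by
  rw [injective_iff_map_eq_zero]
  intro v hv
  have h0 := det3_map L v (stdVec 1) (stdVec 2)
  have h1 := det3_map L v (stdVec 2) (stdVec 0)
  have h2 := det3_map L v (stdVec 0) (stdVec 1)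
  rw [hv] at h0 h1 h2
  simp [det3, stdVec_apply, h] at h0 h1 h2
  ext i; fin_cases i <;> simp [h0, h1, h2]

theorem exists_equiv_of_injective {L : R3 →L[ℝ] R3} (h : Function.Injective L) :
    ∃ e : R3 ≃L[ℝ] R3, (e : R3 →L[ℝ] R3) = L := by
  refine ⟨(LinearEquiv.ofInjectiveEndo (L : R3 →ₗ[ℝ] R3) h).toContinuousLinearEquiv, ?_⟩
  ext1 v; rfl

theorem continuous_jac : Continuous jac := by
  unfold jac det3
  fun_prop

theorem wedge_comp (A : R3 →L[ℝ] ℝ) (θ θ' : R3 [⋀^Fin 2]→L[ℝ] ℝ) (L : R3 →L[ℝ] R3)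
    (h : ∀ v w, θ' ![v, w] = θ ![L v, L w]) : wedge (A.comp L) θ' = wedge A θ * jac L := by
  rw [jac, ← wedge_mul_det3, wedge, h, h, h]
  simp only [ContinuousLinearMap.comp_apply]

end LinearAlgebra

/-! ### The pointwise Moser equation. -/

section Moser

/-- The solution `Y` of `A Y = 0`, `ι_Y θ + B ∈ ℝ A`. -/
def moserVector (A B : R3 →L[ℝ] ℝ) (θ : R3 [⋀^Fin 2]→L[ℝ] ℝ) : R3 :=
  (wedge A θ)⁻¹ • ((A (stdVec 1) * B (stdVec 2) - A (stdVec 2) * B (stdVec 1)) • stdVec 0 +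
    (A (stdVec 2) * B (stdVec 0) - A (stdVec 0) * B (stdVec 2)) • stdVec 1 +
    (A (stdVec 0) * B (stdVec 1) - A (stdVec 1) * B (stdVec 0)) • stdVec 2)

theorem apply_moserVector (A B : R3 →L[ℝ] ℝ) (θ : R3 [⋀^Fin 2]→L[ℝ] ℝ) :
    A (moserVector A B θ) = 0 := by
  simp only [moserVector, map_smul, map_add, smul_eq_mul]
  ring

/-- `moserVector` is the cross product of `A` and `B` divided by `A ∧ θ`. The explicit multiplier on
the right becomes the coefficient of the scalar equation satisfied along the flow. -/
theorem contract_moserVector {A B : R3 →L[ℝ] ℝ} {θ : R3 [⋀^Fin 2]→L[ℝ] ℝ} (h : wedge A θ ≠ 0)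
    (v : R3) : θ ![moserVector A B θ, v] + B v = wedge B θ / wedge A θ * A v := by
  rw [twoForm_expand, functional_expand B v, functional_expand A v]
  simp only [moserVector, PiLp.add_apply, PiLp.smul_apply, smul_eq_mul, stdVec_apply]
  simp only [Fin.reduceEq, if_true, if_false, mul_one, mul_zero, add_zero, zero_add]
  field_simp
  unfold wedge
  ring

theorem moserVector_eq_zero {A : R3 →L[ℝ] ℝ} (θ : R3 [⋀^Fin 2]→L[ℝ] ℝ) (c : ℝ) :
    moserVector A (c • A) θ = 0 := by
  simp only [moserVector, smul_apply, smul_eq_mul]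
  rw [show A (stdVec 1) * (c * A (stdVec 2)) - A (stdVec 2) * (c * A (stdVec 1)) = 0 by ring,
    show A (stdVec 2) * (c * A (stdVec 0)) - A (stdVec 0) * (c * A (stdVec 2)) = 0 by ring,
    show A (stdVec 0) * (c * A (stdVec 1)) - A (stdVec 1) * (c * A (stdVec 0)) = 0 by ring]
  simp

/-- `θ` is nondegenerate on `ker A` when `A ∧ θ ≠ 0`. This makes the solution of the Moser equation
unique. -/
theorem eq_zero_of_contract_eq {A : R3 →L[ℝ] ℝ} {θ : R3 [⋀^Fin 2]→L[ℝ] ℝ} (h : wedge A θ ≠ 0)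
    {z : R3} (hz : A z = 0) {μ : ℝ} (hμ : ∀ v, θ ![z, v] = μ * A v) : z = 0 := by
  have h0 := hμ (stdVec 0)
  have h1 := hμ (stdVec 1)
  have h2 := hμ (stdVec 2)
  rw [twoForm_expand] at h0 h1 h2
  rw [functional_expand] at hz
  simp only [stdVec_apply, Fin.reduceEq, if_true, if_false, mul_one, mul_zero, add_zero, zero_add,
    sub_zero, zero_sub, zero_mul] at h0 h1 h2
  have e0 : wedge A θ * z 0 = 0 := by
    unfold wedge
    linear_combination θ ![stdVec 1, stdVec 2] * hz + A (stdVec 2) * h1 - A (stdVec 1) * h2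
  have e1 : wedge A θ * z 1 = 0 := by
    unfold wedge
    linear_combination θ ![stdVec 2, stdVec 0] * hz + A (stdVec 0) * h2 - A (stdVec 2) * h0
  have e2 : wedge A θ * z 2 = 0 := by
    unfold wedge
    linear_combination θ ![stdVec 0, stdVec 1] * hz + A (stdVec 1) * h0 - A (stdVec 0) * h1
  have f0 := (mul_eq_zero.1 e0).resolve_left h
  have f1 := (mul_eq_zero.1 e1).resolve_left h
  have f2 := (mul_eq_zero.1 e2).resolve_left h
  ext i; fin_cases i <;> simp [f0, f1, f2]

/-- Since `A`, `B` and `θ` all change sign under `U`, the image of the solution solves the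
transformed equation; uniqueness does the rest. -/
theorem moserVector_equivariant {A B A' B' : R3 →L[ℝ] ℝ} {θ θ' : R3 [⋀^Fin 2]→L[ℝ] ℝ}
    {U : R3 →L[ℝ] R3} (hU : Function.Surjective U) (h : wedge A θ ≠ 0) (h' : wedge A' θ' ≠ 0)
    (hA : ∀ v, A' (U v) = -A v) (hB : ∀ v, B' (U v) = -B v)
    (hθ : ∀ v w, θ' ![U v, U w] = -θ ![v, w]) :
    moserVector A' B' θ' = U (moserVector A B θ) := by
  rw [← sub_eq_zero]
  refine eq_zero_of_contract_eq h' (μ := wedge B' θ' / wedge A' θ' - wedge B θ / wedge A θ) ?_ ?_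
  · rw [map_sub, apply_moserVector, hA, apply_moserVector]; simp
  · intro y
    obtain ⟨v, rfl⟩ := hU y
    have h1 := contract_moserVector (B := B') h' (U v)
    have h2 := contract_moserVector (B := B) h v
    have h3 := hθ (moserVector A B θ) v
    rw [← toBilin_apply, map_sub, LinearMap.sub_apply, toBilin_apply, toBilin_apply]
    rw [hA, hB] at *
    linear_combination h1 + h2 - h3

end Moser

section ExteriorDerivative

theorem dForm_apply {α : R3 → R3 →L[ℝ] ℝ} {p : R3} (h : DifferentiableAt ℝ α p) (v w : R3) :
    dForm α p ![v, w] = fderiv ℝ α p v w - fderiv ℝ α p w v := by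
  let T : (R3 →L[ℝ] ℝ) →L[ℝ] R3 [⋀^Fin 1]→L[ℝ] ℝ :=
    (ContinuousAlternatingMap.ofSubsingletonLIE (𝕜 := ℝ) (E := R3) (F := ℝ) (0 : Fin 1)).toContinuousLinearEquiv
  have hT : (fun x => ContinuousAlternatingMap.ofSubsingleton ℝ R3 ℝ (0 : Fin 1) (α x)) =
      fun x => T (α x) := rfl
  have hd : HasFDerivAt (fun x => T (α x)) (T.comp (fderiv ℝ α p)) p :=
    T.hasFDerivAt.comp p h.hasFDerivAt
  rw [dForm, hT, extDeriv, hd.fderiv, ContinuousAlternatingMap.alternatizeUncurryFin_apply]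
  simp [Fin.sum_univ_two, T, Fin.removeNth, Fin.succAbove]
  ring

end ExteriorDerivative

end EquivContact

end

noncomputable section

open Set Filter Topology
open scoped ContDiff unitInterval

namespace EquivContact

/-! ### Grönwall uniqueness from either end of the unit interval. -/

section LinearODE

variable {E : Type*} [NormedAddCommGroup E] [NormedSpace ℝ E]

theorem eq_zero_of_norm_deriv_le_of_left {f f' : ℝ → E} {C : ℝ}
    (hf : ∀ t ∈ Icc (0 : ℝ) 1, HasDerivWithinAt f (f' t) (Icc 0 1) t)
    (hC : ∀ t ∈ Icc (0 : ℝ) 1, ‖f' t‖ ≤ C * ‖f t‖) (h0 : f 0 = 0) : f 1 = 0 :=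
  eq_zero_of_abs_deriv_le_mul_abs_self_of_eq_zero_right (f' := f') (K := C)
    (fun t ht => (hf t ht).continuousWithinAt)
    (fun t ht => (hf t ⟨ht.1, ht.2.le⟩).mono_of_mem_nhdsWithin
      (Icc_mem_nhdsGE_of_mem ht))
    h0 (fun t ht => hC t ⟨ht.1, ht.2.le⟩) 1 (by simp)

theorem eq_zero_of_norm_deriv_le_of_right {f f' : ℝ → E} {C : ℝ}
    (hf : ∀ t ∈ Icc (0 : ℝ) 1, HasDerivWithinAt f (f' t) (Icc 0 1) t)
    (hC : ∀ t ∈ Icc (0 : ℝ) 1, ‖f' t‖ ≤ C * ‖f t‖) (h1 : f 1 = 0) : f 0 = 0 := by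
  have hm : MapsTo (fun s : ℝ => 1 - s) (Icc 0 1) (Icc 0 1) :=
    fun s hs => ⟨by linarith [hs.2], by linarith [hs.1]⟩
  have := eq_zero_of_norm_deriv_le_of_left (f := fun s => f (1 - s)) (f' := fun s => -f' (1 - s))
    (C := C) (fun t ht => by
      have h2 : HasDerivWithinAt (fun s : ℝ => 1 - s) (-1) (Icc 0 1) t :=
        ((hasDerivAt_id t).const_sub 1).hasDerivWithinAt
      simpa [Function.comp_def] using (hf (1 - t) (hm ht)).scomp t h2 hm)
    (fun t ht => by simpa using hC _ (hm ht)) (by simpa using h1)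
  simpa using this

end LinearODE

/-! ### Pull-back of forms and anti-invariance. -/

section Pullback

/-- The pull-back of a 1-form. -/
def pullbackForm (f : R3 → R3) (α : R3 → R3 →L[ℝ] ℝ) (x : R3) : R3 →L[ℝ] ℝ :=
  (α (f x)).comp (fderiv ℝ f x)

theorem pullbackForm_apply (f : R3 → R3) (α : R3 → R3 →L[ℝ] ℝ) (x v : R3) :
    pullbackForm f α x v = α (f x) (fderiv ℝ f x v) := rfl

theorem contDiffOn_pullbackForm {f : R3 → R3} {α : R3 → R3 →L[ℝ] ℝ} {N O : Set R3}
    (hN : IsOpen N) (hf : ContDiffOn ℝ ∞ f N) (hα : ContDiffOn ℝ ∞ α O) (hm : MapsTo f N O) :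
    ContDiffOn ℝ ∞ (pullbackForm f α) N :=
  (hα.comp hf hm).clm_comp (hf.fderiv_of_isOpen hN (by simp))

/-- The terms with the second derivative of `f` cancel, because it is symmetric. -/
theorem dForm_pullbackForm {f : R3 → R3} {α : R3 → R3 →L[ℝ] ℝ} {x : R3}
    (hf : ContDiffAt ℝ ∞ f x) (hα : DifferentiableAt ℝ α (f x)) (v w : R3) :
    dForm (pullbackForm f α) x ![v, w] =
      dForm α (f x) ![fderiv ℝ f x v, fderiv ℝ f x w] := by
  have hf1 : HasFDerivAt f (fderiv ℝ f x) x := (hf.differentiableAt (by simp)).hasFDerivAt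
  have hf2 : HasFDerivAt (fderiv ℝ f) (fderiv ℝ (fderiv ℝ f) x) x :=
    ((hf.fderiv_right (m := ∞) (by simp)).differentiableAt (by simp)).hasFDerivAt
  have hd := (hα.hasFDerivAt.comp x hf1).clm_comp hf2
  have hsymm : IsSymmSndFDerivAt ℝ f x := hf.isSymmSndFDerivAt (by
    rw [minSmoothness_of_isRCLikeNormedField]; exact WithTop.coe_le_coe.2 le_top)
  have hd' : HasFDerivAt (pullbackForm f α) _ x := hd
  rw [dForm_apply hd'.differentiableAt, dForm_apply hα, hd'.fderiv]
  have := hsymm v w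
  simp [this]

theorem contDiffOn_dForm_apply {α : R3 → R3 →L[ℝ] ℝ} {O : Set R3} (hO : IsOpen O)
    (hα : ContDiffOn ℝ ∞ α O) (v w : R3) : ContDiffOn ℝ ∞ (fun x => dForm α x ![v, w]) O := by
  have h1 : ContDiffOn ℝ ∞ (fderiv ℝ α) O := hα.fderiv_of_isOpen hO (by simp)
  refine (((h1.clm_apply (contDiffOn_const (c := v))).clm_apply (contDiffOn_const (c := w))).sub
    ((h1.clm_apply (contDiffOn_const (c := w))).clm_apply (contDiffOn_const (c := v)))).congr fun x hx => ?_
  exact dForm_apply ((hα.contDiffAt (hO.mem_nhds hx)).differentiableAt (by simp)) v w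

theorem contactVolume_eq_wedge (α : R3 → R3 →L[ℝ] ℝ) (p : R3) :
    contactVolume α p = wedge (α p) (dForm α p) := rfl

theorem contactVolume_pullbackForm {f : R3 → R3} {α : R3 → R3 →L[ℝ] ℝ} {x : R3}
    (hf : ContDiffAt ℝ ∞ f x) (hα : DifferentiableAt ℝ α (f x)) :
    contactVolume (pullbackForm f α) x = contactVolume α (f x) * jac (fderiv ℝ f x) :=
  wedge_comp _ _ _ _ (dForm_pullbackForm hf hα)

theorem dForm_antiInvariant {α : R3 → R3 →L[ℝ] ℝ} {u : R3 → R3} {O : Set R3} {x : R3}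
    (hO : IsOpen O) (hu : ContDiff ℝ ∞ u) (huO : MapsTo u O O) (hα : ContDiffOn ℝ ∞ α O)
    (huα : ∀ p ∈ O, ∀ v, α (u p) (fderiv ℝ u p v) = -α p v) (hx : x ∈ O) (v w : R3) :
    dForm α (u x) ![fderiv ℝ u x v, fderiv ℝ u x w] = -dForm α x ![v, w] := by
  have hd : ∀ y ∈ O, DifferentiableAt ℝ α y :=
    fun y hy => (hα.contDiffAt (hO.mem_nhds hy)).differentiableAt (by simp)
  have h1 : pullbackForm u α =ᶠ[𝓝 x] fun y => -α y := by
    filter_upwards [hO.mem_nhds hx] with y hy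
    ext z
    exact huα y hy z
  rw [← dForm_pullbackForm hu.contDiffAt (hd _ (huO hx)), dForm_apply
    ((hd x hx).neg.congr_of_eventuallyEq h1), dForm_apply (hd x hx), h1.fderiv_eq]
  have : fderiv ℝ (fun y => -α y) x = -fderiv ℝ α x := fderiv_fun_neg
  rw [this]
  simp; ring

theorem fderiv_comp_fderiv_of_involutive {u : R3 → R3} (hu : ContDiff ℝ ∞ u)
    (hui : Function.Involutive u) (x : R3) :
    (fderiv ℝ u (u x)).comp (fderiv ℝ u x) = ContinuousLinearMap.id ℝ R3 := by
  have hd : ∀ y, HasFDerivAt u (fderiv ℝ u y) y :=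
    fun y => (hu.differentiable (by simp) y).hasFDerivAt
  have h1 : HasFDerivAt (u ∘ u) _ x := (hd (u x)).comp x (hd x)
  rw [hui.comp_self] at h1
  exact h1.unique (hasFDerivAt_id x)

theorem fderiv_involutive_apply {u : R3 → R3} (hu : ContDiff ℝ ∞ u)
    (hui : Function.Involutive u) (x v : R3) : fderiv ℝ u (u x) (fderiv ℝ u x v) = v :=
  congrArg (fun L : R3 →L[ℝ] R3 => L v) (fderiv_comp_fderiv_of_involutive hu hui x)

end Pullback

end EquivContact

end

/-! ### Moser's trick for the linear path between two contact forms. -/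

noncomputable section

open Set Filter Topology
open scoped ContDiff unitInterval

namespace EquivContact

/-- The linear path of 1-forms from `α` to `β`. -/
def pathForm (α β : R3 → R3 →L[ℝ] ℝ) (q : ℝ × R3) : R3 →L[ℝ] ℝ :=
  α q.2 + q.1 • (β q.2 - α q.2)

/-- The exterior derivatives of the linear path of 1-forms from `α` to `β`. -/
def pathDForm (α β : R3 → R3 →L[ℝ] ℝ) (q : ℝ × R3) : R3 [⋀^Fin 2]→L[ℝ] ℝ :=
  dForm α q.2 + q.1 • (dForm β q.2 - dForm α q.2)

/-- The time-dependent vector field whose flow carries `ker α` to `ker β`. -/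
def moserField (α β : R3 → R3 →L[ℝ] ℝ) (q : ℝ × R3) : R3 :=
  moserVector (pathForm α β q) (β q.2 - α q.2) (pathDForm α β q)

theorem pathForm_apply (α β : R3 → R3 →L[ℝ] ℝ) (q : ℝ × R3) (v : R3) :
    pathForm α β q v = α q.2 v + q.1 * (β q.2 v - α q.2 v) := rfl

theorem pathDForm_apply (α β : R3 → R3 →L[ℝ] ℝ) (q : ℝ × R3) (v : Fin 2 → R3) :
    pathDForm α β q v = dForm α q.2 v + q.1 * (dForm β q.2 v - dForm α q.2 v) := rfl

section

variable {α β : R3 → R3 →L[ℝ] ℝ} {O : Set R3}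

theorem contDiffOn_pathForm_apply (hα : ContDiffOn ℝ ∞ α O) (hβ : ContDiffOn ℝ ∞ β O) (v : R3) :
    ContDiffOn ℝ ∞ (fun q => pathForm α β q v) (univ ×ˢ O) := by
  have h1 : ContDiffOn ℝ ∞ (fun q : ℝ × R3 => α q.2 v) (univ ×ˢ O) :=
    (hα.clm_apply contDiffOn_const).comp contDiffOn_snd fun q hq => hq.2
  have h2 : ContDiffOn ℝ ∞ (fun q : ℝ × R3 => β q.2 v) (univ ×ˢ O) :=
    (hβ.clm_apply contDiffOn_const).comp contDiffOn_snd fun q hq => hq.2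
  exact h1.add (contDiffOn_fst.mul (h2.sub h1))

theorem contDiffOn_pathDForm_apply (hO : IsOpen O) (hα : ContDiffOn ℝ ∞ α O)
    (hβ : ContDiffOn ℝ ∞ β O) (v w : R3) :
    ContDiffOn ℝ ∞ (fun q => pathDForm α β q ![v, w]) (univ ×ˢ O) := by
  have h1 : ContDiffOn ℝ ∞ (fun q : ℝ × R3 => dForm α q.2 ![v, w]) (univ ×ˢ O) :=
    (contDiffOn_dForm_apply hO hα v w).comp contDiffOn_snd fun q hq => hq.2
  have h2 : ContDiffOn ℝ ∞ (fun q : ℝ × R3 => dForm β q.2 ![v, w]) (univ ×ˢ O) :=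
    (contDiffOn_dForm_apply hO hβ v w).comp contDiffOn_snd fun q hq => hq.2
  exact h1.add (contDiffOn_fst.mul (h2.sub h1))

theorem contDiffOn_wedge {X : Type*} [NormedAddCommGroup X] [NormedSpace ℝ X] {s : Set X}
    {A : X → R3 →L[ℝ] ℝ} {θ : X → R3 [⋀^Fin 2]→L[ℝ] ℝ}
    (hA : ∀ v, ContDiffOn ℝ ∞ (fun x => A x v) s)
    (hθ : ∀ v w, ContDiffOn ℝ ∞ (fun x => θ x ![v, w]) s) :
    ContDiffOn ℝ ∞ (fun x => wedge (A x) (θ x)) s :=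
  (((hA _).mul (hθ _ _)).add ((hA _).mul (hθ _ _))).add ((hA _).mul (hθ _ _))

theorem contDiffOn_moserField (hO : IsOpen O) (hα : ContDiffOn ℝ ∞ α O) (hβ : ContDiffOn ℝ ∞ β O)
    {R : Set (ℝ × R3)} (hRO : R ⊆ univ ×ˢ O)
    (hR : ∀ q ∈ R, wedge (pathForm α β q) (pathDForm α β q) ≠ 0) :
    ContDiffOn ℝ ∞ (moserField α β) R := by
  have hA : ∀ v, ContDiffOn ℝ ∞ (fun q => pathForm α β q v) R :=
    fun v => (contDiffOn_pathForm_apply hα hβ v).mono hRO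
  have hθ : ∀ v w, ContDiffOn ℝ ∞ (fun q => pathDForm α β q ![v, w]) R :=
    fun v w => (contDiffOn_pathDForm_apply hO hα hβ v w).mono hRO
  have hB : ∀ v, ContDiffOn ℝ ∞ (fun q : ℝ × R3 => (β q.2 - α q.2) v) R := by
    intro v
    have h : ContDiffOn ℝ ∞ (fun x => (β x - α x) v) O :=
      (hβ.sub hα).clm_apply contDiffOn_const
    exact h.comp contDiffOn_snd fun q hq => (hRO hq).2
  exact ((contDiffOn_wedge hA hθ).inv hR).smul
    ((((((hA _).mul (hB _)).sub ((hA _).mul (hB _))).smul contDiffOn_const).add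
      ((((hA _).mul (hB _)).sub ((hA _).mul (hB _))).smul contDiffOn_const)).add
      ((((hA _).mul (hB _)).sub ((hA _).mul (hB _))).smul contDiffOn_const))

/-- Where `β` is a positive multiple of `α` and both are positive contact forms, so are all the
forms of the linear path. -/
theorem wedge_pathForm_pos {p : R3} (hα : 0 < contactVolume α p) (hβ : 0 < contactVolume β p)
    {c : ℝ} (hc : 0 < c) (h : β p = c • α p) {t : ℝ} (ht : t ∈ Icc (0 : ℝ) 1) :
    0 < wedge (pathForm α β (t, p)) (pathDForm α β (t, p)) := by
  -- Proportionality at `p` says nothing about `dForm β p`; positivity of `α ∧ dβ` is recovered from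
  -- `β ∧ dβ = c • α ∧ dβ`.
  have h1 : wedge (pathForm α β (t, p)) (pathDForm α β (t, p)) =
      ((1 - t) + t * c) * ((1 - t) * contactVolume α p + t * wedge (α p) (dForm β p)) := by
    rw [contactVolume_eq_wedge]
    simp only [wedge, pathForm_apply, pathDForm_apply, h, smul_apply, smul_eq_mul]
    ring
  have h2 : contactVolume β p = c * wedge (α p) (dForm β p) := by
    rw [contactVolume_eq_wedge, h]
    simp only [wedge, smul_apply, smul_eq_mul]
    ring
  have h3 : 0 < wedge (α p) (dForm β p) := by
    rw [h2] at hβ; exact (pos_iff_pos_of_mul_pos hβ).1 hc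
  rw [h1]
  rcases eq_or_lt_of_le ht.1 with rfl | h0
  · simpa using hα
  · have : 0 ≤ 1 - t := by linarith [ht.2]
    positivity

/-- Here `β - α` is a multiple of the form `α_t` of the path, so their cross product vanishes and
the flow fixes the point. -/
theorem moserField_eq_zero {p : R3} {c : ℝ} (hc : 0 < c) (h : β p = c • α p) {t : ℝ}
    (ht : t ∈ Icc (0 : ℝ) 1) : moserField α β (t, p) = 0 := by
  have h0 : 0 < (1 - t) + t * c := by
    rcases eq_or_lt_of_le ht.1 with rfl | h0
    · simp
    · have : 0 ≤ 1 - t := by linarith [ht.2]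
      positivity
  have h1 : β p - α p = ((c - 1) / ((1 - t) + t * c)) • pathForm α β (t, p) := by
    ext v
    rw [smul_apply, pathForm_apply, sub_apply, h, smul_apply, smul_eq_mul, smul_eq_mul]
    rw [div_mul_eq_mul_div, eq_div_iff h0.ne']
    ring
  rw [moserField, h1, moserVector_eq_zero]

/-- The derivative of `α_t(η)` along the linearized flow of the Moser vector field. -/
theorem hasDerivWithinAt_pathForm_apply (hO : IsOpen O) (hα : ContDiffOn ℝ ∞ α O)
    (hβ : ContDiffOn ℝ ∞ β O) {R : Set (ℝ × R3)} (hRo : IsOpen R) (hRO : R ⊆ univ ×ˢ O)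
    (hR : ∀ q ∈ R, wedge (pathForm α β q) (pathDForm α β q) ≠ 0) {γ η : ℝ → R3} {t : ℝ} {s : Set ℝ}
    (hq : (t, γ t) ∈ R) (hγ : HasDerivWithinAt γ (moserField α β (t, γ t)) s t)
    (hη : HasDerivWithinAt η (fderiv ℝ (moserField α β) (t, γ t) (0, η t)) s t) :
    HasDerivWithinAt (fun t => pathForm α β (t, γ t) (η t))
      (wedge (β (γ t) - α (γ t)) (pathDForm α β (t, γ t)) /
        wedge (pathForm α β (t, γ t)) (pathDForm α β (t, γ t)) * pathForm α β (t, γ t) (η t))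
      s t := by
  set Y := moserField α β
  have hx : γ t ∈ O := (hRO hq).2
  have hdα : HasFDerivAt α (fderiv ℝ α (γ t)) (γ t) :=
    ((hα.contDiffAt (hO.mem_nhds hx)).differentiableAt (by simp)).hasFDerivAt
  have hdβ : HasFDerivAt β (fderiv ℝ β (γ t)) (γ t) :=
    ((hβ.contDiffAt (hO.mem_nhds hx)).differentiableAt (by simp)).hasFDerivAt
  have hdY : HasFDerivAt Y (fderiv ℝ Y (t, γ t)) (t, γ t) :=
    (((contDiffOn_moserField hO hα hβ hRO hR).contDiffAt (hRo.mem_nhds hq)).differentiableAt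
      (by simp)).hasFDerivAt
  have h1 := hdα.comp_hasDerivWithinAt t hγ
  have h2 := hdβ.comp_hasDerivWithinAt t hγ
  have h3 := (h1.add ((hasDerivWithinAt_id t s).smul (h2.sub h1))).clm_apply hη
  have hYx : HasFDerivAt (fun x => Y (t, x))
      ((fderiv ℝ Y (t, γ t)).comp (ContinuousLinearMap.inr ℝ ℝ R3)) (γ t) :=
    hdY.comp (γ t) (hasFDerivAt_prodMk_right t (γ t))
  have hax : HasFDerivAt (fun x => pathForm α β (t, x))
      (fderiv ℝ α (γ t) + t • (fderiv ℝ β (γ t) - fderiv ℝ α (γ t))) (γ t) :=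
    hdα.add ((hdβ.sub hdα).const_smul t)
  have h4 := hax.clm_apply hYx
  -- Differentiating the identity `α_t (Y_t) = 0` along `η` replaces `α_t (DY η)` by `-(Dα_t η) Y`.
  -- The derivative sought becomes `dα_t (Y, η) + (β - α) η`, which the Moser equation makes a
  -- multiple of `α_t η`.
  have h5 : (fun x => pathForm α β (t, x) (Y (t, x))) = fun _ => 0 :=
    funext fun x => apply_moserVector _ _ _
  have h6 := congrArg (fun L : R3 →L[ℝ] ℝ => L (η t))
    (h4.unique (h5 ▸ hasFDerivAt_const (0 : ℝ) (γ t)))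
  have h7 := contract_moserVector (B := β (γ t) - α (γ t)) (hR _ hq) (η t)
  change pathDForm α β (t, γ t) ![Y (t, γ t), η t] + _ = _ at h7
  rw [pathDForm_apply, dForm_apply hdα.differentiableAt, dForm_apply hdβ.differentiableAt] at h7
  refine h3.congr_deriv ?_
  rw [← h7]
  simp [pathForm_apply] at h6 ⊢
  linear_combination h6

/-- `α_t (η t)` solves a homogeneous scalar linear equation with bounded coefficient, so it vanishes
at time `1` if it vanishes at time `0`. -/
theorem form_apply_eq_zero_of_linearized_flow (hO : IsOpen O) (hα : ContDiffOn ℝ ∞ α O)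
    (hβ : ContDiffOn ℝ ∞ β O) {R : Set (ℝ × R3)} (hRo : IsOpen R) (hRO : R ⊆ univ ×ˢ O)
    (hR : ∀ q ∈ R, wedge (pathForm α β q) (pathDForm α β q) ≠ 0) {γ η : ℝ → R3}
    (hmem : ∀ t ∈ Icc (0 : ℝ) 1, (t, γ t) ∈ R)
    (hγ : ∀ t ∈ Icc (0 : ℝ) 1, HasDerivWithinAt γ (moserField α β (t, γ t)) (Icc 0 1) t)
    (hη : ∀ t ∈ Icc (0 : ℝ) 1,
      HasDerivWithinAt η (fderiv ℝ (moserField α β) (t, γ t) (0, η t)) (Icc 0 1) t)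
    (h0 : α (γ 0) (η 0) = 0) : β (γ 1) (η 1) = 0 := by
  have hcγ : ContinuousOn (fun t => (t, γ t)) (Icc 0 1) :=
    continuousOn_id.prodMk fun t ht => (hγ t ht).continuousWithinAt
  have hB : ∀ v, ContDiffOn ℝ ∞ (fun q : ℝ × R3 => (β q.2 - α q.2) v) (univ ×ˢ O) := by
    intro v
    have h : ContDiffOn ℝ ∞ (fun x => (β x - α x) v) O :=
      (hβ.sub hα).clm_apply contDiffOn_const
    exact h.comp contDiffOn_snd fun q hq => hq.2
  have hw1 : ContinuousOn (fun q : ℝ × R3 => wedge (β q.2 - α q.2) (pathDForm α β q))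
      (univ ×ˢ O) := (contDiffOn_wedge hB (contDiffOn_pathDForm_apply hO hα hβ)).continuousOn
  have hw2 : ContinuousOn (fun q : ℝ × R3 => wedge (pathForm α β q) (pathDForm α β q))
      (univ ×ˢ O) := (contDiffOn_wedge (contDiffOn_pathForm_apply hα hβ)
        (contDiffOn_pathDForm_apply hO hα hβ)).continuousOn
  have hm : MapsTo (fun t => (t, γ t)) (Icc 0 1) (univ ×ˢ O) := fun t ht => hRO (hmem t ht)
  have hc : ContinuousOn (fun t => wedge (β (γ t) - α (γ t)) (pathDForm α β (t, γ t)) /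
      wedge (pathForm α β (t, γ t)) (pathDForm α β (t, γ t))) (Icc 0 1) :=
    (hw1.comp hcγ hm).div (hw2.comp hcγ hm) fun t ht => hR _ (hmem t ht)
  obtain ⟨C, hC⟩ := isCompact_Icc.exists_bound_of_continuousOn hc
  have h1 := eq_zero_of_norm_deriv_le_of_left (C := C)
    (f := fun t => pathForm α β (t, γ t) (η t))
    (fun t ht => hasDerivWithinAt_pathForm_apply hO hα hβ hRo hRO hR (hmem t ht) (hγ t ht)
      (hη t ht))
    (fun t ht => by
      rw [norm_mul]
      exact mul_le_mul_of_nonneg_right (hC t ht) (norm_nonneg _))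
    (by simpa [pathForm_apply] using h0)
  simpa [pathForm_apply] using h1

end

/-- **Moser's trick.** Two positive contact forms near a compact set which are positively
proportional along that set have diffeomorphic kernels near the set, through a diffeomorphism fixing
the set pointwise. -/
theorem exists_moser_diffeo {K O : Set R3} (hK : IsCompact K) (hO : IsOpen O) (hKO : K ⊆ O)
    {α β : R3 → R3 →L[ℝ] ℝ} (hα : ContDiffOn ℝ ∞ α O) (hβ : ContDiffOn ℝ ∞ β O)
    (hαpos : ∀ p ∈ K, 0 < contactVolume α p) (hβpos : ∀ p ∈ K, 0 < contactVolume β p)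
    (hαβ : ∀ p ∈ K, ∃ c : ℝ, 0 < c ∧ β p = c • α p) {u : R3 → R3} (hu : ContDiff ℝ ∞ u)
    (hui : Function.Involutive u) (huK : MapsTo u K K) (huO : MapsTo u O O)
    (huα : ∀ p ∈ O, ∀ v, α (u p) (fderiv ℝ u p v) = -α p v)
    (huβ : ∀ p ∈ O, ∀ v, β (u p) (fderiv ℝ u p v) = -β p v) :
    ∃ (N : Set R3) (χ : R3 → R3), IsOpen N ∧ K ⊆ N ∧ ContDiffOn ℝ ∞ χ N ∧
      MapsTo χ N O ∧ (∀ p ∈ K, χ p = p) ∧ (∀ p ∈ K, Function.Injective (fderiv ℝ χ p)) ∧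
      (∀ x ∈ N, ∀ v, α x v = 0 → β (χ x) (fderiv ℝ χ x v) = 0) ∧
      ∀ x ∈ N, u x ∈ N → χ (u x) = u (χ x) := by
  set W : ℝ × R3 → ℝ := fun q => wedge (pathForm α β q) (pathDForm α β q) with hW
  have hWs : ContDiffOn ℝ ∞ W (univ ×ˢ O) :=
    contDiffOn_wedge (contDiffOn_pathForm_apply hα hβ) (contDiffOn_pathDForm_apply hO hα hβ)
  -- `R` is where `α_t ∧ dα_t` does not vanish; it contains `[0, 1] × K` because the two forms are
  -- positively proportional on `K`.
  set R : Set (ℝ × R3) := (univ ×ˢ O) ∩ W ⁻¹' {0}ᶜ with hRdef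
  have hRo : IsOpen R := hWs.continuousOn.isOpen_inter_preimage (isOpen_univ.prod hO)
    isOpen_compl_singleton
  have hRO : R ⊆ univ ×ˢ O := inter_subset_left
  have hR : ∀ q ∈ R, wedge (pathForm α β q) (pathDForm α β q) ≠ 0 := fun q hq => hq.2
  have hY := contDiffOn_moserField hO hα hβ hRO hR
  have hKR : Icc (0 : ℝ) 1 ×ˢ K ⊆ R := by
    rintro ⟨t, p⟩ ⟨ht, hp⟩
    obtain ⟨c, hc, h⟩ := hαβ p hp
    exact ⟨⟨trivial, hKO hp⟩, (wedge_pathForm_pos (hαpos p hp) (hβpos p hp) hc h ht).ne'⟩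
  obtain ⟨N, Γ, hN, hKN, hΓ, hΓK, hΓ0, hΓR, hΓd, hη0, hηd, hΓu⟩ :=
    exists_equivariant_flow hK hRo hKR hY (by
      rintro ⟨t, p⟩ ⟨ht, hp⟩
      obtain ⟨c, hc, h⟩ := hαβ p hp
      exact moserField_eq_zero hc h ht) hu huK (by
      intro t x hx hux
      refine moserVector_equivariant
        (fun y => ⟨fderiv ℝ u (u x) y, ?_⟩) (hR _ hx) (hR _ hux) ?_ ?_ ?_
      · have := fderiv_involutive_apply hu hui (u x) y
        rwa [hui x] at this
      · intro v
        simp only [pathForm_apply, huα x hx.1.2, huβ x hx.1.2]; ring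
      · intro v
        simp only [sub_apply, huα x hx.1.2, huβ x hx.1.2]; ring
      · intro v w
        simp only [pathDForm_apply, dForm_antiInvariant hO hu huO hα huα hx.1.2,
          dForm_antiInvariant hO hu huO hβ huβ hx.1.2]
        ring)
  have hproj1 : projIcc (0 : ℝ) 1 zero_le_one 1 = 1 := projIcc_right _
  have hproj0 : projIcc (0 : ℝ) 1 zero_le_one 0 = 0 := projIcc_left _
  let ev : C(I, R3) →L[ℝ] R3 := ContinuousMap.evalCLM ℝ (1 : I)
  have hχd : ∀ x ∈ N, HasFDerivAt (fun x => Γ x 1) (ev.comp (fderiv ℝ Γ x)) x := fun x hx =>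
    ev.hasFDerivAt.comp x ((hΓ.contDiffAt (hN.mem_nhds hx)).differentiableAt (by simp)).hasFDerivAt
  have hχv : ∀ x ∈ N, ∀ v, fderiv ℝ (fun x => Γ x 1) x v = fderiv ℝ Γ x v 1 := fun x hx v => by
    rw [(hχd x hx).fderiv]; rfl
  refine ⟨N, fun x => Γ x 1, hN, hKN, ev.contDiff.comp_contDiffOn hΓ,
    fun x hx => (hRO (hΓR x hx 1)).2, fun p hp => hΓK p hp 1, ?_, ?_,
    fun x hx hux => hΓu x hx hux 1⟩
  -- At `p ∈ K` the integral curve is constant. The linearized flow solves a linear equation with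
  -- bounded coefficient, so a vector sent to zero at time `1` was zero at time `0`.
  · intro p hp
    rw [injective_iff_map_eq_zero]
    intro v hv
    rw [hχv p (hKN hp)] at hv
    have hc : ContinuousOn (fun t : ℝ => fderiv ℝ (moserField α β) (t, p)) (Icc 0 1) :=
      (hY.continuousOn_fderiv_of_isOpen hRo (by simp)).comp (by fun_prop)
        fun t ht => hKR ⟨ht, hp⟩
    obtain ⟨C, hC⟩ := isCompact_Icc.exists_bound_of_continuousOn hc
    have h1 := eq_zero_of_norm_deriv_le_of_right (C := C)
      (f := fun s => fderiv ℝ Γ p v (projIcc 0 1 zero_le_one s))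
      (f' := fun t => fderiv ℝ (moserField α β) (t, p)
        (0, fderiv ℝ Γ p v (projIcc 0 1 zero_le_one t)))
      (fun t ht => by
        have := hηd p (hKN hp) v t ht
        rw [hΓK p hp] at this
        rwa [projIcc_of_mem _ ht])
      (fun t ht => by
        refine (ContinuousLinearMap.le_opNorm _ _).trans ?_
        have h2 : ‖((0 : ℝ), fderiv ℝ Γ p v (projIcc 0 1 zero_le_one t))‖ =
            ‖fderiv ℝ Γ p v (projIcc 0 1 zero_le_one t)‖ := by simp [Prod.norm_def]
        rw [h2]
        exact mul_le_mul_of_nonneg_right (hC t ht) (norm_nonneg _))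
      (by rw [hproj1]; exact hv)
    rw [hproj0, hη0 p (hKN hp)] at h1
    exact h1
  · intro x hx v hv
    have hγt : ∀ t (ht : t ∈ Icc (0 : ℝ) 1),
        Γ x (projIcc 0 1 zero_le_one t) = Γ x ⟨t, ht⟩ := fun t ht => by rw [projIcc_of_mem _ ht]
    have hηt : ∀ t (ht : t ∈ Icc (0 : ℝ) 1), fderiv ℝ Γ x v (projIcc 0 1 zero_le_one t) =
        fderiv ℝ Γ x v ⟨t, ht⟩ := fun t ht => by rw [projIcc_of_mem _ ht]
    have h1 := form_apply_eq_zero_of_linearized_flow hO hα hβ hRo hRO hR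
      (γ := fun s => Γ x (projIcc 0 1 zero_le_one s))
      (η := fun s => fderiv ℝ Γ x v (projIcc 0 1 zero_le_one s))
      (fun t ht => by simpa only [hγt t ht] using hΓR x hx ⟨t, ht⟩)
      (fun t ht => by simpa only [hγt t ht] using hΓd x hx t ht)
      (fun t ht => by simpa only [hγt t ht, hηt t ht] using hηd x hx v t ht)
      (by simpa only [hproj0, hΓ0 x hx, hη0 x hx v] using hv)
    rw [hχv x hx]
    simpa only [hproj1] using h1

end EquivContact

end

noncomputable section

open Set Filter Topology
open scoped ContDiff Manifold

namespace EquivContact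

/-! ### Tangent planes of surfaces and extension of smooth maps. -/

section TangentPlane

variable {F : Type*} [NormedAddCommGroup F] [NormedSpace ℝ F] {S : Set R3} {p : R3}

/-- A derivative within `S` is determined on the tangent cone, hence by linearity on its span, but
in no other direction. -/
theorem eqOn_tangentPlane {f : R3 → F} {f' f'' : R3 →L[ℝ] F}
    (h' : HasFDerivWithinAt f f' S p) (h'' : HasFDerivWithinAt f f'' S p) {v : R3}
    (hv : v ∈ tangentPlane S p) : f' v = f'' v := by
  have : tangentPlane S p ≤ LinearMap.ker ((f' - f'' : R3 →L[ℝ] F) : R3 →ₗ[ℝ] F) := by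
    refine Submodule.span_le.2 fun y hy => ?_
    have := h'.unique_on h'' hy
    simp [this]
  have h := this hv
  rw [LinearMap.mem_ker] at h
  exact sub_eq_zero.1 h

theorem mapsTo_tangentPlane {f : R3 → R3} {f' : R3 →L[ℝ] R3} {S' : Set R3}
    (h : HasFDerivWithinAt f f' S p) (hm : MapsTo f S S') {v : R3} (hv : v ∈ tangentPlane S p) :
    f' v ∈ tangentPlane S' (f p) := by
  have h1 : tangentPlane S p ≤ (tangentPlane S' (f p)).comap (f' : R3 →ₗ[ℝ] R3) := by
    refine Submodule.span_le.2 fun y hy => ?_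
    exact Submodule.subset_span (tangentConeAt_mono hm.image_subset (h.mapsTo_tangent_cone hy))
  exact h1 hv

theorem fderiv_eq_of_eqOn {f g : R3 → F} (hf : DifferentiableAt ℝ f p)
    (hg : DifferentiableAt ℝ g p) (hp : p ∈ S) (h : ∀ᶠ x in 𝓝 p, x ∈ S → f x = g x) {v : R3}
    (hv : v ∈ tangentPlane S p) : fderiv ℝ f p v = fderiv ℝ g p v := by
  refine eqOn_tangentPlane (f := f) hf.hasFDerivAt.hasFDerivWithinAt
    (hg.hasFDerivAt.hasFDerivWithinAt.congr_of_eventuallyEq ?_ ?_) hv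
  · exact eventually_nhdsWithin_iff.2 h
  · exact h.self_of_nhds hp

/-- The tangent plane in terms of a chart. -/
theorem mem_tangentPlane_iff_of_chart {e : OpenPartialHomeomorph R3 R3} (hp : p ∈ S)
    (hpe : p ∈ e.source) (he : ContDiffOn ℝ ∞ e e.source) (he' : ContDiffOn ℝ ∞ e.symm e.target)
    (hS : (∀ x ∈ e.source, x ∈ S ↔ e x 2 = 0) ∨
      (∀ x ∈ e.source, x ∈ S ↔ e x 2 = 0 ∧ 0 ≤ e x 1)) (v : R3) :
    v ∈ tangentPlane S p ↔ fderiv ℝ e p v 2 = 0 := by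
  have hed : HasFDerivAt e (fderiv ℝ e p) p :=
    ((he.contDiffAt (e.open_source.mem_nhds hpe)).differentiableAt (by simp)).hasFDerivAt
  have hpt := e.map_source hpe
  have hed' : HasFDerivAt e.symm (fderiv ℝ e.symm (e p)) (e p) :=
    ((he'.contDiffAt (e.open_target.mem_nhds hpt)).differentiableAt (by simp)).hasFDerivAt
  have hinv : ∀ v, fderiv ℝ e.symm (e p) (fderiv ℝ e p v) = v := by
    have h1 := hed'.comp p hed
    have h2 : HasFDerivAt (e.symm ∘ e) (ContinuousLinearMap.id ℝ R3) p := by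
      refine (hasFDerivAt_id p).congr_of_eventuallyEq ?_
      filter_upwards [e.open_source.mem_nhds hpe] with x hx using e.left_inv hx
    exact fun v => congrArg (fun L : R3 →L[ℝ] R3 => L v) (h1.unique h2)
  have hcoord : HasFDerivAt (fun x => e x 2)
      ((EuclideanSpace.proj (2 : Fin 3) : R3 →L[ℝ] ℝ).comp (fderiv ℝ e p)) p :=
    (EuclideanSpace.proj (2 : Fin 3) : R3 →L[ℝ] ℝ).hasFDerivAt.comp p hed
  have h2 : ∀ x ∈ e.source, x ∈ S → e x 2 = 0 := by
    intro x hx hxS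
    rcases hS with h | h
    · exact (h x hx).1 hxS
    · exact ((h x hx).1 hxS).1
  constructor
  · intro hv
    have h3 := fderiv_eq_of_eqOn (f := fun x => e x 2) (g := fun _ => (0 : ℝ))
      hcoord.differentiableAt (differentiableAt_const _) hp (by
        filter_upwards [e.open_source.mem_nhds hpe] with x hx hxS using h2 x hx hxS) hv
    rw [hcoord.fderiv] at h3
    simpa using h3
  · intro hv
    -- `H` is the model plane or half-plane. Direction `1` points into the half-plane, so segments
    -- in the directions `0` and `1` stay in `H`, and the cone spans the whole plane even at a
    -- boundary point.
    set H : Set R3 := {y | y 2 = 0 ∧ ((∀ x ∈ e.source, x ∈ S ↔ e x 2 = 0) ∨ 0 ≤ y 1)} with hH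
    have hm : MapsTo e.symm (H ∩ e.target) S := by
      rintro y ⟨hy, hyt⟩
      have h3 := e.map_target hyt
      rcases hS with h | h
      · rw [h _ h3, e.right_inv hyt]; exact hy.1
      · rcases hy.2 with h' | h'
        · rw [h' _ h3, e.right_inv hyt]; exact hy.1
        · rw [h _ h3, e.right_inv hyt]; exact ⟨hy.1, h'⟩
    have hpH : e p ∈ H := by
      refine ⟨h2 p hpe hp, ?_⟩
      rcases hS with h | h
      · exact Or.inl h
      · exact Or.inr ((h p hpe).1 hp).2
    have hb : ∀ i : Fin 3, i ≠ 2 → fderiv ℝ e.symm (e p) (stdVec i) ∈ tangentPlane S p := by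
      intro i hi
      have hseg : segment ℝ (e p) (e p + stdVec i) ⊆ H := by
        rw [segment_eq_image']
        rintro _ ⟨θ, hθ, rfl⟩
        refine ⟨?_, ?_⟩
        · simp [stdVec_apply, hi.symm, hpH.1]
        · rcases hpH.2 with h | h
          · exact Or.inl h
          · right
            simp only [add_sub_cancel_left, PiLp.add_apply, PiLp.smul_apply, smul_eq_mul,
              stdVec_apply]
            have := hθ.1
            split_ifs <;> simp <;> linarith
      have h3 : stdVec i ∈ tangentConeAt ℝ (H ∩ e.target) (e p) := by
        rw [tangentConeAt_inter_nhds (e.open_target.mem_nhds hpt)]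
        simpa using mem_tangentConeAt_of_segment_subset hseg
      have h4 := mapsTo_tangentPlane (hed'.hasFDerivWithinAt (s := H ∩ e.target)) hm
        (Submodule.subset_span h3)
      rwa [e.left_inv hpe] at h4
    rw [← hinv v, clm_expand _ (fderiv ℝ e p v), hv, zero_smul, add_zero]
    exact Submodule.add_mem _ (Submodule.smul_mem _ _ (hb 0 (by decide)))
      (Submodule.smul_mem _ _ (hb 1 (by decide)))

end TangentPlane

/-- A smooth map on a compact set is the restriction of a smooth map on the whole space. -/
theorem SmoothOnSet.exists_contDiff {F : Type*} [NormedAddCommGroup F] [NormedSpace ℝ F]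
    {f : R3 → F} {S : Set R3} (hS : IsClosed S) (hf : SmoothOnSet f S) :
    ∃ g : R3 → F, ContDiff ℝ ∞ g ∧ EqOn g f S := by
  -- The condition at each point is convex: a prescribed value on `S`, none off `S`. Local
  -- extensions can therefore be glued by a partition of unity.
  obtain ⟨g, hg⟩ := exists_contMDiffMap_forall_mem_convex_of_local (n := (⊤ : ℕ∞)) (M := R3)
    (F := F) 𝓘(ℝ, R3) (t := fun x => {y | x ∈ S → y = f x}) (fun x => by
      by_cases hx : x ∈ S
      · simp [hx]
      · simp [hx, convex_univ]) (fun x => by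
      by_cases hx : x ∈ S
      · obtain ⟨V, g, hV, hxV, hg, hfg⟩ := hf x hx
        exact ⟨V, hV.mem_nhds hxV, g, contMDiffOn_iff_contDiffOn.2 hg,
          fun y hy hyS => (hfg ⟨hyS, hy⟩).symm⟩
      · exact ⟨Sᶜ, hS.isOpen_compl.mem_nhds hx, 0,
          contMDiffOn_iff_contDiffOn.2 contDiffOn_const, fun y hy hyS => absurd hyS hy⟩)
  exact ⟨g, contMDiff_iff_contDiff.1 g.contMDiff, fun x hx => hg x hx⟩

/-! ### Defining functions cooriented by an area form. -/

section DefiningFunction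

theorem wedge_add_left (A B : R3 →L[ℝ] ℝ) (θ : R3 [⋀^Fin 2]→L[ℝ] ℝ) :
    wedge (A + B) θ = wedge A θ + wedge B θ := by
  simp only [wedge, add_apply]; ring

theorem wedge_smul_left (c : ℝ) (A : R3 →L[ℝ] ℝ) (θ : R3 [⋀^Fin 2]→L[ℝ] ℝ) :
    wedge (c • A) θ = c * wedge A θ := by
  simp only [wedge, smul_apply, smul_eq_mul]; ring

theorem continuous_wedge :
    Continuous fun q : (R3 →L[ℝ] ℝ) × (R3 [⋀^Fin 2]→L[ℝ] ℝ) => wedge q.1 q.2 := by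
  have h (v : Fin 2 → R3) : Continuous fun q : (R3 →L[ℝ] ℝ) × (R3 [⋀^Fin 2]→L[ℝ] ℝ) => q.2 v :=
    (ContinuousAlternatingMap.apply ℝ R3 ℝ v).continuous.comp continuous_snd
  have h' (v : R3) : Continuous fun q : (R3 →L[ℝ] ℝ) × (R3 [⋀^Fin 2]→L[ℝ] ℝ) => q.1 v := by
    fun_prop
  exact (((h' _).mul (h _)).add ((h' _).mul (h _))).add ((h' _).mul (h _))

theorem ker_eq_of_ker_le {A B : R3 →L[ℝ] ℝ} (h : ∀ v, A v = 0 → B v = 0) (hB : B ≠ 0) {v : R3}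
    (hv : B v = 0) : A v = 0 := by
  by_contra hA
  refine hB (ContinuousLinearMap.ext fun w => ?_)
  have := h (w - (A w / A v) • v) (by simp [hA])
  simpa [hv] using this

variable {S : Set R3} {Ω : R3 → R3 [⋀^Fin 2]→L[ℝ] ℝ}

/-- A surface is locally the zero set of a function that is a submersion along the surface and
coorients it in the way prescribed by an area form. -/
theorem exists_local_definingFunction (hS : IsCompactSurface S) (hΩ : ContDiff ℝ ∞ Ω)
    (hne : ∀ p ∈ S, ∃ v ∈ tangentPlane S p, ∃ w ∈ tangentPlane S p, Ω p ![v, w] ≠ 0) {p : R3}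
    (hp : p ∈ S) : ∃ (V : Set R3) (s : R3 → ℝ), IsOpen V ∧ p ∈ V ∧ ContDiffOn ℝ ∞ s V ∧
      (∀ x ∈ V, x ∈ S → s x = 0) ∧ (∀ x ∈ V, 0 < wedge (fderiv ℝ s x) (Ω x)) := by
  obtain ⟨e, hpe, he, he', hSe⟩ := hS.chart p hp
  have hed : HasFDerivAt e (fderiv ℝ e p) p :=
    ((he.contDiffAt (e.open_source.mem_nhds hpe)).differentiableAt (by simp)).hasFDerivAt
  let π : R3 →L[ℝ] ℝ := EuclideanSpace.proj (2 : Fin 3)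
  set s0 : R3 → ℝ := fun x => e x 2 with hs0
  have hs0s : ContDiffOn ℝ ∞ s0 e.source := π.contDiff.comp_contDiffOn he
  have hs0d : fderiv ℝ s0 p = π.comp (fderiv ℝ e p) := (π.hasFDerivAt.comp p hed).fderiv
  have hzero : ∀ x ∈ e.source, x ∈ S → s0 x = 0 := by
    intro x hx hxS
    rcases hSe with h | h
    · exact (h x hx).1 hxS
    · exact ((h x hx).1 hxS).1
  have hT := mem_tangentPlane_iff_of_chart hp hpe he he' hSe
  -- Otherwise evaluation on `(v, w, n)` gives `ds0 n * Ω ![v, w] = 0` for every `n`, hence `ds0 =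
  -- 0`, contradicting that `e` is a chart.
  have hw : wedge (fderiv ℝ s0 p) (Ω p) ≠ 0 := by
    intro h0
    obtain ⟨v, hv, w, hw, hvw⟩ := hne p hp
    have hv' : fderiv ℝ s0 p v = 0 := by rw [hs0d]; exact (hT v).1 hv
    have hw' : fderiv ℝ s0 p w = 0 := by rw [hs0d]; exact (hT w).1 hw
    have hall : ∀ n, fderiv ℝ s0 p n = 0 := by
      intro n
      have := wedge_mul_det3 (fderiv ℝ s0 p) (Ω p) v w n
      rw [hv', hw', h0] at this
      simpa [hvw] using this
    have hT' : ∀ n, n ∈ tangentPlane S p := fun n => by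
      rw [hT]; have := hall n; rwa [hs0d] at this
    have hsurj : (fderiv ℝ e p).comp (fderiv ℝ e.symm (e p)) = ContinuousLinearMap.id ℝ R3 := by
      have hpt := e.map_source hpe
      have hed' : HasFDerivAt e.symm (fderiv ℝ e.symm (e p)) (e p) :=
        ((he'.contDiffAt (e.open_target.mem_nhds hpt)).differentiableAt (by simp)).hasFDerivAt
      have h1 : HasFDerivAt (e ∘ e.symm) _ (e p) :=
        HasFDerivAt.comp (e p) (by rwa [e.left_inv hpe]) hed'
      refine h1.unique ((hasFDerivAt_id (e p)).congr_of_eventuallyEq ?_)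
      filter_upwards [e.open_target.mem_nhds hpt] with x hx using e.right_inv hx
    have h3 := (hT (fderiv ℝ e.symm (e p) (stdVec 2))).1 (hT' _)
    have h4 : fderiv ℝ e p (fderiv ℝ e.symm (e p) (stdVec 2)) = stdVec 2 :=
      congrArg (fun L : R3 →L[ℝ] R3 => L (stdVec 2)) hsurj
    rw [h4] at h3
    simp [stdVec_apply] at h3
  have key : ∀ σ : ℝ, 0 < wedge (fderiv ℝ (fun x => σ * s0 x) p) (Ω p) →
      ∃ (V : Set R3) (s : R3 → ℝ), IsOpen V ∧ p ∈ V ∧ ContDiffOn ℝ ∞ s V ∧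
      (∀ x ∈ V, x ∈ S → s x = 0) ∧ (∀ x ∈ V, 0 < wedge (fderiv ℝ s x) (Ω x)) := by
    intro σ hσ
    have hs : ContDiffOn ℝ ∞ (fun x => σ * s0 x) e.source := contDiffOn_const.mul hs0s
    have hc : ContinuousOn (fun x => wedge (fderiv ℝ (fun x => σ * s0 x) x) (Ω x)) e.source :=
      continuous_wedge.comp_continuousOn
        ((hs.continuousOn_fderiv_of_isOpen e.open_source (by simp)).prodMk
          hΩ.continuous.continuousOn)
    refine ⟨_, fun x => σ * s0 x, hc.isOpen_inter_preimage e.open_source isOpen_Ioi,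
      ⟨hpe, hσ⟩, hs.mono inter_subset_left, fun x hx hxS => ?_, fun x hx => hx.2⟩
    simp only [hzero x hx.1 hxS, mul_zero]
  have hdiff : DifferentiableAt ℝ s0 p :=
    (hs0s.contDiffAt (e.open_source.mem_nhds hpe)).differentiableAt (by simp)
  rcases lt_or_gt_of_ne hw with h | h
  · refine key (-1) ?_
    rw [fderiv_const_mul hdiff, wedge_smul_left]; linarith
  · refine key 1 ?_
    rw [fderiv_const_mul hdiff, wedge_smul_left]; linarith

/-- A compact surface is contained in the zero set of a smooth function that is a submersion along
the surface and coorients it in the way prescribed by an area form. -/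
theorem exists_definingFunction (hS : IsCompactSurface S) (hΩ : ContDiff ℝ ∞ Ω)
    (hne : ∀ p ∈ S, ∃ v ∈ tangentPlane S p, ∃ w ∈ tangentPlane S p, Ω p ![v, w] ≠ 0) :
    ∃ s : R3 → ℝ, ContDiff ℝ ∞ s ∧ (∀ p ∈ S, s p = 0) ∧
      (∀ p ∈ S, 0 < wedge (fderiv ℝ s p) (Ω p)) ∧
      ∀ p ∈ S, ∀ v, v ∈ tangentPlane S p ↔ fderiv ℝ s p v = 0 := by
  -- Local defining functions can be added without cancellation, since `Ω` coorients all of them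
  -- alike. The induction carries weak positivity on `S` and strict positivity on the part already
  -- covered.
  have key : ∃ s : R3 → ℝ, ContDiff ℝ ∞ s ∧ (∀ p ∈ S, s p = 0) ∧
      (∀ p ∈ S, 0 ≤ wedge (fderiv ℝ s p) (Ω p)) ∧
      ∀ p ∈ S, p ∈ S → 0 < wedge (fderiv ℝ s p) (Ω p) := by
    refine hS.compact.induction_on (p := fun A => ∃ s : R3 → ℝ, ContDiff ℝ ∞ s ∧
      (∀ p ∈ S, s p = 0) ∧ (∀ p ∈ S, 0 ≤ wedge (fderiv ℝ s p) (Ω p)) ∧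
      ∀ p ∈ A, p ∈ S → 0 < wedge (fderiv ℝ s p) (Ω p)) ?_ ?_ ?_ ?_
    · exact ⟨fun _ => 0, contDiff_const, fun _ _ => rfl, fun p _ => by simp [wedge], by simp⟩
    · rintro A B hAB ⟨s, h1, h2, h3, h4⟩
      exact ⟨s, h1, h2, h3, fun p hp => h4 p (hAB hp)⟩
    · rintro A B ⟨s, h1, h2, h3, h4⟩ ⟨s', h1', h2', h3', h4'⟩
      have hd : ∀ p, wedge (fderiv ℝ (fun x => s x + s' x) p) (Ω p) =
          wedge (fderiv ℝ s p) (Ω p) + wedge (fderiv ℝ s' p) (Ω p) := fun p => by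
        rw [fderiv_fun_add (h1.differentiable (by simp) p) (h1'.differentiable (by simp) p),
          wedge_add_left]
      refine ⟨fun x => s x + s' x, h1.add h1', fun p hp => by simp [h2 p hp, h2' p hp],
        fun p hp => by rw [hd]; exact add_nonneg (h3 p hp) (h3' p hp), fun p hp hpS => ?_⟩
      rw [hd]
      rcases hp with hp | hp
      · exact add_pos_of_pos_of_nonneg (h4 p hp hpS) (h3' p hpS)
      · exact add_pos_of_nonneg_of_pos (h3 p hpS) (h4' p hp hpS)
    · intro p hp
      obtain ⟨V, s, hV, hpV, hs, hs0, hsw⟩ := exists_local_definingFunction hS hΩ hne hp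
      obtain ⟨r, hr, hrV⟩ := Metric.isOpen_iff.1 hV p hpV
      let χ : ContDiffBump p := ⟨r / 4, r / 2, by linarith, by linarith⟩
      have hχV : Metric.closedBall p (r / 2) ⊆ V :=
        (Metric.closedBall_subset_ball (by linarith)).trans hrV
      have hχ0 : ∀ x ∉ Metric.closedBall p (r / 2), (fun x => χ x * s x) =ᶠ[𝓝 x] fun _ => 0 := by
        intro x hx
        filter_upwards [Metric.isClosed_closedBall.isOpen_compl.mem_nhds hx] with y hy
        have : χ y = 0 := by
          refine χ.zero_of_le_dist ?_
          have : y ∉ Metric.closedBall p (r / 2) := hy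
          rw [Metric.mem_closedBall] at this
          exact (not_le.1 this).le
        rw [this, zero_mul]
      have hsmooth : ContDiff ℝ ∞ fun x => χ x * s x := by
        rw [contDiff_iff_contDiffAt]
        intro x
        by_cases hx : x ∈ Metric.closedBall p (r / 2)
        · exact χ.contDiff.contDiffAt.mul (hs.contDiffAt (hV.mem_nhds (hχV hx)))
        · exact contDiffAt_const.congr_of_eventuallyEq (hχ0 x hx)
      -- On `S` the term with the derivative of the cut-off disappears because `s` vanishes there.
      have hd : ∀ x ∈ S, x ∈ V → wedge (fderiv ℝ (fun x => χ x * s x) x) (Ω x) =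
          χ x * wedge (fderiv ℝ s x) (Ω x) := by
        intro x hx hxV
        rw [fderiv_fun_mul (χ.contDiff.differentiable (n := ∞) (by simp) x)
          ((hs.contDiffAt (hV.mem_nhds hxV)).differentiableAt (by simp)), hs0 x hxV hx, zero_smul,
          add_zero, wedge_smul_left]
      refine ⟨Metric.ball p (r / 2), mem_nhdsWithin_of_mem_nhds (Metric.ball_mem_nhds p (by
        linarith)), fun x => χ x * s x, hsmooth, fun x hx => ?_, fun x hx => ?_, fun x hx hxS => ?_⟩
      · by_cases hxV : x ∈ Metric.closedBall p (r / 2)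
        · simp [hs0 x (hχV hxV) hx]
        · exact (hχ0 x hxV).self_of_nhds
      · by_cases hxV : x ∈ Metric.closedBall p (r / 2)
        · rw [hd x hx (hχV hxV)]
          exact mul_nonneg χ.nonneg (hsw x (hχV hxV)).le
        · rw [(hχ0 x hxV).fderiv_eq]; simp [wedge]
      · have hxV := hχV (Metric.ball_subset_closedBall hx)
        rw [hd x hxS hxV]
        exact mul_pos (χ.pos_of_mem_ball hx) (hsw x hxV)
  obtain ⟨s, h1, h2, -, h4⟩ := key
  refine ⟨s, h1, h2, fun p hp => h4 p hp hp, fun p hp v => ?_⟩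
  have hsub : ∀ v ∈ tangentPlane S p, fderiv ℝ s p v = 0 := by
    intro v hv
    have := fderiv_eq_of_eqOn (f := s) (g := fun _ => (0 : ℝ)) (h1.differentiable (by simp) p)
      (differentiableAt_const _) hp (Eventually.of_forall h2) hv
    simpa using this
  refine ⟨hsub v, fun hv => ?_⟩
  obtain ⟨e, hpe, he, he', hSe⟩ := hS.chart p hp
  have hT := mem_tangentPlane_iff_of_chart hp hpe he he' hSe
  rw [hT]
  refine ker_eq_of_ker_le
    (A := (EuclideanSpace.proj (2 : Fin 3) : R3 →L[ℝ] ℝ).comp (fderiv ℝ e p))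
    (fun v hv => hsub v ((hT v).2 hv)) (fun h0 => ?_) hv
  have := h4 p hp hp
  rw [h0] at this
  simp [wedge] at this

end DefiningFunction

/-- The exterior derivative of a 1-form that vanishes on the tangent planes of a surface vanishes on
these planes, too. -/
theorem dForm_eq_zero_of_vanishing {S : Set R3} {s : R3 → ℝ} {γ : R3 → R3 →L[ℝ] ℝ} {p : R3}
    (hs : ContDiff ℝ ∞ s) (hγ : DifferentiableAt ℝ γ p) (hp : p ∈ S)
    (hT : ∀ q ∈ S, ∀ v, v ∈ tangentPlane S q ↔ fderiv ℝ s q v = 0) (hsp : fderiv ℝ s p ≠ 0)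
    (h : ∀ q ∈ S, ∀ v ∈ tangentPlane S q, γ q v = 0) {v w : R3} (hv : v ∈ tangentPlane S p)
    (hw : w ∈ tangentPlane S p) : dForm γ p ![v, w] = 0 := by
  obtain ⟨n, hn⟩ : ∃ n, fderiv ℝ s p n ≠ 0 := by
    by_contra! h0
    exact hsp (ContinuousLinearMap.ext h0)
  have hds : HasFDerivAt (fderiv ℝ s) (fderiv ℝ (fderiv ℝ s) p) p :=
    ((hs.fderiv_right (m := ∞) (by simp)).differentiable (by simp) p).hasFDerivAt
  have hsymm : IsSymmSndFDerivAt ℝ s p := hs.contDiffAt.isSymmSndFDerivAt (by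
    rw [minSmoothness_of_isRCLikeNormedField]; exact WithTop.coe_le_coe.2 le_top)
  -- The vector `ds n • w - ds w • n` is tangent to `S` at every point of `S`, so `γ` vanishes on
  -- it. Differentiating along `v` expresses `Dγ v w` through the Hessian of `s`, which is symmetric
  -- in `v` and `w`.
  have key : ∀ v ∈ tangentPlane S p, ∀ w ∈ tangentPlane S p,
      fderiv ℝ γ p v w * fderiv ℝ s p n = γ p n * fderiv ℝ (fderiv ℝ s) p v w := by
    intro v hv w hw
    have e1 := hγ.hasFDerivAt.clm_apply (hasFDerivAt_const w p)
    have e2 := hγ.hasFDerivAt.clm_apply (hasFDerivAt_const n p)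
    have e3 := hds.clm_apply (hasFDerivAt_const w p)
    have e4 := hds.clm_apply (hasFDerivAt_const n p)
    have e5 := (e1.mul e4).sub (e2.mul e3)
    have e6 := fderiv_eq_of_eqOn (S := S) (g := fun _ => (0 : ℝ)) e5.differentiableAt
      (differentiableAt_const _) hp (Eventually.of_forall fun q hq => by
        have := h q hq (fderiv ℝ s q n • w - fderiv ℝ s q w • n) (by
          rw [hT q hq]; simp; ring)
        simp only [map_sub, map_smul, smul_eq_mul] at this
        simp only [Pi.sub_apply, Pi.mul_apply]
        linarith) hv
    rw [e5.fderiv] at e6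
    have f1 := h p hp w hw
    have f2 := (hT p hp w).1 hw
    simp [f1, f2] at e6
    linarith
  have k1 := key v hv w hw
  have k2 := key w hw v hv
  rw [dForm_apply hγ]
  have hs' := hsymm v w
  rw [hs', ← k2] at k1
  have := mul_right_cancel₀ hn k1
  rw [this, sub_self]

end EquivContact

end

/-! ### Extension of a surface map in the normal direction. -/

noncomputable section

open Set Filter Topology
open scoped ContDiff

namespace EquivContact

/-- Near a point with `P > 0` a large `M` suffices; near a zero of `P` the value of `Q` does. By `0
≤ P` a larger `M` only helps, so compactness yields one constant. -/
theorem exists_mul_add_pos {X : Type*} [TopologicalSpace X] {K : Set X} (hK : IsCompact K)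
    {P Q : X → ℝ} (hP : ContinuousOn P K) (hQ : ContinuousOn Q K) (h0 : ∀ x ∈ K, 0 ≤ P x)
    (h : ∀ x ∈ K, P x = 0 → 0 < Q x) : ∃ M : ℝ, ∀ x ∈ K, 0 < M * P x + Q x := by
  have : ∃ M : ℝ, ∀ x ∈ K, x ∈ K → 0 < M * P x + Q x := by
    refine hK.induction_on (p := fun A => ∃ M : ℝ, ∀ x ∈ A, x ∈ K → 0 < M * P x + Q x) ?_ ?_ ?_ ?_
    · exact ⟨0, by simp⟩
    · rintro A B hAB ⟨M, hM⟩
      exact ⟨M, fun x hx => hM x (hAB hx)⟩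
    · rintro A B ⟨M, hM⟩ ⟨M', hM'⟩
      refine ⟨max M M', fun x hx hxK => ?_⟩
      rcases hx with hx | hx
      · exact (hM x hx hxK).trans_le (by gcongr; exacts [h0 x hxK, le_max_left _ _])
      · exact (hM' x hx hxK).trans_le (by gcongr; exacts [h0 x hxK, le_max_right _ _])
    · intro x hx
      obtain ⟨M, hM⟩ : ∃ M : ℝ, 0 < M * P x + Q x := by
        by_cases hPx : P x = 0
        · exact ⟨0, by simpa using h x hx hPx⟩
        · refine ⟨(1 - Q x) / P x, ?_⟩
          rw [div_mul_cancel₀ _ hPx]; norm_num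
      have hc : ContinuousOn (fun y => M * P y + Q y) K := (continuousOn_const.mul hP).add hQ
      exact ⟨{y | 0 < M * P y + Q y}, (hc x hx).eventually_const_lt hM, M, fun y hy _ => hy⟩
  exact this.imp fun M hM x hx => hM x hx hx

/-- The vector dual to a covector. -/
def sharp (A : R3 →L[ℝ] ℝ) : R3 :=
  A (stdVec 0) • stdVec 0 + A (stdVec 1) • stdVec 1 + A (stdVec 2) • stdVec 2

theorem apply_sharp (A B : R3 →L[ℝ] ℝ) : A (sharp B) =
    A (stdVec 0) * B (stdVec 0) + A (stdVec 1) * B (stdVec 1) + A (stdVec 2) * B (stdVec 2) := by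
  simp only [sharp, map_add, map_smul, smul_eq_mul]; ring

theorem apply_sharp_comm (A B : R3 →L[ℝ] ℝ) : A (sharp B) = B (sharp A) := by
  rw [apply_sharp, apply_sharp]; ring

theorem apply_sharp_self_pos {A : R3 →L[ℝ] ℝ} (h : A ≠ 0) : 0 < A (sharp A) := by
  have h1 : 0 ≤ A (sharp A) := by rw [apply_sharp]; nlinarith
  refine lt_of_le_of_ne h1 fun h0 => h ?_
  rw [apply_sharp] at h0
  have e0 : A (stdVec 0) = 0 := by nlinarith
  have e1 : A (stdVec 1) = 0 := by nlinarith
  have e2 : A (stdVec 2) = 0 := by nlinarith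
  ext v
  rw [functional_expand, e0, e1, e2]; simp

theorem lagrange_sharp (A B : R3 →L[ℝ] ℝ) :
    A (sharp A) * B (sharp B) - A (sharp B) ^ 2 =
      (A (stdVec 1) * B (stdVec 2) - A (stdVec 2) * B (stdVec 1)) ^ 2 +
      (A (stdVec 2) * B (stdVec 0) - A (stdVec 0) * B (stdVec 2)) ^ 2 +
      (A (stdVec 0) * B (stdVec 1) - A (stdVec 1) * B (stdVec 0)) ^ 2 := by
  rw [apply_sharp, apply_sharp, apply_sharp]; ring

theorem sq_apply_sharp_le (A B : R3 →L[ℝ] ℝ) :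
    A (sharp B) ^ 2 ≤ A (sharp A) * B (sharp B) := by
  have := lagrange_sharp A B
  nlinarith [sq_nonneg (A (stdVec 1) * B (stdVec 2) - A (stdVec 2) * B (stdVec 1)),
    sq_nonneg (A (stdVec 2) * B (stdVec 0) - A (stdVec 0) * B (stdVec 2)),
    sq_nonneg (A (stdVec 0) * B (stdVec 1) - A (stdVec 1) * B (stdVec 0))]

/-- Equality in Cauchy–Schwarz makes the cross product vanish, so `A` is a multiple of `B`. With `B`
the conormal of `S₁`, this detects the singular points of the foliation. -/
theorem apply_eq_zero_of_sq_apply_sharp_eq {A B : R3 →L[ℝ] ℝ} (hB : B ≠ 0)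
    (h : A (sharp B) ^ 2 = A (sharp A) * B (sharp B)) {v : R3} (hv : B v = 0) : A v = 0 := by
  have h1 := lagrange_sharp A B
  rw [h, sub_self] at h1
  set a := A (stdVec 1) * B (stdVec 2) - A (stdVec 2) * B (stdVec 1) with ha
  set b := A (stdVec 2) * B (stdVec 0) - A (stdVec 0) * B (stdVec 2) with hb
  set c := A (stdVec 0) * B (stdVec 1) - A (stdVec 1) * B (stdVec 0) with hc
  have a0 : a = 0 := by nlinarith [sq_nonneg a, sq_nonneg b, sq_nonneg c]
  have b0 : b = 0 := by nlinarith [sq_nonneg a, sq_nonneg b, sq_nonneg c]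
  have c0 : c = 0 := by nlinarith [sq_nonneg a, sq_nonneg b, sq_nonneg c]
  have h2 : A v * B (sharp B) = A (sharp B) * B v := by
    rw [apply_sharp, apply_sharp, functional_expand A v, functional_expand B v]
    rw [ha] at a0
    rw [hb] at b0
    rw [hc] at c0
    linear_combination (v 0 * B (stdVec 1) - v 1 * B (stdVec 0)) * c0 +
      (v 1 * B (stdVec 2) - v 2 * B (stdVec 1)) * a0 +
      (v 2 * B (stdVec 0) - v 0 * B (stdVec 2)) * b0
  rw [hv, mul_zero] at h2
  exact (mul_eq_zero.1 h2).resolve_right (apply_sharp_self_pos hB).ne'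

theorem contDiffOn_apply_sharp {X : Type*} [NormedAddCommGroup X] [NormedSpace ℝ X] {s : Set X}
    {A B : X → R3 →L[ℝ] ℝ} (hA : ContDiffOn ℝ ∞ A s) (hB : ContDiffOn ℝ ∞ B s) :
    ContDiffOn ℝ ∞ (fun x => A x (sharp (B x))) s := by
  simp only [apply_sharp]
  fun_prop

theorem contDiffOn_sharp {X : Type*} [NormedAddCommGroup X] [NormedSpace ℝ X] {s : Set X}
    {A : X → R3 →L[ℝ] ℝ} (hA : ContDiffOn ℝ ∞ A s) :
    ContDiffOn ℝ ∞ (fun x => sharp (A x)) s := by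
  unfold sharp
  fun_prop

theorem ne_zero_of_wedge_pos {A : R3 →L[ℝ] ℝ} {θ : R3 [⋀^Fin 2]→L[ℝ] ℝ} (h : 0 < wedge A θ) :
    A ≠ 0 := by
  rintro rfl
  simp [wedge] at h

/-- The data of a map between neighbourhoods of two cooriented surfaces which carries the first
surface into the second one, is compatible with their area forms, and pulls back the restriction
of one contact form to a positive multiple of the restriction of the other. -/
structure IsSurfaceMap (S₀ S₁ : Set R3) (s₀ s₁ : R3 → ℝ) (Ω₀ Ω₁ : R3 → R3 [⋀^Fin 2]→L[ℝ] ℝ)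
    (α₀ α₁ : R3 → R3 →L[ℝ] ℝ) (U₀ U₁ : Set R3) (f : R3 → R3) (g h : R3 → ℝ) : Prop where
  compact : IsCompact S₀
  smooth₀ : ContDiff ℝ ∞ s₀
  smooth₁ : ContDiff ℝ ∞ s₁
  zero₀ : ∀ p ∈ S₀, s₀ p = 0
  tangent₀ : ∀ p ∈ S₀, ∀ v, v ∈ tangentPlane S₀ p ↔ fderiv ℝ s₀ p v = 0
  tangent₁ : ∀ p ∈ S₁, ∀ v, v ∈ tangentPlane S₁ p ↔ fderiv ℝ s₁ p v = 0
  coorient₀ : ∀ p ∈ S₀, 0 < wedge (fderiv ℝ s₀ p) (Ω₀ p)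
  coorient₁ : ∀ p ∈ S₁, 0 < wedge (fderiv ℝ s₁ p) (Ω₁ p)
  nonvanishing : ∀ p ∈ S₀, ∃ v ∈ tangentPlane S₀ p, ∃ w ∈ tangentPlane S₀ p, Ω₀ p ![v, w] ≠ 0
  isOpen₀ : IsOpen U₀
  isOpen₁ : IsOpen U₁
  subset₀ : S₀ ⊆ U₀
  subset₁ : S₁ ⊆ U₁
  smooth_form₀ : ContDiffOn ℝ ∞ α₀ U₀
  smooth_form₁ : ContDiffOn ℝ ∞ α₁ U₁
  contact₀ : ∀ p ∈ U₀, 0 < contactVolume α₀ p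
  contact₁ : ∀ p ∈ U₁, 0 < contactVolume α₁ p
  smooth_map : ContDiff ℝ ∞ f
  mapsTo : MapsTo f S₀ S₁
  smooth_factor : ContDiffOn ℝ ∞ h U₀
  factor_pos : ∀ p ∈ S₀, 0 < h p
  area_factor_pos : ∀ p ∈ S₀, 0 < g p
  pullback_area : ∀ p ∈ S₀, ∀ v ∈ tangentPlane S₀ p, ∀ w ∈ tangentPlane S₀ p,
    Ω₁ (f p) ![fderiv ℝ f p v, fderiv ℝ f p w] = g p * Ω₀ p ![v, w]
  pullback_form : ∀ p ∈ S₀, ∀ v ∈ tangentPlane S₀ p, α₁ (f p) (fderiv ℝ f p v) = h p * α₀ p v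

namespace IsSurfaceMap

variable {S₀ S₁ : Set R3} {s₀ s₁ : R3 → ℝ} {Ω₀ Ω₁ : R3 → R3 [⋀^Fin 2]→L[ℝ] ℝ}
    {α₀ α₁ : R3 → R3 →L[ℝ] ℝ} {U₀ U₁ : Set R3} {f : R3 → R3} {g h : R3 → ℝ}

theorem mapsTo_tangentPlane (H : IsSurfaceMap S₀ S₁ s₀ s₁ Ω₀ Ω₁ α₀ α₁ U₀ U₁ f g h) {p : R3}
    {v : R3} (hv : v ∈ tangentPlane S₀ p) : fderiv ℝ f p v ∈ tangentPlane S₁ (f p) :=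
  EquivContact.mapsTo_tangentPlane
    (H.smooth_map.differentiable (by simp) p).hasFDerivAt.hasFDerivWithinAt H.mapsTo hv

/-- The sign of the Jacobian of an extension of a surface map is read off on the coorientation. -/
theorem jac_mul_eq (H : IsSurfaceMap S₀ S₁ s₀ s₁ Ω₀ Ω₁ α₀ α₁ U₀ U₁ f g h) {p : R3} (hp : p ∈ S₀)
    {L : R3 →L[ℝ] R3} (hL : ∀ v ∈ tangentPlane S₀ p, L v = fderiv ℝ f p v) {n : R3}
    (hn : fderiv ℝ s₀ p n = 1) :
    wedge (fderiv ℝ s₁ (f p)) (Ω₁ (f p)) * jac L =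
      fderiv ℝ s₁ (f p) (L n) * (g p * wedge (fderiv ℝ s₀ p) (Ω₀ p)) := by
  obtain ⟨v, hv, w, hw, hvw⟩ := H.nonvanishing p hp
  have h1 := wedge_mul_det3 (fderiv ℝ s₀ p) (Ω₀ p) v w n
  rw [(H.tangent₀ p hp v).1 hv, (H.tangent₀ p hp w).1 hw, hn] at h1
  have h2 := wedge_mul_det3 (fderiv ℝ s₁ (f p)) (Ω₁ (f p)) (L v) (L w) (L n)
  rw [hL v hv, hL w hw, (H.tangent₁ _ (H.mapsTo hp) _).1 (H.mapsTo_tangentPlane hv),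
    (H.tangent₁ _ (H.mapsTo hp) _).1 (H.mapsTo_tangentPlane hw), H.pullback_area p hp v hv w hw,
    ← hL v hv, ← hL w hw, det3_map] at h2
  have hd : det3 v w n ≠ 0 := by
    intro h0
    rw [h0] at h1
    simp [hvw] at h1
  refine mul_right_cancel₀ hd ?_
  linear_combination -h2 + fderiv ℝ s₁ (f p) (L n) * g p * h1

/-- For fixed tangential part, positivity of the Jacobian is a linear condition on `L n`, and is
therefore preserved by averaging. -/
theorem jac_pos_iff (H : IsSurfaceMap S₀ S₁ s₀ s₁ Ω₀ Ω₁ α₀ α₁ U₀ U₁ f g h) {p : R3} (hp : p ∈ S₀)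
    {L : R3 →L[ℝ] R3} (hL : ∀ v ∈ tangentPlane S₀ p, L v = fderiv ℝ f p v) {n : R3}
    (hn : fderiv ℝ s₀ p n = 1) : 0 < jac L ↔ 0 < fderiv ℝ s₁ (f p) (L n) := by
  have h1 := H.jac_mul_eq hp hL hn
  have h2 := H.coorient₁ _ (H.mapsTo hp)
  have h3 : 0 < g p * wedge (fderiv ℝ s₀ p) (Ω₀ p) :=
    mul_pos (H.area_factor_pos p hp) (H.coorient₀ p hp)
  rw [← mul_pos_iff_of_pos_left h2, h1, mul_pos_iff_of_pos_right h3]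

/-- At the singular points of the characteristic foliation, the normal component of the contact
forms have the same sign. -/
theorem normal_mul_normal_pos (H : IsSurfaceMap S₀ S₁ s₀ s₁ Ω₀ Ω₁ α₀ α₁ U₀ U₁ f g h) {p : R3}
    (hp : p ∈ S₀) (hsing : ∀ v ∈ tangentPlane S₁ (f p), α₁ (f p) v = 0) {n m : R3}
    (hn : fderiv ℝ s₀ p n = 1) (hm : 0 < fderiv ℝ s₁ (f p) m) :
    0 < α₀ p n * α₁ (f p) m := by
  obtain ⟨v, hv, w, hw, hvw⟩ := H.nonvanishing p hp
  have hα₀d : DifferentiableAt ℝ α₀ p :=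
    (H.smooth_form₀.contDiffAt (H.isOpen₀.mem_nhds (H.subset₀ hp))).differentiableAt (by simp)
  have hα₁d : DifferentiableAt ℝ α₁ (f p) := (H.smooth_form₁.contDiffAt
    (H.isOpen₁.mem_nhds (H.subset₁ (H.mapsTo hp)))).differentiableAt (by simp)
  have hhd : DifferentiableAt ℝ h p :=
    (H.smooth_factor.contDiffAt (H.isOpen₀.mem_nhds (H.subset₀ hp))).differentiableAt (by simp)
  have hβd : DifferentiableAt ℝ (pullbackForm f α₁) p :=
    ((contDiffOn_pullbackForm (H.isOpen₁.preimage H.smooth_map.continuous)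
      H.smooth_map.contDiffOn H.smooth_form₁ (mapsTo_preimage f U₁)).contDiffAt
      ((H.isOpen₁.preimage H.smooth_map.continuous).mem_nhds
        (H.subset₁ (H.mapsTo hp)))).differentiableAt (by simp)
  have hz : ∀ v ∈ tangentPlane S₀ p, α₀ p v = 0 := by
    intro v hv
    have h1 := H.pullback_form p hp v hv
    rw [hsing _ (H.mapsTo_tangentPlane hv)] at h1
    exact (mul_eq_zero.1 h1.symm).resolve_left (H.factor_pos p hp).ne'
  -- The form `f^* α₁ - h α₀` vanishes on the tangent planes along `S₀`, hence so does its exterior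
  -- derivative. As `α₀` vanishes on the plane at `p`, the term `dh ∧ α₀` drops out and `f^* dα₁ = h
  -- dα₀` on that plane.
  have hγd : HasFDerivAt (fun q => pullbackForm f α₁ q - h q • α₀ q) _ p :=
    hβd.hasFDerivAt.sub (hhd.hasFDerivAt.smul hα₀d.hasFDerivAt)
  have hd := dForm_eq_zero_of_vanishing H.smooth₀ hγd.differentiableAt hp H.tangent₀
    (ne_zero_of_wedge_pos (H.coorient₀ p hp)) (fun q hq v hv => by
      simp [pullbackForm_apply, H.pullback_form q hq v hv]) hv hw
  have hpull := dForm_pullbackForm (x := p) H.smooth_map.contDiffAt hα₁d v w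
  rw [dForm_apply hγd.differentiableAt, hγd.fderiv] at hd
  rw [dForm_apply hβd] at hpull
  have hdα₀ := dForm_apply hα₀d v w
  simp [hz v hv, hz w hw] at hd
  have key : dForm α₁ (f p) ![fderiv ℝ f p v, fderiv ℝ f p w] = h p * dForm α₀ p ![v, w] := by
    rw [← hpull, hdα₀]; linarith
  -- At a singular point the contact condition reads `α n * dα ![v, w] = volume * det`, with
  -- positive volume. The two values of `dα` agree up to the factor `h p > 0`, and the area forms
  -- show that the two determinants have the same sign.
  have c0 := wedge_mul_det3 (α₀ p) (dForm α₀ p) v w n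
  rw [hz v hv, hz w hw, ← contactVolume_eq_wedge] at c0
  have c1 := wedge_mul_det3 (α₁ (f p)) (dForm α₁ (f p)) (fderiv ℝ f p v) (fderiv ℝ f p w) m
  rw [hsing _ (H.mapsTo_tangentPlane hv), hsing _ (H.mapsTo_tangentPlane hw), key,
    ← contactVolume_eq_wedge] at c1
  have d0 := wedge_mul_det3 (fderiv ℝ s₀ p) (Ω₀ p) v w n
  rw [(H.tangent₀ p hp v).1 hv, (H.tangent₀ p hp w).1 hw, hn] at d0
  have d1 := wedge_mul_det3 (fderiv ℝ s₁ (f p)) (Ω₁ (f p)) (fderiv ℝ f p v) (fderiv ℝ f p w) m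
  rw [(H.tangent₁ _ (H.mapsTo hp) _).1 (H.mapsTo_tangentPlane hv),
    (H.tangent₁ _ (H.mapsTo hp) _).1 (H.mapsTo_tangentPlane hw),
    H.pullback_area p hp v hv w hw] at d1
  have k0 := H.contact₀ p (H.subset₀ hp)
  have k1 := H.contact₁ _ (H.subset₁ (H.mapsTo hp))
  have w0 := H.coorient₀ p hp
  have w1 := H.coorient₁ _ (H.mapsTo hp)
  have hh := H.factor_pos p hp
  have hg := H.area_factor_pos p hp
  set d := det3 v w n
  set d' := det3 (fderiv ℝ f p v) (fderiv ℝ f p w) m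
  set x := dForm α₀ p ![v, w]
  have hd0 : d ≠ 0 := by
    intro h0
    rw [h0] at d0
    simp [hvw] at d0
  have hdd : 0 < d' * d := by
    have e1 : wedge (fderiv ℝ s₁ (f p)) (Ω₁ (f p)) * (d' * d) =
        fderiv ℝ s₁ (f p) m * g p * wedge (fderiv ℝ s₀ p) (Ω₀ p) * d ^ 2 := by
      linear_combination -d * d1 + fderiv ℝ s₁ (f p) m * g p * d * d0
    have e2 : 0 < fderiv ℝ s₁ (f p) m * g p * wedge (fderiv ℝ s₀ p) (Ω₀ p) * d ^ 2 := by
      positivity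
    rw [← e1] at e2
    exact (pos_iff_pos_of_mul_pos e2).1 w1
  have e3 : α₀ p n * α₁ (f p) m * (h p * x ^ 2) =
      contactVolume α₀ p * contactVolume α₁ (f p) * (d' * d) := by
    simp only [zero_mul, zero_add] at c0 c1
    linear_combination α₁ (f p) m * h p * x * c0 + contactVolume α₀ p * d * c1
  have e4 : 0 < α₀ p n * α₁ (f p) m * (h p * x ^ 2) := by rw [e3]; positivity
  have hx : x ≠ 0 := by
    intro h0
    rw [h0] at e4; simp at e4
  have : 0 < h p * x ^ 2 := by positivity
  exact (pos_iff_pos_of_mul_pos e4).2 this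

/-- A surface map extends to a local diffeomorphism near the surface that matches the contact planes
along the surface. -/
theorem exists_extension (H : IsSurfaceMap S₀ S₁ s₀ s₁ Ω₀ Ω₁ α₀ α₁ U₀ U₁ f g h) :
    ∃ (N : Set R3) (F : R3 → R3), IsOpen N ∧ S₀ ⊆ N ∧ ContDiffOn ℝ ∞ F N ∧ EqOn F f S₀ ∧
      (∀ p ∈ S₀, ∀ v, α₁ (f p) (fderiv ℝ F p v) = h p * α₀ p v) ∧
      (∀ p ∈ S₀, 0 < jac (fderiv ℝ F p)) := by
  have hfc := H.smooth_map.continuous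
  have hd₁ : ContDiff ℝ ∞ fun p => fderiv ℝ s₁ (f p) :=
    (H.smooth₁.fderiv_right (m := ∞) (by simp)).comp H.smooth_map
  have hd₀ : ContDiff ℝ ∞ (fderiv ℝ s₀) := H.smooth₀.fderiv_right (m := ∞) (by simp)
  have hne₀ : ∀ p ∈ S₀, fderiv ℝ s₀ p ≠ 0 := fun p hp => ne_zero_of_wedge_pos (H.coorient₀ p hp)
  have hne₁ : ∀ p ∈ S₀, fderiv ℝ s₁ (f p) ≠ 0 :=
    fun p hp => ne_zero_of_wedge_pos (H.coorient₁ _ (H.mapsTo hp))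
  set V : Set R3 := {p | p ∈ U₀ ∧ f p ∈ U₁ ∧ fderiv ℝ s₀ p ≠ 0} with hV
  have hVo : IsOpen V := H.isOpen₀.inter ((H.isOpen₁.preimage hfc).inter
    (isOpen_ne.preimage hd₀.continuous))
  have hSV : S₀ ⊆ V := fun p hp => ⟨H.subset₀ hp, H.subset₁ (H.mapsTo hp), hne₀ p hp⟩
  have hα₁ne : ∀ p ∈ V, α₁ (f p) ≠ 0 := fun p hp =>
    ne_zero_of_wedge_pos (H.contact₁ _ hp.2.1)
  set n : R3 → R3 := fun p => (fderiv ℝ s₀ p (sharp (fderiv ℝ s₀ p)))⁻¹ • sharp (fderiv ℝ s₀ p)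
    with hn
  have hn1 : ∀ p ∈ V, fderiv ℝ s₀ p (n p) = 1 := by
    intro p hp
    rw [hn, map_smul, smul_eq_mul, inv_mul_cancel₀ (apply_sharp_self_pos hp.2.2).ne']
  have hns : ContDiffOn ℝ ∞ n V :=
    ((contDiffOn_apply_sharp hd₀.contDiffOn hd₀.contDiffOn).inv
      fun p hp => (apply_sharp_self_pos hp.2.2).ne').smul (contDiffOn_sharp hd₀.contDiffOn)
  have ha₁ : ContDiffOn ℝ ∞ (fun p => α₁ (f p)) V :=
    H.smooth_form₁.comp H.smooth_map.contDiffOn fun p hp => hp.2.1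
  have hq : ContDiffOn ℝ ∞ (fun p => h p * α₀ p (n p)) V :=
    (H.smooth_factor.mono fun p hp => hp.1).mul
      ((H.smooth_form₀.mono fun p hp => hp.1).clm_apply hns)
  have haa : ContDiffOn ℝ ∞ (fun p => α₁ (f p) (sharp (α₁ (f p)))) V := contDiffOn_apply_sharp ha₁ ha₁
  have had : ContDiffOn ℝ ∞ (fun p => α₁ (f p) (sharp (fderiv ℝ s₁ (f p)))) V :=
    contDiffOn_apply_sharp ha₁ hd₁.contDiffOn
  have hdd : ContDiffOn ℝ ∞ (fun p => fderiv ℝ s₁ (f p) (sharp (fderiv ℝ s₁ (f p)))) V :=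
    contDiffOn_apply_sharp hd₁.contDiffOn hd₁.contDiffOn
  have haapos : ∀ p ∈ V, 0 < α₁ (f p) (sharp (α₁ (f p))) := fun p hp =>
    apply_sharp_self_pos (hα₁ne p hp)
  -- The quantity is `ds₁ (Z p)` for the `Z` defined below. The coefficient of `M` is nonnegative by
  -- Cauchy–Schwarz and vanishes only at singular points, where `normal_mul_normal_pos` makes the
  -- rest positive.
  obtain ⟨M, hM⟩ : ∃ M : ℝ, ∀ p ∈ S₀, 0 < M * (fderiv ℝ s₁ (f p) (sharp (fderiv ℝ s₁ (f p))) -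
      α₁ (f p) (sharp (fderiv ℝ s₁ (f p))) ^ 2 / α₁ (f p) (sharp (α₁ (f p)))) +
      h p * α₀ p (n p) * α₁ (f p) (sharp (fderiv ℝ s₁ (f p))) / α₁ (f p) (sharp (α₁ (f p))) := by
    refine exists_mul_add_pos H.compact ?_ ?_ ?_ ?_
    · exact ((hdd.sub ((had.pow 2).div haa fun p hp => (haapos p hp).ne')).continuousOn).mono hSV
    · exact (((hq.mul had).div haa fun p hp => (haapos p hp).ne').continuousOn).mono hSV
    · intro p hp
      rw [sub_nonneg, div_le_iff₀ (haapos p (hSV hp)), mul_comm]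
      exact sq_apply_sharp_le _ _
    · intro p hp h0
      rw [sub_eq_zero, eq_div_iff (haapos p (hSV hp)).ne', mul_comm] at h0
      have hm := apply_sharp_self_pos (hne₁ p hp)
      have h1 := H.normal_mul_normal_pos hp (fun v hv =>
        apply_eq_zero_of_sq_apply_sharp_eq (hne₁ p hp) h0.symm
          ((H.tangent₁ _ (H.mapsTo hp) v).1 hv)) (hn1 p (hSV hp)) hm
      have := H.factor_pos p hp
      rw [mul_assoc]
      exact div_pos (mul_pos this h1) (haapos p (hSV hp))
  -- `Z` is `M` times the part of the conormal orthogonal to `α₁`, plus the multiple of the dual of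
  -- `α₁` that gives `α₁ Z = h * α₀ n`.
  set Z : R3 → R3 := fun p => M • sharp (fderiv ℝ s₁ (f p)) +
    ((h p * α₀ p (n p) - M * α₁ (f p) (sharp (fderiv ℝ s₁ (f p)))) /
      α₁ (f p) (sharp (α₁ (f p)))) • sharp (α₁ (f p)) with hZ
  have hZs : ContDiffOn ℝ ∞ Z V :=
    ((contDiffOn_sharp hd₁.contDiffOn).const_smul M).add
      (((hq.sub (contDiffOn_const.mul had)).div haa fun p hp => (haapos p hp).ne').smul
        (contDiffOn_sharp ha₁))
  have hZα : ∀ p ∈ V, α₁ (f p) (Z p) = h p * α₀ p (n p) := by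
    intro p hp
    rw [hZ, map_add, map_smul, map_smul, smul_eq_mul, smul_eq_mul,
      div_mul_cancel₀ _ (haapos p hp).ne']
    ring
  have hZd : ∀ p ∈ S₀, 0 < fderiv ℝ s₁ (f p) (Z p) := by
    intro p hp
    have h1 := hM p hp
    have h2 := (haapos p (hSV hp)).ne'
    refine h1.trans_eq ?_
    have hcomm := apply_sharp_comm (fderiv ℝ s₁ (f p)) (α₁ (f p))
    simp only [hZ]
    generalize n p = m
    rw [map_add, map_smul, map_smul, smul_eq_mul, smul_eq_mul, hcomm]
    field_simp
    ring
  have hWs : ContDiffOn ℝ ∞ (fun p => Z p - fderiv ℝ f p (n p)) V :=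
    hZs.sub (((H.smooth_map.fderiv_right (m := ∞) (by simp)).contDiffOn).clm_apply hns)
  -- Since `s₀ = 0` on `S₀`, there `F = f` and `dF = df + ds₀ ⊗ (Z - df n)`: tangentially `dF` is
  -- `df`, and `dF n = Z`.
  set F : R3 → R3 := fun p => f p + s₀ p • (Z p - fderiv ℝ f p (n p)) with hF
  have hFd : ∀ p ∈ S₀, ∀ v, fderiv ℝ F p v =
      fderiv ℝ f p v + fderiv ℝ s₀ p v • (Z p - fderiv ℝ f p (n p)) := by
    intro p hp v
    have h1 : HasFDerivAt F _ p := (H.smooth_map.differentiable (by simp) p).hasFDerivAt.add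
      ((H.smooth₀.differentiable (by simp) p).hasFDerivAt.smul
        ((hWs.contDiffAt (hVo.mem_nhds (hSV hp))).differentiableAt (by simp)).hasFDerivAt)
    rw [h1.fderiv]
    simp [H.zero₀ p hp]
  refine ⟨V, F, hVo, hSV, H.smooth_map.contDiffOn.add (H.smooth₀.contDiffOn.smul hWs),
    fun p hp => by rw [hF]; simp [H.zero₀ p hp], fun p hp v => ?_, fun p hp => ?_⟩
  · have h1 : v - fderiv ℝ s₀ p v • n p ∈ tangentPlane S₀ p := by
      rw [H.tangent₀ p hp, map_sub, map_smul, hn1 p (hSV hp)]; simp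
    have h2 := H.pullback_form p hp _ h1
    rw [hFd p hp]
    simp only [map_sub, map_add, map_smul, smul_eq_mul, hZα p (hSV hp)] at h2 ⊢
    linear_combination h2
  · rw [H.jac_pos_iff hp (fun v hv => ?_) (hn1 p (hSV hp))]
    · rw [hFd p hp, hn1 p (hSV hp), one_smul, add_sub_cancel]
      exact hZd p hp
    · rw [hFd p hp, (H.tangent₀ p hp v).1 hv, zero_smul, add_zero]

end IsSurfaceMap

end EquivContact

end

noncomputable section

open Set Filter Topology
open scoped ContDiff

namespace EquivContact

/-! ### Making a map equivariant near a compact set. -/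

section Averaging

variable {u : R3 → R3}

/-- An equivariant retraction of a neighbourhood of a compact part of the graph of an involution. -/
theorem exists_retraction_graph (hu : ContDiff ℝ ∞ u) (hui : Function.Involutive u) {K : Set R3}
    (hK : IsCompact K) (huK : MapsTo u K K) :
    ∃ (T : Set (R3 × R3)) (r : R3 × R3 → R3) (O : Set R3), IsOpen T ∧ ContDiffOn ℝ ∞ r T ∧
      (∀ y ∈ T, y.swap ∈ T ∧ r y.swap = u (r y)) ∧ IsOpen O ∧ K ⊆ O ∧
      (∀ z ∈ K, (z, u z) ∈ T) ∧ ∀ z ∈ O, r (z, u z) = z := by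
  have hdu : ContDiff ℝ ∞ (fderiv ℝ u) := hu.fderiv_right (by simp)
  have hinv := fderiv_involutive_apply hu hui
  have hinv' : ∀ x v, fderiv ℝ u x (fderiv ℝ u (u x) v) = v := fun x v => by
    have := hinv (u x) v
    rwa [hui x] at this
  -- `G` gives tubular coordinates `(z, u z) + (-w, Du w)` around the graph of `u`, in which `τ`
  -- corresponds to swapping the factors. The retraction `r` is the `z`-coordinate.
  set G : R3 × R3 → R3 × R3 := fun q => (q.1 - q.2, u q.1 + fderiv ℝ u q.1 q.2) with hG
  set τ : R3 × R3 → R3 × R3 := fun q => (u q.1, -fderiv ℝ u q.1 q.2) with hτ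
  have hGs : ContDiff ℝ ∞ G := (contDiff_fst.sub contDiff_snd).prodMk
    ((hu.comp contDiff_fst).add ((hdu.comp contDiff_fst).clm_apply contDiff_snd))
  have hτs : ContDiff ℝ ∞ τ := (hu.comp contDiff_fst).prodMk
    ((hdu.comp contDiff_fst).clm_apply contDiff_snd).neg
  have hGτ : ∀ q, G (τ q) = (G q).swap := by
    intro q
    simp only [hG, hτ, Prod.swap_prod_mk, map_neg, hinv, hui q.1, sub_neg_eq_add]
    rw [← sub_eq_add_neg]
  have hττ : ∀ q, τ (τ q) = q := by
    intro q
    simp only [hτ, map_neg, hinv, hui q.1, neg_neg]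
  obtain ⟨e, hKe, -, heq, hes, -⟩ := exists_openPartialHomeomorph_of_injOn
    (f := G) (K := (fun z => (z, (0 : R3))) '' K) (hK.image (by fun_prop)) isOpen_univ
    (subset_univ _) hGs.contDiffOn (by
      rintro _ ⟨z, -, rfl⟩ _ ⟨z', -, rfl⟩ h
      have : z - 0 = z' - 0 := congrArg Prod.fst h
      simpa using this) (by
      rintro _ ⟨z, -, rfl⟩
      let f1 := ContinuousLinearMap.fst ℝ R3 R3
      let f2 := ContinuousLinearMap.snd ℝ R3 R3
      let D := fderiv ℝ u z
      let D' := fderiv ℝ u (u z)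
      let L : R3 × R3 →L[ℝ] R3 × R3 := (f1 - f2).prod (D.comp f1 + D.comp f2)
      let L' : R3 × R3 →L[ℝ] R3 × R3 :=
        ((1 / 2 : ℝ) • (f1 + D'.comp f2)).prod ((1 / 2 : ℝ) • (D'.comp f2 - f1))
      refine ⟨ContinuousLinearEquiv.equivOfInverse L L' ?_ ?_, ?_⟩
      · rintro ⟨a, b⟩
        change ((1 / 2 : ℝ) • ((a - b) + D' (D a + D b)),
          (1 / 2 : ℝ) • (D' (D a + D b) - (a - b))) = (a, b)
        rw [map_add, hinv, hinv]
        refine Prod.ext ?_ ?_ <;> simp only <;> module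
      · rintro ⟨a, b⟩
        change ((1 / 2 : ℝ) • (a + D' b) - (1 / 2 : ℝ) • (D' b - a),
          D ((1 / 2 : ℝ) • (a + D' b)) + D ((1 / 2 : ℝ) • (D' b - a))) = (a, b)
        simp only [map_smul, map_add, map_sub]
        rw [hinv']
        refine Prod.ext ?_ ?_ <;> simp only <;> module
      · change HasFDerivAt G L (z, 0)
        have h1 : HasFDerivAt (fun q : R3 × R3 => u q.1) (D.comp f1) (z, 0) :=
          (hu.differentiable (by simp) z).hasFDerivAt.comp (z, (0 : R3)) hasFDerivAt_fst
        have h2 : HasFDerivAt (fun q : R3 × R3 => fderiv ℝ u q.1)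
            ((fderiv ℝ (fderiv ℝ u) z).comp f1) (z, 0) :=
          (hdu.differentiable (by simp) z).hasFDerivAt.comp (z, (0 : R3)) hasFDerivAt_fst
        refine ((hasFDerivAt_fst.sub hasFDerivAt_snd).prodMk
          (h1.add (h2.clm_apply hasFDerivAt_snd))).congr_fderiv ?_
        ext <;> simp [L, f1, f2, D])
  have hsymm : ∀ q ∈ e.source, e.symm (G q) = q := fun q hq => by rw [← heq, e.left_inv hq]
  have hG0 : ∀ z, G (z, 0) = (z, u z) := fun z => by simp [hG]
  have hKs : ∀ z ∈ K, (z, (0 : R3)) ∈ e.source := fun z hz => hKe ⟨z, hz, rfl⟩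
  have hτ0 : ∀ z, τ (z, 0) = (u z, 0) := fun z => by simp [hτ]
  have key : ∀ y ∈ e.target, τ (e.symm y) ∈ e.source →
      y.swap ∈ e.target ∧ e.symm y.swap = τ (e.symm y) := by
    intro y hy hτy
    have h1 : G (τ (e.symm y)) = y.swap := by
      rw [hGτ, ← heq, e.right_inv hy]
    refine ⟨?_, by rw [← h1, hsymm _ hτy]⟩
    have := e.map_source hτy
    rwa [heq, h1] at this
  refine ⟨e.target ∩ (fun y => τ (e.symm y)) ⁻¹' e.source, fun y => (e.symm y).1,
    (fun z => (z, (0 : R3))) ⁻¹' e.source,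
    (hτs.continuous.comp_continuousOn hes.continuousOn).isOpen_inter_preimage e.open_target
      e.open_source, contDiff_fst.comp_contDiffOn (hes.mono inter_subset_left), ?_,
    e.open_source.preimage (by fun_prop), hKs, ?_, ?_⟩
  · rintro y ⟨hy, hτy⟩
    obtain ⟨h1, h2⟩ := key y hy hτy
    refine ⟨⟨h1, ?_⟩, ?_⟩
    · change τ (e.symm y.swap) ∈ e.source
      rw [h2, hττ]
      exact e.map_target hy
    · simp only [h2, hτ]
  · intro z hz
    have h1 := e.map_source (hKs z hz)
    rw [heq, hG0] at h1
    refine ⟨h1, ?_⟩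
    rw [mem_preimage, ← hG0, hsymm _ (hKs z hz), hτ0]
    exact hKs _ (huK hz)
  · intro z hz
    have : (z, (0 : R3)) ∈ e.source := hz
    simp only [← hG0, hsymm _ this]

/-- A map that is equivariant along a compact set `K` can be made equivariant near `K`; its
derivative along `K` is replaced by its average. -/
theorem exists_equivariant_average (hu : ContDiff ℝ ∞ u) (hui : Function.Involutive u)
    {K N : Set R3} {F : R3 → R3} (hK : IsCompact K) (huK : MapsTo u K K) (hN : IsOpen N)
    (hKN : K ⊆ N) (hF : ContDiffOn ℝ ∞ F N) (hFu : ∀ p ∈ K, F (u p) = u (F p)) :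
    ∃ (N' : Set R3) (F' : R3 → R3), IsOpen N' ∧ K ⊆ N' ∧ MapsTo u N' N' ∧
      ContDiffOn ℝ ∞ F' N' ∧ EqOn F' F K ∧ (∀ x ∈ N', F' (u x) = u (F' x)) ∧
      ∀ p ∈ K, fderiv ℝ F' p = (1 / 2 : ℝ) • (fderiv ℝ F p +
        ((fderiv ℝ u (F (u p))).comp (fderiv ℝ F (u p))).comp (fderiv ℝ u p)) := by
  have hinv := fderiv_involutive_apply hu hui
  have hFK : MapsTo u (F '' K) (F '' K) := by
    rintro _ ⟨p, hp, rfl⟩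
    exact ⟨u p, huK hp, hFu p hp⟩
  obtain ⟨T, r, O, hT, hr, hTr, hO, hKO, hKT, hrO⟩ := exists_retraction_graph hu hui
    (hK.image_of_continuousOn (hF.continuousOn.mono hKN)) hFK
  set M : Set R3 := N ∩ u ⁻¹' N with hM
  have hMo : IsOpen M := hN.inter (hN.preimage hu.continuous)
  have hKM : K ⊆ M := fun p hp => ⟨hKN hp, hKN (huK hp)⟩
  -- `A x` is the midpoint of the two points of the graph of `u` lying over `F x` and `u (F (u x))`.
  -- Replacing `x` by `u x` swaps its components, so `r ∘ A` is equivariant.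
  set A : R3 → R3 × R3 := fun x =>
    ((1 / 2 : ℝ) • (F x + u (F (u x))), (1 / 2 : ℝ) • (u (F x) + F (u x))) with hA
  have hF1 : ContDiffOn ℝ ∞ F M := hF.mono inter_subset_left
  have hF2 : ContDiffOn ℝ ∞ (fun x => F (u x)) M :=
    hF.comp hu.contDiffOn fun x hx => hx.2
  have hAs : ContDiffOn ℝ ∞ A M :=
    ((hF1.add (hu.comp_contDiffOn hF2)).const_smul (1 / 2 : ℝ)).prodMk
      (((hu.comp_contDiffOn hF1).add hF2).const_smul (1 / 2 : ℝ))
  have hAK : ∀ p ∈ K, A p = (F p, u (F p)) := by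
    intro p hp
    simp only [hA, hFu p hp, hui (F p)]
    refine Prod.ext ?_ ?_ <;> simp only <;> module
  have hAu : ∀ x, A (u x) = (A x).swap := by
    intro x
    simp only [hA, hui x, Prod.swap_prod_mk]
    rw [add_comm (F (u x)), add_comm (u (F (u x)))]
  refine ⟨M ∩ A ⁻¹' T, fun x => r (A x), hAs.continuousOn.isOpen_inter_preimage hMo hT, ?_, ?_,
    hr.comp (hAs.mono inter_subset_left) fun x hx => hx.2, ?_, ?_, ?_⟩
  · intro p hp
    refine ⟨hKM hp, ?_⟩
    rw [mem_preimage, hAK p hp]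
    exact hKT _ ⟨p, hp, rfl⟩
  · rintro x ⟨hx, hxT⟩
    refine ⟨⟨hx.2, by rw [mem_preimage, hui x]; exact hx.1⟩, ?_⟩
    rw [mem_preimage, hAu]
    exact (hTr _ hxT).1
  · intro p hp
    simp only [hAK p hp, hrO _ (hKO ⟨p, hp, rfl⟩)]
  · rintro x ⟨hx, hxT⟩
    simp only [hAu, (hTr _ hxT).2]
  · intro p hp
    have hud : ∀ y, HasFDerivAt u (fderiv ℝ u y) y :=
      fun y => (hu.differentiable (by simp) y).hasFDerivAt
    have hFd : ∀ q ∈ K, HasFDerivAt F (fderiv ℝ F q) q := fun q hq =>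
      ((hF.contDiffAt (hN.mem_nhds (hKN hq))).differentiableAt (by simp)).hasFDerivAt
    set L := fderiv ℝ F p
    set L₂ := (fderiv ℝ F (u p)).comp (fderiv ℝ u p) with hL₂
    set L₁ := (fderiv ℝ u (F (u p))).comp L₂ with hL₁
    set D := fderiv ℝ u (F p)
    have d2 : HasFDerivAt (fun x => F (u x)) L₂ p := (hFd (u p) (huK hp)).comp p (hud p)
    have d1 : HasFDerivAt (fun x => u (F (u x))) L₁ p :=
      HasFDerivAt.comp p (hud (F (u p))) d2
    have d3 : HasFDerivAt (fun x => u (F x)) (D.comp L) p := (hud (F p)).comp p (hFd p hp)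
    have dA : HasFDerivAt A (((1 / 2 : ℝ) • (L + L₁)).prod ((1 / 2 : ℝ) • (D.comp L + L₂))) p :=
      (((hFd p hp).add d1).const_smul (1 / 2 : ℝ)).prodMk ((d3.add d2).const_smul (1 / 2 : ℝ))
    have hAT : A p ∈ T := by rw [hAK p hp]; exact hKT _ ⟨p, hp, rfl⟩
    have dr : HasFDerivAt r (fderiv ℝ r (A p)) (A p) :=
      ((hr.contDiffAt (hT.mem_nhds hAT)).differentiableAt (by simp)).hasFDerivAt
    have hDL : D.comp L₁ = L₂ := by
      ext1 v
      have := hinv (F (u p)) (L₂ v)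
      have e : u (F (u p)) = F p := by rw [hFu p hp, hui (F p)]
      rw [e] at this
      exact this
    -- The derivative of `r` recovers `w` from the vector `(w, D w)` tangent to the graph, and by
    -- `hDL` the derivative of `A` takes values in such vectors.
    have dgraph : ∀ w, fderiv ℝ r (A p) (w, D w) = w := by
      intro w
      have e1 : HasFDerivAt (fun z => (z, u z)) ((ContinuousLinearMap.id ℝ R3).prod D) (F p) :=
        (hasFDerivAt_id _).prodMk (hud (F p))
      have e2 : HasFDerivAt (fun z => r (z, u z)) _ (F p) :=
        HasFDerivAt.comp (F p) (by rw [← hAK p hp]; exact dr) e1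
      have e3 : (fun z => r (z, u z)) =ᶠ[𝓝 (F p)] id := by
        filter_upwards [hO.mem_nhds (hKO ⟨p, hp, rfl⟩)] with z hz using hrO z hz
      exact congrArg (fun S : R3 →L[ℝ] R3 => S w)
        (e2.unique ((hasFDerivAt_id (F p)).congr_of_eventuallyEq e3))
    have dF' : HasFDerivAt (fun x => r (A x)) _ p := dr.comp p dA
    rw [dF'.fderiv]
    ext1 v
    have := dgraph (((1 / 2 : ℝ) • (L + L₁)) v)
    change fderiv ℝ r (A p) (((1 / 2 : ℝ) • (L + L₁)) v, ((1 / 2 : ℝ) • (D.comp L + L₂)) v) = _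
    rw [← hDL, ← ContinuousLinearMap.comp_add, ← ContinuousLinearMap.comp_smul]
    exact this

end Averaging

/-- The derivative of an involution is invertible everywhere, so its Jacobian has constant sign on
the connected space `R3`. Conjugation by `u` thus preserves the sign of a Jacobian. -/
theorem jac_mul_jac_pos_of_involutive {u : R3 → R3} (hu : ContDiff ℝ ∞ u)
    (hui : Function.Involutive u) (a b : R3) : 0 < jac (fderiv ℝ u a) * jac (fderiv ℝ u b) := by
  have hne : ∀ x, jac (fderiv ℝ u x) ≠ 0 := by
    intro x
    have := fderiv_comp_fderiv_of_involutive hu hui (u x)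
    rw [hui x] at this
    exact jac_ne_zero_of_comp_eq_id this
  have hc : Continuous fun x => jac (fderiv ℝ u x) :=
    continuous_jac.comp (hu.continuous_fderiv (by simp))
  rcases lt_or_gt_of_ne (hne a) with ha | ha <;> rcases lt_or_gt_of_ne (hne b) with hb | hb
  · exact mul_pos_of_neg_of_neg ha hb
  · obtain ⟨x, hx⟩ := mem_range_of_exists_le_of_exists_ge hc ⟨a, ha.le⟩ ⟨b, hb.le⟩
    exact absurd hx (hne x)
  · obtain ⟨x, hx⟩ := mem_range_of_exists_le_of_exists_ge hc ⟨b, hb.le⟩ ⟨a, ha.le⟩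
    exact absurd hx (hne x)
  · exact mul_pos ha hb

end EquivContact

end

/-! ### Equivariant extension and the contactomorphism. -/

noncomputable section

open Set Filter Topology
open scoped ContDiff

namespace EquivContact

variable {S₀ S₁ : Set R3} {s₀ s₁ : R3 → ℝ} {Ω₀ Ω₁ : R3 → R3 [⋀^Fin 2]→L[ℝ] ℝ}
    {α₀ α₁ : R3 → R3 →L[ℝ] ℝ} {V₀ U₀ U₁ : Set R3} {f : R3 → R3} {g h : R3 → ℝ} {u : R3 → R3}

/-- An equivariant surface map extends equivariantly to a local diffeomorphism near the surface that
matches the contact planes along the surface. -/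
theorem IsSurfaceMap.exists_equivariant_extension
    (H : IsSurfaceMap S₀ S₁ s₀ s₁ Ω₀ Ω₁ α₀ α₁ V₀ U₁ f g h) (hu : ContDiff ℝ ∞ u)
    (hui : Function.Involutive u) (huS : MapsTo u S₀ S₀) (hfu : ∀ p ∈ S₀, f (u p) = u (f p))
    (hα₀ : ∀ p ∈ S₀, ∀ v, α₀ (u p) (fderiv ℝ u p v) = -α₀ p v)
    (hα₁ : ∀ p ∈ S₁, ∀ v, α₁ (u p) (fderiv ℝ u p v) = -α₁ p v) :
    ∃ (N : Set R3) (F : R3 → R3), IsOpen N ∧ S₀ ⊆ N ∧ MapsTo u N N ∧ ContDiffOn ℝ ∞ F N ∧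
      EqOn F f S₀ ∧ (∀ x ∈ N, F (u x) = u (F x)) ∧
      (∀ p ∈ S₀, ∃ c : ℝ, 0 < c ∧ pullbackForm F α₁ p = c • α₀ p) ∧
      (∀ p ∈ S₀, 0 < jac (fderiv ℝ F p)) := by
  obtain ⟨N, F, hN, hSN, hF, hFf, hFα, hFj⟩ := H.exists_extension
  have hFu : ∀ p ∈ S₀, F (u p) = u (F p) := fun p hp => by
    rw [hFf (huS hp), hFf hp, hfu p hp]
  obtain ⟨N', F', hN', hSN', huN', hF', hFF', hF'u, hF'd⟩ :=
    exists_equivariant_average hu hui H.compact huS hN hSN hF hFu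
  have hud : ∀ y, HasFDerivAt u (fderiv ℝ u y) y :=
    fun y => (hu.differentiable (by simp) y).hasFDerivAt
  have hFd : ∀ q ∈ S₀, HasFDerivAt F (fderiv ℝ F q) q := fun q hq =>
    ((hF.contDiffAt (hN.mem_nhds (hSN hq))).differentiableAt (by simp)).hasFDerivAt
  refine ⟨N', F', hN', hSN', huN', hF', fun p hp => (hFF' hp).trans (hFf hp), hF'u,
    -- The two averaged derivatives pull `α₁` back to `h p • α₀` and `h (u p) • α₀`; in the second
    -- one the signs from the anti-invariance of `α₁` and `α₀` cancel.
    fun p hp => ⟨(1 / 2) * (h p + h (u p)), ?_, ?_⟩, fun p hp => ?_⟩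
  · have := H.factor_pos p hp
    have := H.factor_pos _ (huS hp)
    positivity
  · ext v
    have e1 := hFα p hp v
    have e2 := hα₁ _ (H.mapsTo (huS hp)) (fderiv ℝ F (u p) (fderiv ℝ u p v))
    have e3 := hFα _ (huS hp) (fderiv ℝ u p v)
    have e4 := hα₀ p hp v
    have e5 : u (f (u p)) = f p := by rw [hfu p hp, hui (f p)]
    rw [e5, e3, e4] at e2
    rw [pullbackForm_apply, hFF' hp, hFf hp, hF'd p hp]
    simp only [smul_apply, add_apply, ContinuousLinearMap.comp_apply, map_smul, map_add,
      smul_eq_mul, hFf (huS hp)]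
    rw [e1, e2]
    ring
  · obtain ⟨n, hn⟩ : ∃ n, fderiv ℝ s₀ p n = 1 := by
      have h0 := ne_zero_of_wedge_pos (H.coorient₀ p hp)
      have h1 := apply_sharp_self_pos h0
      exact ⟨(fderiv ℝ s₀ p (sharp (fderiv ℝ s₀ p)))⁻¹ • sharp (fderiv ℝ s₀ p), by
        rw [map_smul, smul_eq_mul, inv_mul_cancel₀ h1.ne']⟩
    have hfd : DifferentiableAt ℝ f p := H.smooth_map.differentiable (by simp) p
    set L := fderiv ℝ F p
    set L₁ := ((fderiv ℝ u (F (u p))).comp (fderiv ℝ F (u p))).comp (fderiv ℝ u p) with hL₁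
    have d1 : HasFDerivAt (fun x => u (F (u x))) L₁ p :=
      ((hud (F (u p))).comp (u p) (hFd (u p) (huS hp))).comp p (hud p)
    have hL : ∀ v ∈ tangentPlane S₀ p, L v = fderiv ℝ f p v := fun v hv =>
      fderiv_eq_of_eqOn (hFd p hp).differentiableAt hfd hp
        (Eventually.of_forall fun x hx => hFf hx) hv
    have hL₁T : ∀ v ∈ tangentPlane S₀ p, L₁ v = fderiv ℝ f p v := fun v hv => by
      rw [← d1.fderiv]
      exact fderiv_eq_of_eqOn d1.differentiableAt hfd hp
        (Eventually.of_forall fun x hx => by rw [hFu x hx, hui (F x), hFf hx]) hv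
    have k1 := (H.jac_pos_iff hp hL hn).1 (hFj p hp)
    have k2 := (H.jac_pos_iff hp hL₁T hn).1 (by
      rw [hL₁, jac_comp, jac_comp, mul_right_comm]
      exact mul_pos (jac_mul_jac_pos_of_involutive hu hui _ _) (hFj _ (huS hp)))
    rw [hF'd p hp, H.jac_pos_iff hp (fun v hv => ?_) hn]
    · rw [smul_apply, add_apply, map_smul, map_add, smul_eq_mul]
      positivity
    · rw [smul_apply, add_apply, hL v hv, hL₁T v hv]
      module

/-- An equivariant surface map extends to an equivariant contactomorphism of neighbourhoods. -/
theorem IsSurfaceMap.exists_equivariant_contacto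
    (H : IsSurfaceMap S₀ S₁ s₀ s₁ Ω₀ Ω₁ α₀ α₁ V₀ U₁ f g h) (hu : ContDiff ℝ ∞ u)
    (hui : Function.Involutive u) (huS : MapsTo u S₀ S₀) (hfu : ∀ p ∈ S₀, f (u p) = u (f p))
    (hfinj : InjOn f S₀) (hSU : S₀ ⊆ U₀) (hα₀ : IsInvariantContactForm u U₀ α₀)
    (hα₁ : IsInvariantContactForm u U₁ α₁) :
    ∃ ψ : OpenPartialHomeomorph R3 R3, S₀ ⊆ ψ.source ∧ ψ.source ⊆ U₀ ∧ ψ.target ⊆ U₁ ∧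
      IsEquivariantContacto u α₀ α₁ ψ ∧ EqOn ψ f S₀ := by
  obtain ⟨N, F, hN, hSN, huN, hF, hFf, hFu, hFα, hFj⟩ := H.exists_equivariant_extension hu hui huS
    hfu (fun p hp => hα₀.antiInvariant p (hSU hp))
    (fun p hp => hα₁.antiInvariant p (H.subset₁ hp))
  have hud : ∀ y, HasFDerivAt u (fderiv ℝ u y) y :=
    fun y => (hu.differentiable (by simp) y).hasFDerivAt
  set O : Set R3 := (N ∩ F ⁻¹' U₁) ∩ U₀ with hO
  have hOo : IsOpen O := (hF.continuousOn.isOpen_inter_preimage hN hα₁.isOpen).inter hα₀.isOpen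
  have hSO : S₀ ⊆ O := fun p hp => ⟨⟨hSN hp, by
    rw [mem_preimage, hFf hp]; exact H.subset₁ (H.mapsTo hp)⟩, hSU hp⟩
  have huO : MapsTo u O O := fun x hx => ⟨⟨huN hx.1.1, by
    rw [mem_preimage, hFu x hx.1.1]; exact hα₁.mapsTo hx.1.2⟩, hα₀.mapsTo hx.2⟩
  have hFO : ContDiffOn ℝ ∞ F O := hF.mono fun x hx => hx.1.1
  have hFd : ∀ x ∈ O, HasFDerivAt F (fderiv ℝ F x) x := fun x hx =>
    ((hFO.contDiffAt (hOo.mem_nhds hx)).differentiableAt (by simp)).hasFDerivAt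
  obtain ⟨M, χ, hM, hSM, hχ, hχO, hχS, hχinj, hχα, hχu⟩ := exists_moser_diffeo H.compact hOo hSO
    (α := α₀) (β := pullbackForm F α₁) (hα₀.smooth.mono fun x hx => hx.2)
    (contDiffOn_pullbackForm hOo hFO hα₁.smooth fun x hx => hx.1.2)
    (fun p hp => hα₀.positive p (hSU hp))
    (fun p hp => by
      rw [contactVolume_pullbackForm (hFO.contDiffAt (hOo.mem_nhds (hSO hp)))
        ((hα₁.smooth.contDiffAt (hα₁.isOpen.mem_nhds (hSO hp).1.2)).differentiableAt (by simp))]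
      exact mul_pos (hα₁.positive _ (hSO hp).1.2) (hFj p hp))
    hFα hu hui huS huO (fun p hp => hα₀.antiInvariant p hp.2)
    (fun p hp v => by
      have e1 : HasFDerivAt (fun x => F (u x)) _ p := (hFd (u p) (huO hp)).comp p (hud p)
      have e2 : HasFDerivAt (fun x => u (F x)) _ p := (hud (F p)).comp p (hFd p hp)
      have e3 : (fun x => F (u x)) =ᶠ[𝓝 p] fun x => u (F x) := by
        filter_upwards [hN.mem_nhds hp.1.1] with x hx using hFu x hx
      have e4 : fderiv ℝ F (u p) (fderiv ℝ u p v) = fderiv ℝ u (F p) (fderiv ℝ F p v) :=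
        congrArg (fun L : R3 →L[ℝ] R3 => L v) (e1.unique (e2.congr_of_eventuallyEq e3))
      rw [pullbackForm_apply, pullbackForm_apply, e4, hFu p hp.1.1]
      exact hα₁.antiInvariant _ hp.1.2 _)
  have hχd : ∀ x ∈ M, HasFDerivAt χ (fderiv ℝ χ x) x := fun x hx =>
    ((hχ.contDiffAt (hM.mem_nhds hx)).differentiableAt (by simp)).hasFDerivAt
  have hψs : ContDiffOn ℝ ∞ (fun x => F (χ x)) (M ∩ U₀) :=
    (hFO.comp hχ hχO).mono inter_subset_left
  have hψd : ∀ x ∈ M, HasFDerivAt (fun x => F (χ x)) ((fderiv ℝ F (χ x)).comp (fderiv ℝ χ x)) x :=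
    fun x hx => (hFd (χ x) (hχO hx)).comp x (hχd x hx)
  have hψf : ∀ p ∈ S₀, F (χ p) = f p := fun p hp => by rw [hχS p hp, hFf hp]
  obtain ⟨e, hSe, heV, heq, hesymm, hed⟩ := exists_openPartialHomeomorph_of_injOn
    (f := fun x => F (χ x)) H.compact (hM.inter hα₀.isOpen) (fun p hp => ⟨hSM hp, hSU hp⟩) hψs
    (fun p hp q hq hpq => hfinj hp hq (by
      have : F (χ p) = F (χ q) := hpq
      rwa [hψf p hp, hψf q hq] at this))
    (fun p hp => by
      have hinj : Function.Injective ((fderiv ℝ F (χ p)).comp (fderiv ℝ χ p)) := by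
        rw [ContinuousLinearMap.coe_comp, hχS p hp]
        exact (injective_of_jac_ne_zero (hFj p hp).ne').comp (hχinj p hp)
      obtain ⟨L, hL⟩ := exists_equiv_of_injective hinj
      exact ⟨L, hL ▸ hψd p (hSM hp)⟩)
  have heq' : ∀ x, e x = F (χ x) := heq
  have hequiv : ∀ x ∈ e.source, u x ∈ e.source → e (u x) = u (e x) := by
    intro x hx hux
    rw [heq', heq', hχu x (heV hx).1 (heV hux).1, hFu _ (hχO (heV hx).1).1.1]
  -- The source is made `u`-invariant by intersecting it with its preimage under `u`.
  let ψ := e.restrOpen (u ⁻¹' e.source) (e.open_source.preimage hu.continuous)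
  have hψsrc : ψ.source = e.source ∩ u ⁻¹' e.source := rfl
  have hψe : ∀ x, ψ x = e x := fun x => rfl
  have hψsymm : ∀ x, ψ.symm x = e.symm x := fun x => rfl
  have hsrc : MapsTo u ψ.source ψ.source := by
    rintro x ⟨hx, hux⟩
    exact ⟨hux, by rw [mem_preimage, hui x]; exact hx⟩
  have heqv : ∀ x ∈ ψ.source, ψ (u x) = u (ψ x) := fun x hx => hequiv x hx.1 hx.2
  refine ⟨ψ, fun p hp => ⟨hSe hp, hSe (huS hp)⟩, fun x hx => (heV hx.1).2, ?_, ?_, ?_⟩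
  · intro y hy
    have hx := ψ.map_target hy
    rw [← ψ.right_inv hy, hψe, heq']
    exact (hχO (heV hx.1).1).1.2
  · refine ⟨hsrc, ?_, ?_, ?_, heqv, ?_⟩
    · intro y hy
      have hx := ψ.map_target hy
      rw [← ψ.right_inv hy, ← heqv _ hx]
      exact ψ.map_source (hsrc hx)
    · refine (hψs.mono fun x hx => heV hx.1).congr fun x _ => heq' x
    · exact hesymm.mono fun y hy => hy.1
    · intro x hx
      obtain ⟨L, hL⟩ := hed x hx.1
      have hψeq : (ψ : R3 → R3) = fun x => F (χ x) := funext fun x => heq' x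
      have hfd : fderiv ℝ ψ x = L := by rw [hψeq]; exact hL.fderiv
      have hLc : (L : R3 →L[ℝ] R3) = (fderiv ℝ F (χ x)).comp (fderiv ℝ χ x) :=
        hL.unique (hψd x (heV hx.1).1)
      have hker : ∀ v, α₀ x v = 0 → (α₁ (ψ x)).comp (L : R3 →L[ℝ] R3) v = 0 := by
        intro v hv
        have := hχα x (heV hx.1).1 v hv
        rw [pullbackForm_apply] at this
        rw [hLc, hψe, heq']
        exact this
      have hne : (α₁ (ψ x)).comp (L : R3 →L[ℝ] R3) ≠ 0 := by
        intro h0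
        have hpos := hα₁.positive (ψ x) (by
          rw [hψe, heq']; exact (hχO (heV hx.1).1).1.2)
        refine ne_zero_of_wedge_pos hpos (ContinuousLinearMap.ext fun w => ?_)
        have := congrArg (fun A : R3 →L[ℝ] ℝ => A (L.symm w)) h0
        simpa using this
      rw [hfd]
      ext w
      constructor
      · rintro ⟨v, hv, rfl⟩
        exact hker v hv
      -- The inclusion of kernels becomes an equality because the pulled-back functional is nonzero.
      · intro hw
        refine ⟨L.symm w, ?_, L.apply_symm_apply w⟩
        refine ker_eq_of_ker_le hker hne ?_
        change α₁ (ψ x) (L (L.symm w)) = 0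
        rw [L.apply_symm_apply]
        exact hw
  · intro p hp
    rw [hψe, heq', hψf p hp]

end EquivContact

end

noncomputable section

open Set Filter Topology
open scoped ContDiff

namespace EquivContact

/-! ### The ratio of the area forms and its sign. -/

section AreaRatio

variable {S S₀ S₁ U₀ U₁ : Set R3} {s₀ l : R3 → ℝ} {Ω Ω' Ω₀ Ω₁ : R3 → R3 [⋀^Fin 2]→L[ℝ] ℝ}
  {α α₀ α₁ : R3 → R3 →L[ℝ] ℝ} {f u X X₀ X₁ : R3 → R3}

/-- The factor by which `f` changes the area of a surface with defining function `s₀`. -/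
def areaRatio (s₀ : R3 → ℝ) (Ω₀ Ω₁ : R3 → R3 [⋀^Fin 2]→L[ℝ] ℝ) (f : R3 → R3) (p : R3) : ℝ :=
  wedge (fderiv ℝ s₀ p) ((Ω₁ (f p)).compContinuousLinearMap (fderiv ℝ f p)) /
    wedge (fderiv ℝ s₀ p) (Ω₀ p)

theorem compContinuousLinearMap_pair (θ : R3 [⋀^Fin 2]→L[ℝ] ℝ) (L : R3 →L[ℝ] R3) (v w : R3) :
    θ.compContinuousLinearMap L ![v, w] = θ ![L v, L w] := by
  rw [ContinuousAlternatingMap.compContinuousLinearMap_apply]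
  congr 1
  ext i : 1; fin_cases i <;> rfl

theorem areaRatio_neg (p : R3) : areaRatio s₀ Ω₀ (-Ω₁) f p = -areaRatio s₀ Ω₀ Ω₁ f p := by
  rw [areaRatio, areaRatio, ← neg_div]
  congr 1
  simp only [wedge, compContinuousLinearMap_pair, Pi.neg_apply, ContinuousAlternatingMap.neg_apply]
  ring

theorem contDiff_twoForm_apply {Y : Type*} [NormedAddCommGroup Y] [NormedSpace ℝ Y]
    {θ : Y → R3 [⋀^Fin 2]→L[ℝ] ℝ} (hθ : ContDiff ℝ ∞ θ) {v w : Y → R3} (hv : ContDiff ℝ ∞ v)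
    (hw : ContDiff ℝ ∞ w) : ContDiff ℝ ∞ fun x => θ x ![v x, w x] := by
  have h (a : Fin 2 → R3) : ContDiff ℝ ∞ fun x => θ x a :=
    (ContinuousAlternatingMap.apply ℝ R3 ℝ a).contDiff.comp hθ
  have := h ![stdVec 1, stdVec 2]
  have := h ![stdVec 2, stdVec 0]
  have := h ![stdVec 0, stdVec 1]
  have hc (i : Fin 3) : ContDiff ℝ ∞ fun x => v x i :=
    (EuclideanSpace.proj (𝕜 := ℝ) i : R3 →L[ℝ] ℝ).contDiff.comp hv
  have hc' (i : Fin 3) : ContDiff ℝ ∞ fun x => w x i :=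
    (EuclideanSpace.proj (𝕜 := ℝ) i : R3 →L[ℝ] ℝ).contDiff.comp hw
  rw [funext fun x => twoForm_expand (θ x) (v x) (w x)]
  fun_prop

theorem contDiff_wedge_fderiv (hs : ContDiff ℝ ∞ s₀) {θ : R3 → R3 [⋀^Fin 2]→L[ℝ] ℝ}
    (hθ : ∀ v w, ContDiff ℝ ∞ fun x => θ x ![v, w]) :
    ContDiff ℝ ∞ fun p => wedge (fderiv ℝ s₀ p) (θ p) := by
  rw [← contDiffOn_univ]
  have h1 : ContDiff ℝ ∞ (fderiv ℝ s₀) := hs.fderiv_right (by simp)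
  exact contDiffOn_wedge (fun v => (h1.clm_apply contDiff_const).contDiffOn)
    fun v w => (hθ v w).contDiffOn

theorem contDiffOn_areaRatio (hs : ContDiff ℝ ∞ s₀) (hΩ₀ : ContDiff ℝ ∞ Ω₀)
    (hΩ₁ : ContDiff ℝ ∞ Ω₁) (hf : ContDiff ℝ ∞ f) :
    ContDiffOn ℝ ∞ (areaRatio s₀ Ω₀ Ω₁ f) {p | wedge (fderiv ℝ s₀ p) (Ω₀ p) ≠ 0} := by
  have h1 : ContDiff ℝ ∞ (fderiv ℝ f) := hf.fderiv_right (by simp)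
  refine ContDiffOn.div (contDiff_wedge_fderiv hs fun v w => ?_).contDiffOn
    (contDiff_wedge_fderiv hs fun v w =>
      contDiff_twoForm_apply hΩ₀ contDiff_const contDiff_const).contDiffOn fun p hp => hp
  simp only [compContinuousLinearMap_pair]
  exact contDiff_twoForm_apply (hΩ₁.comp hf) (h1.clm_apply contDiff_const)
    (h1.clm_apply contDiff_const)

/-- Two-forms on the plane `ker ds₀` are compared by wedging them with `ds₀`. The resulting quotient
is also defined and smooth near `S₀`, as the factor `h` has to be. -/
theorem apply_fderiv_eq_areaRatio_mul {p : R3} (h0 : 0 < wedge (fderiv ℝ s₀ p) (Ω₀ p)) {v w : R3}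
    (hv : fderiv ℝ s₀ p v = 0) (hw : fderiv ℝ s₀ p w = 0) :
    Ω₁ (f p) ![fderiv ℝ f p v, fderiv ℝ f p w] = areaRatio s₀ Ω₀ Ω₁ f p * Ω₀ p ![v, w] := by
  obtain ⟨n, hn⟩ : ∃ n, fderiv ℝ s₀ p n ≠ 0 := by
    by_contra! h
    exact ne_zero_of_wedge_pos h0 (ContinuousLinearMap.ext h)
  have e1 := wedge_mul_det3 (fderiv ℝ s₀ p) (Ω₀ p) v w n
  have e2 := wedge_mul_det3 (fderiv ℝ s₀ p)
    ((Ω₁ (f p)).compContinuousLinearMap (fderiv ℝ f p)) v w n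
  rw [hv, hw, zero_mul, zero_mul, zero_add, zero_add] at e1 e2
  rw [← compContinuousLinearMap_pair, areaRatio, div_mul_eq_mul_div, eq_div_iff h0.ne']
  refine mul_left_cancel₀ hn ?_
  linear_combination wedge (fderiv ℝ s₀ p) (Ω₀ p) * e2 -
    wedge (fderiv ℝ s₀ p) ((Ω₁ (f p)).compContinuousLinearMap (fderiv ℝ f p)) * e1

theorem IsCharacteristicField.congr_form (h : IsCharacteristicField S Ω α X) (hΩ : EqOn Ω' Ω S) :
    IsCharacteristicField S Ω' α X :=
  fun p hp => ⟨(h p hp).1, fun v hv => by rw [hΩ hp]; exact (h p hp).2 v hv⟩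

theorem IsCharacteristicField.neg (h : IsCharacteristicField S Ω α X) :
    IsCharacteristicField S (-Ω) (-α) X :=
  fun p hp => ⟨(h p hp).1, fun v hv => congrArg Neg.neg ((h p hp).2 v hv)⟩

/-- `α ∧ dα` is quadratic in `α`, so positivity does not see the sign. -/
theorem IsInvariantContactForm.neg (h : IsInvariantContactForm u U₁ α) :
    IsInvariantContactForm u U₁ (-α) where
  isOpen := h.isOpen
  mapsTo := h.mapsTo
  smooth := h.smooth.neg
  positive p hp := by
    have hd : DifferentiableAt ℝ α p :=
      (h.smooth.contDiffAt (h.isOpen.mem_nhds hp)).differentiableAt (by simp)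
    have hdn : ∀ v w, dForm (-α) p ![v, w] = -dForm α p ![v, w] := fun v w => by
      rw [dForm_apply hd, dForm_apply hd.neg, fderiv_neg]
      simp only [neg_apply]; ring
    have := h.positive p hp
    unfold contactVolume at this ⊢
    simpa [hdn] using this
  antiInvariant p hp v := congrArg Neg.neg (h.antiInvariant p hp v)

theorem contactPlane_neg (p : R3) : contactPlane (-α) p = contactPlane α p := by
  ext v
  change -(α p v) = 0 ↔ α p v = 0
  exact neg_eq_zero

theorem IsEquivariantContacto.of_neg {ψ : OpenPartialHomeomorph R3 R3}
    (h : IsEquivariantContacto u α₀ (-α₁) ψ) : IsEquivariantContacto u α₀ α₁ ψ :=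
  { h with
    map_contactPlane := fun p hp => (h.map_contactPlane p hp).trans (contactPlane_neg (ψ p)) }

theorem exists_equivariant_contacto_of_areaRatio_pos (hu : ContDiff ℝ ∞ u)
    (hui : Function.Involutive u) (hS₀ : IsCompactSurface S₀) (hS₁ : IsCompactSurface S₁)
    (huS : MapsTo u S₀ S₀) (hΩ₀ : ContDiff ℝ ∞ Ω₀) (hΩ₁ : ContDiff ℝ ∞ Ω₁)
    (hne₀ : ∀ p ∈ S₀, ∃ v ∈ tangentPlane S₀ p, ∃ w ∈ tangentPlane S₀ p, Ω₀ p ![v, w] ≠ 0)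
    (hne₁ : ∀ p ∈ S₁, ∃ v ∈ tangentPlane S₁ p, ∃ w ∈ tangentPlane S₁ p, Ω₁ p ![v, w] ≠ 0)
    (hSU₀ : S₀ ⊆ U₀) (hSU₁ : S₁ ⊆ U₁) (hα₀ : IsInvariantContactForm u U₀ α₀)
    (hα₁ : IsInvariantContactForm u U₁ α₁) (hX₀ : IsCharacteristicField S₀ Ω₀ α₀ X₀)
    (hX₁ : IsCharacteristicField S₁ Ω₁ α₁ X₁) (hf : ContDiff ℝ ∞ f) (hfS : MapsTo f S₀ S₁)
    (hfinj : InjOn f S₀) (hfu : ∀ p ∈ S₀, f (u p) = u (f p)) (hl : ContDiff ℝ ∞ l)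
    (hl0 : ∀ q ∈ S₁, 0 < l q) (hlX : ∀ p ∈ S₀, X₁ (f p) = l (f p) • fderiv ℝ f p (X₀ p))
    (hs : ContDiff ℝ ∞ s₀) (hs0 : ∀ p ∈ S₀, s₀ p = 0)
    (hsΩ : ∀ p ∈ S₀, 0 < wedge (fderiv ℝ s₀ p) (Ω₀ p))
    (hsT : ∀ p ∈ S₀, ∀ v, v ∈ tangentPlane S₀ p ↔ fderiv ℝ s₀ p v = 0)
    (hpos : ∀ p ∈ S₀, 0 < areaRatio s₀ Ω₀ Ω₁ f p) :
    ∃ ψ : OpenPartialHomeomorph R3 R3, S₀ ⊆ ψ.source ∧ ψ.source ⊆ U₀ ∧ ψ.target ⊆ U₁ ∧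
      IsEquivariantContacto u α₀ α₁ ψ ∧ EqOn ψ f S₀ := by
  obtain ⟨s₁, hs₁, -, hs₁Ω, hs₁T⟩ := exists_definingFunction hS₁ hΩ₁ hne₁
  have hden : Continuous fun p => wedge (fderiv ℝ s₀ p) (Ω₀ p) :=
    (contDiff_wedge_fderiv hs fun v w =>
      contDiff_twoForm_apply hΩ₀ contDiff_const contDiff_const).continuous
  set V₀ := U₀ ∩ {p | wedge (fderiv ℝ s₀ p) (Ω₀ p) ≠ 0}
  have harea : ∀ p ∈ S₀, ∀ v ∈ tangentPlane S₀ p, ∀ w ∈ tangentPlane S₀ p,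
      Ω₁ (f p) ![fderiv ℝ f p v, fderiv ℝ f p w] =
        areaRatio s₀ Ω₀ Ω₁ f p * Ω₀ p ![v, w] := fun p hp v hv w hw =>
    apply_fderiv_eq_areaRatio_mul (hsΩ p hp) ((hsT p hp v).1 hv) ((hsT p hp w).1 hw)
  -- The factor comes from `α₁ (df v) = Ω₁ (X₁, df v) = l Ω₁ (df X₀, df v) = l * ratio * Ω₀ (X₀, v)
  -- = l * ratio * α₀ v`.
  have H : IsSurfaceMap S₀ S₁ s₀ s₁ Ω₀ Ω₁ α₀ α₁ V₀ U₁ f (areaRatio s₀ Ω₀ Ω₁ f)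
      fun p => l (f p) * areaRatio s₀ Ω₀ Ω₁ f p :=
    { compact := hS₀.compact
      smooth₀ := hs
      smooth₁ := hs₁
      zero₀ := hs0
      tangent₀ := hsT
      tangent₁ := hs₁T
      coorient₀ := hsΩ
      coorient₁ := hs₁Ω
      nonvanishing := hne₀
      isOpen₀ := hα₀.isOpen.inter (isOpen_ne_fun hden continuous_const)
      isOpen₁ := hα₁.isOpen
      subset₀ := fun p hp => ⟨hSU₀ hp, (hsΩ p hp).ne'⟩
      subset₁ := hSU₁
      smooth_form₀ := hα₀.smooth.mono inter_subset_left
      smooth_form₁ := hα₁.smooth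
      contact₀ := fun p hp => hα₀.positive p hp.1
      contact₁ := hα₁.positive
      smooth_map := hf
      mapsTo := hfS
      smooth_factor := (hl.comp hf).contDiffOn.mul
        ((contDiffOn_areaRatio hs hΩ₀ hΩ₁ hf).mono inter_subset_right)
      factor_pos := fun p hp => mul_pos (hl0 _ (hfS hp)) (hpos p hp)
      area_factor_pos := hpos
      pullback_area := harea
      pullback_form := fun p hp v hv => by
        have hTv : fderiv ℝ f p v ∈ tangentPlane S₁ (f p) := mapsTo_tangentPlane
          (hf.differentiable (by simp) p).hasFDerivAt.hasFDerivWithinAt hfS hv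
        rw [← (hX₁ _ (hfS hp)).2 _ hTv, hlX p hp, ← toBilin_apply, map_smul,
          LinearMap.smul_apply, toBilin_apply, harea p hp _ (hX₀ p hp).1 v hv,
          (hX₀ p hp).2 v hv, smul_eq_mul, mul_assoc] }
  exact H.exists_equivariant_contacto hu hui huS hfu hfinj hSU₀ hα₀ hα₁

/-- The inverse `k` makes `df` map the tangent plane of `S₀` onto that of `S₁`, where `Ω₁` is
nonzero. -/
theorem areaRatio_ne_zero (hsΩ : ∀ p ∈ S₀, 0 < wedge (fderiv ℝ s₀ p) (Ω₀ p))
    (hsT : ∀ p ∈ S₀, ∀ v, v ∈ tangentPlane S₀ p ↔ fderiv ℝ s₀ p v = 0)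
    (hne₁ : ∀ p ∈ S₁, ∃ v ∈ tangentPlane S₁ p, ∃ w ∈ tangentPlane S₁ p, Ω₁ p ![v, w] ≠ 0)
    {k : R3 → R3} (hf : Differentiable ℝ f) (hk : Differentiable ℝ k) (hfS : MapsTo f S₀ S₁)
    (hkS : MapsTo k S₁ S₀) (hkf : ∀ p ∈ S₀, k (f p) = p) (hfk : ∀ q ∈ S₁, f (k q) = q) {p : R3}
    (hp : p ∈ S₀) : areaRatio s₀ Ω₀ Ω₁ f p ≠ 0 := by
  intro h0
  obtain ⟨v, hv, w, hw, hvw⟩ := hne₁ (f p) (hfS hp)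
  have hT : ∀ v ∈ tangentPlane S₁ (f p), fderiv ℝ s₀ p (fderiv ℝ k (f p) v) = 0 := by
    intro v hv
    have := mapsTo_tangentPlane (hk (f p)).hasFDerivAt.hasFDerivWithinAt hkS hv
    rw [hkf p hp] at this
    exact (hsT p hp _).1 this
  have hD : ∀ v ∈ tangentPlane S₁ (f p), fderiv ℝ f p (fderiv ℝ k (f p) v) = v := by
    intro v hv
    have hc : HasFDerivAt (f ∘ k) ((fderiv ℝ f p).comp (fderiv ℝ k (f p))) (f p) :=
      HasFDerivAt.comp (f p) (by rw [hkf p hp]; exact (hf p).hasFDerivAt) (hk (f p)).hasFDerivAt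
    have := fderiv_eq_of_eqOn hc.differentiableAt differentiableAt_id (hfS hp)
      (Eventually.of_forall hfk) hv
    rw [hc.fderiv, fderiv_id] at this
    exact this
  have := apply_fderiv_eq_areaRatio_mul (Ω₁ := Ω₁) (f := f) (hsΩ p hp) (hT v hv) (hT w hw)
  rw [hD v hv, hD w hw, h0, zero_mul] at this
  exact hvw this

theorem pos_or_neg_of_ne_zero (hS : IsPreconnected S) {g : R3 → ℝ} (hg : ContinuousOn g S)
    (h : ∀ p ∈ S, g p ≠ 0) : (∀ p ∈ S, 0 < g p) ∨ ∀ p ∈ S, g p < 0 := by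
  by_contra! hc
  obtain ⟨⟨p, hp, hgp⟩, q, hq, hgq⟩ := hc
  obtain ⟨x, hx, hgx⟩ := hS.intermediate_value hp hq hg ⟨hgp, hgq⟩
  exact h x hx hgx

end AreaRatio

end EquivContact

end

/-! ### Assembly of the contactomorphism. -/

theorem proposition2p4
    (u : EquivContact.R3 → EquivContact.R3) (hu : EquivContact.IsAxialInvolution u)
    (S₀ S₁ : Set EquivContact.R3)
    (Ω₀ Ω₁ : EquivContact.R3 → EquivContact.R3 [⋀^Fin 2]→L[ℝ] ℝ)
    (hS₀ : EquivContact.IsUOrientedCompactSurface u S₀ Ω₀)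
    (hS₁ : EquivContact.IsUOrientedCompactSurface u S₁ Ω₁)
    (U₀ U₁ : Set EquivContact.R3) (hSU₀ : S₀ ⊆ U₀) (hSU₁ : S₁ ⊆ U₁)
    (α₀ α₁ : EquivContact.R3 → EquivContact.R3 →L[ℝ] ℝ)
    (hα₀ : EquivContact.IsInvariantContactForm u U₀ α₀)
    (hα₁ : EquivContact.IsInvariantContactForm u U₁ α₁)
    (X₀ X₁ : EquivContact.R3 → EquivContact.R3)
    (hX₀ : EquivContact.IsCharacteristicField S₀ Ω₀ α₀ X₀)
    (hX₁ : EquivContact.IsCharacteristicField S₁ Ω₁ α₁ X₁)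
    (φ : PartialEquiv EquivContact.R3 EquivContact.R3)
    (hφ : EquivContact.IsEquivariantDiffeo u S₀ S₁ φ)
    (hfol : EquivContact.SameFoliation u S₁ (EquivContact.pushforward φ X₀) X₁) :
    ∃ ψ : OpenPartialHomeomorph EquivContact.R3 EquivContact.R3,
      S₀ ⊆ ψ.source ∧ ψ.source ⊆ U₀ ∧ S₁ ⊆ ψ.target ∧ ψ.target ⊆ U₁ ∧
      EquivContact.IsEquivariantContacto u α₀ α₁ ψ ∧
      Set.EqOn ψ φ S₀ := by
  open EquivContact in
  have hc₀ := hS₀.surface.compact.isClosed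
  have hc₁ := hS₁.surface.compact.isClosed
  obtain ⟨f, hf, hfφ⟩ := hφ.smooth.exists_contDiff hc₀
  obtain ⟨k, hk, hkφ⟩ := hφ.smooth_symm.exists_contDiff hc₁
  obtain ⟨θ₀, hθ₀, hθΩ₀⟩ := hS₀.area.smooth.exists_contDiff hc₀
  obtain ⟨θ₁, hθ₁, hθΩ₁⟩ := hS₁.area.smooth.exists_contDiff hc₁
  obtain ⟨r, hr, hr0, -, hrX⟩ := hfol
  obtain ⟨l, hl, hlr⟩ := hr.exists_contDiff hc₁
  have hne₀ : ∀ p ∈ S₀, ∃ v ∈ tangentPlane S₀ p, ∃ w ∈ tangentPlane S₀ p, θ₀ p ![v, w] ≠ 0 :=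
    fun p hp => by rw [hθΩ₀ hp]; exact hS₀.area.nonvanishing p hp
  have hne₁ : ∀ p ∈ S₁, ∃ v ∈ tangentPlane S₁ p, ∃ w ∈ tangentPlane S₁ p, θ₁ p ![v, w] ≠ 0 :=
    fun p hp => by rw [hθΩ₁ hp]; exact hS₁.area.nonvanishing p hp
  have hmem : ∀ {p}, p ∈ S₀ → p ∈ φ.source := fun hp => hφ.source_eq.symm ▸ hp
  have hmem' : ∀ {q}, q ∈ S₁ → q ∈ φ.target := fun hq => hφ.target_eq.symm ▸ hq
  have hφS : ∀ {p}, p ∈ S₀ → φ p ∈ S₁ := fun hp => hφ.target_eq ▸ φ.map_source (hmem hp)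
  have hφS' : ∀ {q}, q ∈ S₁ → φ.symm q ∈ S₀ := fun hq => hφ.source_eq ▸ φ.map_target (hmem' hq)
  have hfS : Set.MapsTo f S₀ S₁ := fun p hp => by rw [hfφ hp]; exact hφS hp
  have hkS : Set.MapsTo k S₁ S₀ := fun q hq => by rw [hkφ hq]; exact hφS' hq
  have hkf : ∀ p ∈ S₀, k (f p) = p := fun p hp => by
    rw [hkφ (hfS hp), hfφ hp, φ.left_inv (hmem hp)]
  have hfk : ∀ q ∈ S₁, f (k q) = q := fun q hq => by
    rw [hfφ (hkS hq), hkφ hq, φ.right_inv (hmem' hq)]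
  have hfu : ∀ p ∈ S₀, f (u p) = u (f p) := fun p hp => by
    rw [hfφ hp, hfφ (hS₀.area.mapsTo hp), hφ.equivariant p hp]
  have hfinj : Set.InjOn f S₀ := fun p hp q hq hpq => by
    rw [← hkf p hp, hpq, hkf q hq]
  have hl0 : ∀ q ∈ S₁, 0 < l q := fun q hq => by rw [hlr hq]; exact hr0 q hq
  have hlX : ∀ p ∈ S₀, X₁ (f p) = l (f p) • fderiv ℝ f p (X₀ p) := fun p hp => by
    have hd : HasFDerivWithinAt φ (fderiv ℝ f p) S₀ p :=
      (hf.differentiable (by simp) p).hasFDerivAt.hasFDerivWithinAt.congr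
        (fun x hx => (hfφ hx).symm) (hfφ hp).symm
    rw [hrX _ (hfS hp), hlr (hfS hp), pushforward, hfφ hp, φ.left_inv (hmem hp), hφ.source_eq]
    -- The derivative of `φ` within `S₀` and `df` need only agree on tangent vectors of `S₀`, and
    -- `X₀ p` is one.
    rw [eqOn_tangentPlane hd.differentiableWithinAt.hasFDerivWithinAt hd (hX₀ p hp).1]
  obtain ⟨s, hs, hs0, hsΩ, hsT⟩ := exists_definingFunction hS₀.surface hθ₀ hne₀
  have hratio : ContinuousOn (areaRatio s θ₀ θ₁ f) S₀ :=
    (contDiffOn_areaRatio hs hθ₀ hθ₁ hf).continuousOn.mono fun p hp => (hsΩ p hp).ne'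
  have key : ∃ ψ : OpenPartialHomeomorph R3 R3, S₀ ⊆ ψ.source ∧ ψ.source ⊆ U₀ ∧ ψ.target ⊆ U₁ ∧
      IsEquivariantContacto u α₀ α₁ ψ ∧ Set.EqOn ψ f S₀ := by
    rcases pos_or_neg_of_ne_zero hS₀.surface.connected.isPreconnected hratio
      (fun p hp => areaRatio_ne_zero hsΩ hsT hne₁ (hf.differentiable (by simp))
        (hk.differentiable (by simp)) hfS hkS hkf hfk hp) with h | h
    · exact exists_equivariant_contacto_of_areaRatio_pos hu.smooth hu.involutive hS₀.surface
        hS₁.surface hS₀.area.mapsTo hθ₀ hθ₁ hne₀ hne₁ hSU₀ hSU₁ hα₀ hα₁ (hX₀.congr_form hθΩ₀)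
        (hX₁.congr_form hθΩ₁) hf hfS hfinj hfu hl hl0 hlX hs hs0 hsΩ hsT h
    -- With a negative ratio, `(Ω₁, α₁)` is replaced by `(-Ω₁, -α₁)`: the ratio becomes positive
    -- while `X₁` and `ker α₁` stay the same.
    · obtain ⟨ψ, h1, h2, h3, h4, h5⟩ := exists_equivariant_contacto_of_areaRatio_pos hu.smooth
        hu.involutive hS₀.surface hS₁.surface hS₀.area.mapsTo hθ₀ hθ₁.neg hne₀
        (fun p hp => by
          obtain ⟨v, hv, w, hw, hvw⟩ := hne₁ p hp
          exact ⟨v, hv, w, hw, neg_ne_zero.2 hvw⟩)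
        hSU₀ hSU₁ hα₀ hα₁.neg (hX₀.congr_form hθΩ₀)
        (hX₁.congr_form hθΩ₁).neg hf hfS hfinj hfu hl hl0 hlX hs hs0 hsΩ hsT
        (fun p hp => by
          have := areaRatio_neg (s₀ := s) (Ω₀ := θ₀) (Ω₁ := θ₁) (f := f) p
          exact this.symm ▸ neg_pos.2 (h p hp))
      exact ⟨ψ, h1, h2, h3, h4.of_neg, h5⟩
  obtain ⟨ψ, h1, h2, h3, h4, h5⟩ := key
  refine ⟨ψ, h1, h2, fun q hq => ?_, h3, h4, fun p hp => (h5 hp).trans (hfφ hp)⟩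
  rw [← hfk q hq, ← h5 (hkS hq)]
  exact ψ.map_source (h1 (hkS hq))
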